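/- Let $e_1,e_2,e_3$ be nonzero integers with $e_1+e_2+e_3=0$, where $e_1,e_2$ are odd, $2\mid e_3$ and $4\nmid e_3$. For a positive square-free integer $n$ let $E^{(n)}: y^2=x(x-e_1n)(x+e_2n)$ over $\mathbb Q$, and $E=E^{(1)}$. For nonzero rationals $d_1,d_2,d_3$ with $d_1d_2d_3\in\mathbb Q^{\times 2}$ and $\Lambda=(d_1,d_2,d_3)$, let $D^{(n)}_\Lambda\subset\mathbb P^3$ be the curve $$e_1nt^2+d_2u_2^2-d_3u_3^2=0,\quad e_2nt^2+d_3u_3^2-d_1u_1^2=0,\quad e_3nt^2+d_1u_1^2-d_2u_2^2=0.$$ The $2$-Selmer group $\mathrm{Sel}_2(E^{(n)})$ is the group of classes $\Lambda\in(\mathbb Q^\times/\mathbb Q^{\times2})^3$ with $d_1d_2d_3\in\mathbb Q^{\times2}$ such that $D^{(n)}_\Lambda$ has a point over $\mathbb R$ and over $\mathbb Q_q$ for every prime $q$. The map $(x,y)\mapsto(x+e_2n,\,x-e_1n,\,x)$ (where a vanishing coordinate is replaced by the product of the other two) defines a homomorphism $E^{(n)}(\mathbb Q)\to\mathrm{Sel}_2(E^{(n)})$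 that induces an injection of $E^{(n)}(\mathbb Q)/2E^{(n)}(\mathbb Q)$. The pure $2$-Selmer group is $$\mathrm{Sel}_2'(E^{(n)})=\mathrm{Sel}_2(E^{(n)})\big/\bigl(E^{(n)}(\mathbb Q)_{\mathrm{tors}}/2E^{(n)}(\mathbb Q)_{\mathrm{tors}}\bigr).$$ Let $n=p_1\cdots p_k$ be an odd positive square-free integer, coprime to $e_1e_2e_3$, each of whose prime factors is a quadratic residue modulo every odd prime factor of $e_1e_2e_3$. Write $[\alpha,\beta]_p\in\mathbb F_2$ for the additive Hilbert symbol over $\mathbb Q_p$, and put $$\mathbf A=\bigl([p_j,-n]_{p_i}\bigr)_{i,j},\qquad \mathbf D_u=\mathrm{diag}\Bigl(\Bigl[\tfrac{u}{p_1}\Bigr],\dots,\Bigl[\tfrac{u}{p_k}\Bigr]\Bigr)\in M_k(\mathbb F_2),$$ where $\bigl[\tfrac{u}{p}\bigr]\in\mathbb F_2$ is defined by $(-1)^{[u/p]}=\bigl(\tfrac{u}{p}\bigr)$. Assume that $\mathrm{Sel}_2(E)\cong(\mathbb Z/2\mathbb Z)^2$. Then: 1. Every element of $\mathrm{Sel}_2'(E^{(n)})$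 is represented by exactly one triple $(d_1,d_2,d_3)$ of positive divisors of $n$ whose class lies in $\mathrm{Sel}_2(E^{(n)})$. Sending such a triple to $\binom{\mathbf x}{\mathbf y}$, where $x_i=v_{p_i}(d_1)$ and $y_i=v_{p_i}(d_2)$ modulo $2$, gives a group isomorphism $$\mathrm{Sel}_2'(E^{(n)})\ \xrightarrow{\ \sim\ }\ \mathrm{Ker}\begin{pmatrix}\mathbf A+\mathbf D_{-e_3}&\mathbf D_{-e_2e_3}\\ \mathbf D_{-e_1e_3}&\mathbf A+\mathbf D_{e_3}\end{pmatrix}\subseteq\mathbb F_2^{2k}.$$ 2. If $d_1,d_2,d_3$ are odd square-free integers whose product is a square, and $D^{(n)}_\Lambda$ has a point over $\mathbb R$ and over $\mathbb Q_q$ for every odd prime $q$, then it has a point over $\mathbb Q_2$. -/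

import Mathlib

namespace TwoDescent

/-- The group `Kˣ / Kˣ²` of square classes of a field. -/
def SqClass (K : Type) [Field K] : Type :=
  Kˣ ⧸ (powMonoidHom 2 : Kˣ →* Kˣ).range

noncomputable instance (K : Type) [Field K] : CommGroup (SqClass K) :=
  inferInstanceAs (CommGroup (Kˣ ⧸ (powMonoidHom 2 : Kˣ →* Kˣ).range))

/-- The quotient map `Kˣ → Kˣ / Kˣ²`. -/
noncomputable def SqClass.mk (K : Type) [Field K] : Kˣ →* SqClass K :=
  QuotientGroup.mk' (powMonoidHom 2 : Kˣ →* Kˣ).range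

theorem SqClass.mk_surjective (K : Type) [Field K] : Function.Surjective (SqClass.mk K) :=
  QuotientGroup.mk'_surjective _

theorem SqClass.mk_eq_one_iff {K : Type} [Field K] (u : Kˣ) :
    SqClass.mk K u = 1 ↔ u ∈ (powMonoidHom 2 : Kˣ →* Kˣ).range :=
  QuotientGroup.eq_one_iff u

open Classical in
/-- The square class of a nonzero element of `K` (with the value `1` at `0`, never used). -/
noncomputable def sq {K : Type} [Field K] (x : K) : SqClass K :=
  if h : x ≠ 0 then SqClass.mk K (Units.mk0 x h) else 1

theorem sq_unit {K : Type} [Field K] (u : Kˣ) : sq (u : K) = SqClass.mk K u := by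
  simp [sq]

theorem exists_unit {K : Type} [Field K] (c : SqClass K) : ∃ u : Kˣ, sq (u : K) = c := by
  obtain ⟨u, rfl⟩ := SqClass.mk_surjective K c
  exact ⟨u, sq_unit u⟩

theorem sq_mul {K : Type} [Field K] {x y : K} (hx : x ≠ 0) (hy : y ≠ 0) :
    sq (x * y) = sq x * sq y := by
  have h := sq_unit (Units.mk0 x hx * Units.mk0 y hy)
  rw [Units.val_mul, map_mul, ← sq_unit, ← sq_unit] at h
  simpa using h

theorem sq_eq_one_iff {K : Type} [Field K] {x : K} (hx : x ≠ 0) :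
    sq x = 1 ↔ ∃ c : K, c ≠ 0 ∧ x = c ^ 2 := by
  have h := sq_unit (Units.mk0 x hx)
  rw [Units.val_mk0] at h
  rw [h, SqClass.mk_eq_one_iff]
  constructor
  · rintro ⟨c, hc⟩
    refine ⟨c, c.ne_zero, ?_⟩
    have := congrArg Units.val hc
    simpa using this.symm
  · rintro ⟨c, hc, hxc⟩
    refine ⟨Units.mk0 c hc, ?_⟩
    ext
    simp [hxc]

theorem sqClass_mul_self {K : Type} [Field K] (c : SqClass K) : c * c = 1 := by
  obtain ⟨u, rfl⟩ := exists_unit c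
  rw [← sq_mul u.ne_zero u.ne_zero, sq_eq_one_iff (mul_ne_zero u.ne_zero u.ne_zero)]
  exact ⟨u, u.ne_zero, by ring⟩

theorem sqClass_inv {K : Type} [Field K] (c : SqClass K) : c⁻¹ = c :=
  inv_eq_of_mul_eq_one_left (sqClass_mul_self c)

theorem sq_eq_iff {K : Type} [Field K] {x y : K} (hx : x ≠ 0) (hy : y ≠ 0) :
    sq x = sq y ↔ ∃ c : K, c ≠ 0 ∧ y = x * c ^ 2 := by
  have h1 : sq x = sq y ↔ sq (x * y) = 1 := by
    rw [sq_mul hx hy, mul_eq_one_iff_eq_inv, sqClass_inv]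
  rw [h1, sq_eq_one_iff (mul_ne_zero hx hy)]
  constructor
  · rintro ⟨c, hc, h⟩
    refine ⟨c / x, div_ne_zero hc hx, ?_⟩
    field_simp
    rw [← h]
    ring
  · rintro ⟨c, hc, h⟩
    exact ⟨x * c, mul_ne_zero hx hc, by rw [h]; ring⟩

/-- The affine Weierstrass curve `y² = x (x - a) (x + b)`. -/
def curve {K : Type} [Field K] (a b : K) : WeierstrassCurve.Affine K :=
  { a₁ := 0, a₂ := b - a, a₃ := 0, a₄ := -(a * b), a₆ := 0 }

theorem curve_equation {K : Type} [Field K] (a b x y : K) :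
    (curve a b).Equation x y ↔ y ^ 2 = x * (x - a) * (x + b) := by
  rw [WeierstrassCurve.Affine.equation_iff]
  simp only [curve]
  constructor <;> intro h <;> linear_combination h

theorem curve_nonsingular {K : Type} [Field K] [CharZero K] {a b : K} (ha : a ≠ 0) (hb : b ≠ 0)
    (hab : a + b ≠ 0) {x y : K} (h : y ^ 2 = x * (x - a) * (x + b)) :
    (curve a b).Nonsingular x y := by
  refine (WeierstrassCurve.Affine.equation_iff_nonsingular_of_Δ_ne_zero ?_).1
    ((curve_equation a b x y).2 h)
  have : (curve a b).Δ = 16 * (a * b * (a + b)) ^ 2 := by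
    simp only [curve, WeierstrassCurve.Δ, WeierstrassCurve.b₂, WeierstrassCurve.b₄,
      WeierstrassCurve.b₆, WeierstrassCurve.b₈]
    ring
  rw [this]
  exact mul_ne_zero (by norm_num) (pow_ne_zero 2 (mul_ne_zero (mul_ne_zero ha hb) hab))

open Classical in
/-- The component at the root `r` of the descent map of `y² = (x - r) (x - s) (x - t)`:
the class of `x - r`, replaced by the class of `(r - s) (r - t)` when `x = r`. -/
noncomputable def comp {K : Type} [Field K] (r s t x : K) : SqClass K :=
  if x = r then sq ((r - s) * (r - t)) else sq (x - r)

/-- The descent map `E(K) → (Kˣ/Kˣ²)³`, `(x, y) ↦ (x + b, x - a, x)`, of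
`E : y² = x (x - a) (x + b)`. -/
noncomputable def descentFun {K : Type} [Field K] (a b : K) :
    (curve a b).Point → SqClass K × SqClass K × SqClass K
  | .zero => 1
  | .some x _ _ => (comp (-b) a 0 x, comp a (-b) 0 x, comp 0 a (-b) x)

theorem comp_mul_aux {K : Type} [Field K] {r s t l m x₂ x₃ : K} (hs : r ≠ s) (ht : r ≠ t)
    (h1 : r + x₂ + x₃ = r + s + t + l ^ 2)
    (h2 : r * x₂ + r * x₃ + x₂ * x₃ = r * s + r * t + s * t - 2 * l * m)
    (h3 : r * x₂ * x₃ = r * s * t + m ^ 2) :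
    comp r s t r * comp r s t x₂ * comp r s t x₃ = 1 := by
  have e1 : l * r + m = 0 := by
    have : (l * r + m) ^ 2 = 0 := by linear_combination r * h2 - h3 - r ^ 2 * h1
    exact pow_eq_zero_iff (two_ne_zero) |>.1 this
  have e2 : (r - s) * (r - t) = (x₂ - r) * (x₃ - r) := by
    linear_combination 2 * l * e1 + 2 * r * h1 - h2
  have hne : (r - s) * (r - t) ≠ 0 := mul_ne_zero (sub_ne_zero.2 hs) (sub_ne_zero.2 ht)
  have hne' := hne
  rw [e2] at hne'
  have n2 := left_ne_zero_of_mul hne'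
  have n3 := right_ne_zero_of_mul hne'
  rw [comp, if_pos rfl, comp, if_neg (sub_ne_zero.1 n2), comp, if_neg (sub_ne_zero.1 n3),
    mul_assoc, ← sq_mul n2 n3, ← e2, sqClass_mul_self]

theorem comp_mul {K : Type} [Field K] {r s t l m x₁ x₂ x₃ : K} (hs : r ≠ s) (ht : r ≠ t)
    (h1 : x₁ + x₂ + x₃ = r + s + t + l ^ 2)
    (h2 : x₁ * x₂ + x₁ * x₃ + x₂ * x₃ = r * s + r * t + s * t - 2 * l * m)
    (h3 : x₁ * x₂ * x₃ = r * s * t + m ^ 2) :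
    comp r s t x₁ * comp r s t x₂ * comp r s t x₃ = 1 := by
  by_cases c1 : x₁ = r
  · subst c1
    exact comp_mul_aux hs ht h1 h2 h3
  by_cases c2 : x₂ = r
  · subst c2
    rw [mul_comm (comp x₂ s t x₁)]
    exact comp_mul_aux (l := l) (m := m) hs ht (by linear_combination h1)
      (by linear_combination h2) (by linear_combination h3)
  by_cases c3 : x₃ = r
  · subst c3
    rw [mul_comm (_ * _), ← mul_assoc]
    exact comp_mul_aux (l := l) (m := m) hs ht (by linear_combination h1)
      (by linear_combination h2) (by linear_combination h3)
  have n1 := sub_ne_zero.2 c1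
  have n2 := sub_ne_zero.2 c2
  have n3 := sub_ne_zero.2 c3
  have hp : (x₁ - r) * (x₂ - r) * (x₃ - r) = (l * r + m) ^ 2 := by
    linear_combination h3 - r * h2 + r ^ 2 * h1
  rw [comp, if_neg c1, comp, if_neg c2, comp, if_neg c3, ← sq_mul n1 n2,
    ← sq_mul (mul_ne_zero n1 n2) n3, sq_eq_one_iff (mul_ne_zero (mul_ne_zero n1 n2) n3)]
  refine ⟨l * r + m, ?_, hp⟩
  intro h0
  rw [h0] at hp
  exact mul_ne_zero (mul_ne_zero n1 n2) n3 (by rw [hp]; ring)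

theorem descentFun_add {K : Type} [Field K] [DecidableEq K] {a b : K} (ha : a ≠ 0) (hb : b ≠ 0)
    (hab : a + b ≠ 0) (P Q : (curve a b).Point) :
    descentFun a b (P + Q) = descentFun a b P * descentFun a b Q := by
  have hself : ∀ c : SqClass K × SqClass K × SqClass K, c * c = 1 := fun c => by
    ext <;> exact sqClass_mul_self _
  rcases P with _ | ⟨x₁, y₁, h₁⟩
  · rw [← WeierstrassCurve.Affine.Point.zero_def, zero_add]
    exact (one_mul (descentFun a b _)).symm
  rcases Q with _ | ⟨x₂, y₂, h₂⟩
  · rw [← WeierstrassCurve.Affine.Point.zero_def, add_zero]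
    exact (mul_one (descentFun a b _)).symm
  by_cases hxy : x₁ = x₂ ∧ y₁ = (curve a b).negY x₂ y₂
  · rw [WeierstrassCurve.Affine.Point.add_of_Y_eq hxy.1 hxy.2]
    obtain ⟨rfl, -⟩ := hxy
    exact (hself (comp (-b) a 0 x₁, comp a (-b) 0 x₁, comp 0 a (-b) x₁)).symm
  rw [WeierstrassCurve.Affine.Point.add_some hxy]
  have key := WeierstrassCurve.Affine.addPolynomial_slope h₁.1 h₂.1 hxy
  simp only [descentFun]
  generalize WeierstrassCurve.Affine.slope (curve a b) x₁ x₂ y₁ y₂ = l at key ⊢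
  generalize WeierstrassCurve.Affine.addX (curve a b) x₁ x₂ l = x₃ at key ⊢
  rw [WeierstrassCurve.Affine.addPolynomial_eq, neg_inj, Cubic.prod_X_sub_C_eq,
    Cubic.toPoly_injective] at key
  simp only [curve, Cubic.mk.injEq] at key
  obtain ⟨-, k1, k2, k3⟩ := key
  have fin : ∀ c₁ c₂ c₃ : SqClass K, c₁ * c₂ * c₃ = 1 → c₃ = c₁ * c₂ := fun c₁ c₂ c₃ h => by
    rw [mul_eq_one_iff_eq_inv] at h
    rw [h, sqClass_inv]
  have hab' : -b ≠ a := fun h => hab (by rw [← h]; ring)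
  refine Prod.ext (fin _ _ _ ?_) (Prod.ext (fin _ _ _ ?_) (fin _ _ _ ?_))
  · refine comp_mul (l := l) (m := y₁ - l * x₁) hab' (neg_ne_zero.2 hb) ?_ ?_ ?_
    · linear_combination k1
    · linear_combination -k2
    · linear_combination k3
  · refine comp_mul (l := l) (m := y₁ - l * x₁) hab'.symm ha ?_ ?_ ?_
    · linear_combination k1
    · linear_combination -k2
    · linear_combination k3
  · refine comp_mul (l := l) (m := y₁ - l * x₁) ha.symm (neg_ne_zero.2 hb).symm ?_ ?_ ?_
    · linear_combination k1
    · linear_combination -k2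
    · linear_combination k3

/-- The projective curve
`e₁ t² + d₂ u₂² - d₃ u₃² = 0`, `e₂ t² + d₃ u₃² - d₁ u₁² = 0`, `e₃ t² + d₁ u₁² - d₂ u₂² = 0`
has a `K`-rational point `[t : u₁ : u₂ : u₃]`. -/
def HasPoint {K : Type} [Field K] (e₁ e₂ e₃ d₁ d₂ d₃ : K) : Prop :=
  ∃ t u₁ u₂ u₃ : K, ¬ (t = 0 ∧ u₁ = 0 ∧ u₂ = 0 ∧ u₃ = 0) ∧
    e₁ * t ^ 2 + d₂ * u₂ ^ 2 - d₃ * u₃ ^ 2 = 0 ∧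
    e₂ * t ^ 2 + d₃ * u₃ ^ 2 - d₁ * u₁ ^ 2 = 0 ∧
    e₃ * t ^ 2 + d₁ * u₁ ^ 2 - d₂ * u₂ ^ 2 = 0

theorem HasPoint.of_rep {K : Type} [Field K] {e₁ e₂ e₃ d₁ d₂ d₃ d₁' d₂' d₃' : K}
    (h₁ : d₁ ≠ 0) (h₂ : d₂ ≠ 0) (h₃ : d₃ ≠ 0) (h₁' : d₁' ≠ 0) (h₂' : d₂' ≠ 0) (h₃' : d₃' ≠ 0)
    (s₁ : sq d₁ = sq d₁') (s₂ : sq d₂ = sq d₂') (s₃ : sq d₃ = sq d₃')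
    (h : HasPoint e₁ e₂ e₃ d₁ d₂ d₃) : HasPoint e₁ e₂ e₃ d₁' d₂' d₃' := by
  obtain ⟨c₁, hc₁, rfl⟩ := (sq_eq_iff h₁' h₁).1 s₁.symm
  obtain ⟨c₂, hc₂, rfl⟩ := (sq_eq_iff h₂' h₂).1 s₂.symm
  obtain ⟨c₃, hc₃, rfl⟩ := (sq_eq_iff h₃' h₃).1 s₃.symm
  obtain ⟨t, u₁, u₂, u₃, h0, k₁, k₂, k₃⟩ := h
  refine ⟨t, c₁ * u₁, c₂ * u₂, c₃ * u₃, ?_, ?_, ?_, ?_⟩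
  · simpa [hc₁, hc₂, hc₃] using h0
  · linear_combination k₁
  · linear_combination k₂
  · linear_combination k₃

/-- A point of `E(K)` gives a rational point on the homogeneous space of its image. -/
theorem hasPoint_of_descentFun {K : Type} [Field K] {a b e₃ : K} (ha : a ≠ 0) (hb : b ≠ 0)
    (hab : a + b + e₃ = 0) (he : e₃ ≠ 0) (P : (curve a b).Point) :
    ∃ d₁ d₂ d₃ : K, d₁ ≠ 0 ∧ d₂ ≠ 0 ∧ d₃ ≠ 0 ∧ descentFun a b P = (sq d₁, sq d₂, sq d₃) ∧
      HasPoint a b e₃ d₁ d₂ d₃ ∧ sq d₁ * sq d₂ * sq d₃ = 1 := by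
  have he' : e₃ = -a - b := by linear_combination hab
  have hs : a + b ≠ 0 := fun h => he (by rw [he']; linear_combination -h)
  have hs' : a - -b ≠ 0 := by rwa [sub_neg_eq_add]
  have hs'' : -b - a ≠ 0 := fun h => hs (by linear_combination -h)
  have h1 : sq (1 : K) = 1 := (sq_eq_one_iff one_ne_zero).2 ⟨1, one_ne_zero, by ring⟩
  rcases P with _ | ⟨x, y, h⟩
  · refine ⟨1, 1, 1, one_ne_zero, one_ne_zero, one_ne_zero, ?_, ⟨0, 1, 1, 1, ?_, ?_, ?_, ?_⟩, ?_⟩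
    · rw [h1]; rfl
    · simp
    · ring
    · ring
    · ring
    · simp [h1]
  have hE := (curve_equation a b x y).1 h.1
  have prod1 : ∀ {p q r w : K}, p ≠ 0 → q ≠ 0 → r ≠ 0 → p * q * r = w ^ 2 →
      sq p * sq q * sq r = 1 := by
    intro p q r w hp hq hr hw
    have hn := mul_ne_zero (mul_ne_zero hp hq) hr
    rw [← sq_mul hp hq, ← sq_mul (mul_ne_zero hp hq) hr, sq_eq_one_iff hn]
    exact ⟨w, fun h0 => hn (by rw [hw, h0]; ring), hw⟩
  by_cases c₁ : x = -b
  · subst c₁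
    refine ⟨(-b - a) * (-b - 0), -b - a, -b - 0, by simp [hb, hs''], hs'', by simp [hb], ?_,
      ⟨1, 0, 1, 1, by simp, ?_, ?_, ?_⟩, ?_⟩
    · simp only [descentFun, comp, if_true, if_neg (sub_ne_zero.1 hs''), if_neg (neg_ne_zero.2 hb)]
    · ring
    · ring
    · rw [he']; ring
    · exact prod1 (w := (-b - a) * (-b - 0)) (by simp [hb, hs'']) hs'' (by simp [hb]) (by ring)
  by_cases c₂ : x = a
  · subst c₂
    refine ⟨x - -b, (x - -b) * (x - 0), x - 0, hs', by simpa [ha] using hs', by simpa using ha, ?_,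
      ⟨1, 1, 0, 1, by simp, ?_, ?_, ?_⟩, ?_⟩
    · simp only [descentFun, comp, if_true, if_neg c₁, if_neg ha]
    · ring
    · ring
    · rw [he']; ring
    · exact prod1 (w := (x - -b) * (x - 0)) hs' (by simpa [ha] using hs') (by simpa using ha)
        (by ring)
  by_cases c₃ : x = 0
  · subst c₃
    refine ⟨0 - -b, 0 - a, (0 - a) * (0 - -b), by simpa using hb, by simpa using ha,
      by simp [ha, hb], ?_, ⟨1, 1, 1, 0, by simp, ?_, ?_, ?_⟩, ?_⟩
    · simp only [descentFun, comp, if_true, if_neg c₁, if_neg c₂]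
    · ring
    · ring
    · rw [he']; ring
    · exact prod1 (w := (0 - a) * (0 - -b)) (by simpa using hb) (by simpa using ha)
        (by simp [ha, hb]) (by ring)
  · refine ⟨x - -b, x - a, x - 0, sub_ne_zero.2 c₁, sub_ne_zero.2 c₂, sub_ne_zero.2 c₃, ?_,
      ⟨1, 1, 1, 1, by simp, ?_, ?_, ?_⟩, ?_⟩
    · simp only [descentFun, comp, if_neg c₁, if_neg c₂, if_neg c₃]
    · ring
    · ring
    · rw [he']; ring
    · exact prod1 (w := y) (sub_ne_zero.2 c₁) (sub_ne_zero.2 c₂) (sub_ne_zero.2 c₃)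
        (by rw [hE]; ring)

/-- A rational point on a homogeneous space comes from a point of `E(K)`. -/
theorem exists_descentFun {K : Type} [Field K] [CharZero K] {a b e₃ d₁ d₂ d₃ : K} (ha : a ≠ 0)
    (hb : b ≠ 0) (hab : a + b + e₃ = 0) (he : e₃ ≠ 0) (h₁ : d₁ ≠ 0) (h₂ : d₂ ≠ 0) (h₃ : d₃ ≠ 0)
    (hd : IsSquare (d₁ * d₂ * d₃)) (h : HasPoint a b e₃ d₁ d₂ d₃) :
    ∃ P : (curve a b).Point, descentFun a b P = (sq d₁, sq d₂, sq d₃) := by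
  have he' : e₃ = -a - b := by linear_combination hab
  have hs : a + b ≠ 0 := fun h => he (by rw [he']; linear_combination -h)
  obtain ⟨w, hw⟩ := hd
  have hw0 : w ≠ 0 := by
    rintro rfl
    exact mul_ne_zero (mul_ne_zero h₁ h₂) h₃ (by rw [hw]; ring)
  obtain ⟨t, u₁, u₂, u₃, h0, k₁, k₂, k₃⟩ := h
  by_cases ht : t = 0
  · subst ht
    refine ⟨.zero, ?_⟩
    have q₂ : d₂ * u₂ ^ 2 = d₃ * u₃ ^ 2 := by linear_combination k₁
    have q₁ : d₁ * u₁ ^ 2 = d₃ * u₃ ^ 2 := by linear_combination -k₂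
    have n₃ : u₃ ≠ 0 := by
      rintro rfl
      apply h0
      simp_all
    have n : d₃ * u₃ ^ 2 ≠ 0 := mul_ne_zero h₃ (pow_ne_zero 2 n₃)
    have n₁ : u₁ ≠ 0 := by
      rintro rfl
      exact n (by rw [← q₁]; ring)
    have n₂ : u₂ ≠ 0 := by
      rintro rfl
      exact n (by rw [← q₂]; ring)
    have s₁ : sq d₁ = sq (d₃ * u₃ ^ 2) := (sq_eq_iff h₁ n).2 ⟨u₁, n₁, q₁.symm⟩
    have s₂ : sq d₂ = sq (d₃ * u₃ ^ 2) := (sq_eq_iff h₂ n).2 ⟨u₂, n₂, q₂.symm⟩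
    have s₃ : sq d₃ = sq (d₃ * u₃ ^ 2) := (sq_eq_iff h₃ n).2 ⟨u₃, n₃, rfl⟩
    have hp : sq d₁ * sq d₂ * sq d₃ = 1 := by
      rw [← sq_mul h₁ h₂, ← sq_mul (mul_ne_zero h₁ h₂) h₃,
        sq_eq_one_iff (mul_ne_zero (mul_ne_zero h₁ h₂) h₃)]
      exact ⟨w, hw0, by rw [hw]; ring⟩
    rw [s₁, s₂, s₃, sqClass_mul_self, one_mul] at hp
    rw [s₁, s₂, s₃, hp]
    rfl
  have hx₁ : d₁ * u₁ ^ 2 / t ^ 2 = d₃ * u₃ ^ 2 / t ^ 2 - -b := by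
    field_simp
    linear_combination -k₂
  have hx₂ : d₂ * u₂ ^ 2 / t ^ 2 = d₃ * u₃ ^ 2 / t ^ 2 - a := by
    field_simp
    linear_combination k₁
  have hx₃ : d₃ * u₃ ^ 2 / t ^ 2 = d₃ * u₃ ^ 2 / t ^ 2 - 0 := by ring
  have hy : (w * u₁ * u₂ * u₃ / t ^ 3) ^ 2 = (d₃ * u₃ ^ 2 / t ^ 2) * (d₃ * u₃ ^ 2 / t ^ 2 - a) *
      (d₃ * u₃ ^ 2 / t ^ 2 + b) := by
    rw [← sub_neg_eq_add _ b, ← hx₁, ← hx₂]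
    field_simp
    linear_combination -(u₁ ^ 2 * u₂ ^ 2 * u₃ ^ 2) * hw
  refine ⟨.some _ _ (curve_nonsingular ha hb hs hy), ?_⟩
  have hne : ∀ {d u r s' : K}, d ≠ 0 → d * u ^ 2 / t ^ 2 = r - s' → r ≠ s' →
      sq (r - s') = sq d := by
    intro d u r s' hd0 hr hrs
    refine ((sq_eq_iff hd0 (sub_ne_zero.2 hrs)).2 ⟨u / t, ?_, ?_⟩).symm
    · intro hu
      apply hrs
      rw [← sub_eq_zero, ← hr]
      have : u = 0 := by simpa [ht] using hu
      simp [this]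
    · rw [← hr]; field_simp
  have hprod : ∀ {p q r : K}, p ≠ 0 → q ≠ 0 → r ≠ 0 → p * q * r = w * w →
      sq p * sq q = sq r := by
    intro p q r hp hq hr hpq
    rw [← sq_mul hp hq]
    refine ((sq_eq_iff hr (mul_ne_zero hp hq)).2 ⟨w / r, div_ne_zero hw0 hr, ?_⟩).symm
    field_simp
    linear_combination hpq
  simp only [descentFun]
  obtain ⟨x, hx⟩ : ∃ x, x = d₃ * u₃ ^ 2 / t ^ 2 := ⟨_, rfl⟩
  rw [← hx] at hx₁ hx₂ ⊢
  replace hx₃ : d₃ * u₃ ^ 2 / t ^ 2 = x - 0 := by rw [← hx, sub_zero]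
  clear hx hy
  have hbz : -b ≠ 0 := neg_ne_zero.2 hb
  have hba : -b ≠ a := fun h => hs (by linear_combination -h)
  by_cases c₁ : x = -b
  · have a₂ := hne h₂ hx₂ (by rwa [c₁])
    have a₃ := hne h₃ hx₃ (by rwa [c₁])
    subst c₁
    rw [comp, if_pos rfl, comp, if_neg hba, comp, if_neg hbz, a₂, a₃,
      sq_mul (sub_ne_zero.2 hba) (sub_ne_zero.2 hbz), a₂, a₃,
      hprod h₂ h₃ h₁ (by linear_combination hw)]
  by_cases c₂ : x = a
  · have a₁ := hne h₁ hx₁ (by rw [c₂]; exact hba.symm)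
    have a₃ := hne h₃ hx₃ (by rwa [c₂])
    subst c₂
    rw [comp, if_neg c₁, comp, if_pos rfl, comp, if_neg ha, a₁, a₃,
      sq_mul (sub_ne_zero.2 c₁) (sub_ne_zero.2 ha), a₁, a₃,
      hprod h₁ h₃ h₂ (by linear_combination hw)]
  have a₁ := hne h₁ hx₁ c₁
  have a₂ := hne h₂ hx₂ c₂
  by_cases c₃ : x = 0
  · subst c₃
    rw [comp, if_neg c₁, comp, if_neg c₂, comp, if_pos rfl, a₁, a₂,
      sq_mul (sub_ne_zero.2 c₂) (sub_ne_zero.2 c₁), a₁, a₂,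
      hprod h₂ h₁ h₃ (by linear_combination hw)]
  · rw [comp, if_neg c₁, comp, if_neg c₂, comp, if_neg c₃, a₁, a₂, hne h₃ hx₃ c₃]

theorem HasPoint.mul {K : Type} [Field K] [CharZero K] {e₁ e₂ e₃ d₁ d₂ d₃ d₁' d₂' d₃' : K}
    (he₁ : e₁ ≠ 0) (he₂ : e₂ ≠ 0) (he₃ : e₃ ≠ 0) (he : e₁ + e₂ + e₃ = 0)
    (h₁ : d₁ ≠ 0) (h₂ : d₂ ≠ 0) (h₃ : d₃ ≠ 0) (h₁' : d₁' ≠ 0) (h₂' : d₂' ≠ 0) (h₃' : d₃' ≠ 0)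
    (hd : IsSquare (d₁ * d₂ * d₃)) (hd' : IsSquare (d₁' * d₂' * d₃'))
    (h : HasPoint e₁ e₂ e₃ d₁ d₂ d₃) (h' : HasPoint e₁ e₂ e₃ d₁' d₂' d₃') :
    HasPoint e₁ e₂ e₃ (d₁ * d₁') (d₂ * d₂') (d₃ * d₃') := by
  classical
  have hs : e₁ + e₂ ≠ 0 := fun h0 => he₃ (by linear_combination he - h0)
  obtain ⟨P, hP⟩ := exists_descentFun he₁ he₂ he he₃ h₁ h₂ h₃ hd h
  obtain ⟨Q, hQ⟩ := exists_descentFun he₁ he₂ he he₃ h₁' h₂' h₃' hd' h'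
  obtain ⟨f₁, f₂, f₃, n₁, n₂, n₃, hf, hpt, -⟩ := hasPoint_of_descentFun he₁ he₂ he he₃ (P + Q)
  rw [descentFun_add he₁ he₂ hs, hP, hQ, Prod.mk_mul_mk, Prod.mk_mul_mk, ← sq_mul h₁ h₁',
    ← sq_mul h₂ h₂', ← sq_mul h₃ h₃', Prod.mk.injEq, Prod.mk.injEq] at hf
  exact hpt.of_rep n₁ n₂ n₃ (mul_ne_zero h₁ h₁') (mul_ne_zero h₂ h₂') (mul_ne_zero h₃ h₃')
    hf.1.symm hf.2.1.symm hf.2.2.symm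

/-- Nonzero integers `e₁, e₂, e₃` with `e₁ + e₂ + e₃ = 0`. -/
structure Coeffs where
  e₁ : ℤ
  e₂ : ℤ
  e₃ : ℤ
  ne₁ : e₁ ≠ 0
  ne₂ : e₂ ≠ 0
  ne₃ : e₃ ≠ 0
  sum_eq : e₁ + e₂ + e₃ = 0

/-- The triple `(e₁ n, e₂ n, e₃ n)`, which belongs to the quadratic twist by `n`. -/
def Coeffs.twist (e : Coeffs) (n : ℕ) (hn : n ≠ 0) : Coeffs where
  e₁ := e.e₁ * n
  e₂ := e.e₂ * n
  e₃ := e.e₃ * n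
  ne₁ := mul_ne_zero e.ne₁ (Int.natCast_ne_zero.2 hn)
  ne₂ := mul_ne_zero e.ne₂ (Int.natCast_ne_zero.2 hn)
  ne₃ := mul_ne_zero e.ne₃ (Int.natCast_ne_zero.2 hn)
  sum_eq := by rw [← add_mul, ← add_mul, e.sum_eq, zero_mul]

/-- The group `E(ℚ)` for `E : y² = x (x - e₁) (x + e₂)`. -/
abbrev Coeffs.Points (e : Coeffs) : Type := (curve (e.e₁ : ℚ) (e.e₂ : ℚ)).Point

/-- `D_Λ(K) ≠ ∅`, where `D_Λ` is the homogeneous space of `E` attached to `Λ = (d₁, d₂, d₃)`. -/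
def Coeffs.Solvable (e : Coeffs) (K : Type) [Field K] (d₁ d₂ d₃ : ℚ) : Prop :=
  HasPoint (K := K) ((e.e₁ : ℚ) : K) ((e.e₂ : ℚ) : K) ((e.e₃ : ℚ) : K) (d₁ : K) (d₂ : K) (d₃ : K)

/-- `D_Λ(𝔸_ℚ) ≠ ∅`: the projective curve `D_Λ` has points over `ℝ` and over every `ℚ_p`. -/
def Coeffs.EverywhereSolvable (e : Coeffs) (d₁ d₂ d₃ : ℚ) : Prop :=
  e.Solvable ℝ d₁ d₂ d₃ ∧ ∀ (p : ℕ) [Fact p.Prime], e.Solvable ℚ_[p] d₁ d₂ d₃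

theorem Coeffs.Solvable.mul {e : Coeffs} {K : Type} [Field K] [CharZero K] {d₁ d₂ d₃ : ℚ}
    {d₁' d₂' d₃' : ℚ} (h₁ : d₁ ≠ 0) (h₂ : d₂ ≠ 0) (h₃ : d₃ ≠ 0) (h₁' : d₁' ≠ 0) (h₂' : d₂' ≠ 0)
    (h₃' : d₃' ≠ 0) (hd : IsSquare (d₁ * d₂ * d₃)) (hd' : IsSquare (d₁' * d₂' * d₃'))
    (h : e.Solvable K d₁ d₂ d₃) (h' : e.Solvable K d₁' d₂' d₃') :
    e.Solvable K (d₁ * d₁') (d₂ * d₂') (d₃ * d₃') := by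
  have hs : ((e.e₁ : ℚ) : K) + ((e.e₂ : ℚ) : K) + ((e.e₃ : ℚ) : K) = 0 := by
    exact_mod_cast congrArg (Int.cast (R := K)) e.sum_eq
  have k₁ : ((e.e₁ : ℚ) : K) ≠ 0 := by exact_mod_cast e.ne₁
  have k₂ : ((e.e₂ : ℚ) : K) ≠ 0 := by exact_mod_cast e.ne₂
  have k₃ : ((e.e₃ : ℚ) : K) ≠ 0 := by exact_mod_cast e.ne₃
  have := HasPoint.mul k₁ k₂ k₃ hs (Rat.cast_ne_zero.2 h₁) (Rat.cast_ne_zero.2 h₂)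
    (Rat.cast_ne_zero.2 h₃) (Rat.cast_ne_zero.2 h₁') (Rat.cast_ne_zero.2 h₂')
    (Rat.cast_ne_zero.2 h₃') (by simpa using hd.map (Rat.castHom K))
    (by simpa using hd'.map (Rat.castHom K)) h h'
  simpa only [Coeffs.Solvable, Rat.cast_mul] using this

theorem isSquare_of_class {d₁ d₂ d₃ : ℚˣ} (h : sq (d₁ : ℚ) * sq (d₂ : ℚ) * sq (d₃ : ℚ) = 1) :
    IsSquare ((d₁ : ℚ) * d₂ * d₃) := by
  rw [← sq_mul d₁.ne_zero d₂.ne_zero, ← sq_mul (mul_ne_zero d₁.ne_zero d₂.ne_zero) d₃.ne_zero,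
    sq_eq_one_iff (mul_ne_zero (mul_ne_zero d₁.ne_zero d₂.ne_zero) d₃.ne_zero)] at h
  obtain ⟨c, -, hc⟩ := h
  exact ⟨c, by rw [hc]; ring⟩

theorem Coeffs.solvable_one (e : Coeffs) (K : Type) [Field K] [CharZero K] :
    e.Solvable K 1 1 1 :=
  ⟨0, 1, 1, 1, by simp, by simp, by simp, by simp⟩

/-- The `2`-Selmer group of `E`: the classes `Λ = (d₁, d₂, d₃) ∈ (ℚˣ/ℚˣ²)³` with
`d₁ d₂ d₃ = 1` in `ℚˣ/ℚˣ²` and `D_Λ(𝔸_ℚ) ≠ ∅`. -/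
noncomputable def Coeffs.Sel (e : Coeffs) : Subgroup (SqClass ℚ × SqClass ℚ × SqClass ℚ) where
  carrier := {L | L.1 * L.2.1 * L.2.2 = 1 ∧ ∃ d₁ d₂ d₃ : ℚˣ,
    L = (sq (d₁ : ℚ), sq (d₂ : ℚ), sq (d₃ : ℚ)) ∧ e.EverywhereSolvable d₁ d₂ d₃}
  one_mem' := by
    refine ⟨by simp, 1, 1, 1, ?_, ?_⟩
    · have h1 : sq ((1 : ℚˣ) : ℚ) = 1 := by rw [sq_unit, map_one]
      rw [h1]; rfl
    · exact ⟨by simpa using e.solvable_one ℝ, fun p _ => by simpa using e.solvable_one ℚ_[p]⟩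
  mul_mem' := by
    rintro _ _ ⟨hL, d₁, d₂, d₃, rfl, hr, hp⟩ ⟨hL', d₁', d₂', d₃', rfl, hr', hp'⟩
    refine ⟨?_, d₁ * d₁', d₂ * d₂', d₃ * d₃', ?_, ?_⟩
    · have := congrArg₂ (· * ·) hL hL'
      simp only [mul_one] at this
      rw [← this]
      simp only [Prod.mk_mul_mk]
      ac_rfl
    · rw [Units.val_mul, Units.val_mul, Units.val_mul, sq_mul d₁.ne_zero d₁'.ne_zero,
        sq_mul d₂.ne_zero d₂'.ne_zero, sq_mul d₃.ne_zero d₃'.ne_zero]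
      rfl
    · have q := isSquare_of_class hL
      have q' := isSquare_of_class hL'
      rw [Units.val_mul, Units.val_mul, Units.val_mul]
      exact ⟨hr.mul d₁.ne_zero d₂.ne_zero d₃.ne_zero d₁'.ne_zero d₂'.ne_zero d₃'.ne_zero q q' hr',
        fun p _ => (hp p).mul d₁.ne_zero d₂.ne_zero d₃.ne_zero d₁'.ne_zero d₂'.ne_zero
          d₃'.ne_zero q q' (hp' p)⟩
  inv_mem' := by
    intro L h
    have : L⁻¹ = L := by ext <;> exact sqClass_inv _
    rwa [this]

theorem Coeffs.descentFun_mem (e : Coeffs) (P : e.Points) :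
    descentFun (e.e₁ : ℚ) (e.e₂ : ℚ) P ∈ e.Sel := by
  obtain ⟨d₁, d₂, d₃, h₁, h₂, h₃, hL, ⟨t, u₁, u₂, u₃, h0, k₁, k₂, k₃⟩, hprod⟩ :=
    hasPoint_of_descentFun (e₃ := (e.e₃ : ℚ)) (Int.cast_ne_zero.2 e.ne₁)
      (Int.cast_ne_zero.2 e.ne₂) (by exact_mod_cast e.sum_eq) (Int.cast_ne_zero.2 e.ne₃) P
  have main : ∀ (K : Type) [Field K] [CharZero K], e.Solvable K d₁ d₂ d₃ := by
    intro K _ _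
    refine ⟨(t : K), (u₁ : K), (u₂ : K), (u₃ : K), ?_, ?_, ?_, ?_⟩
    · simpa using h0
    · exact_mod_cast congrArg (Rat.cast (K := K)) k₁
    · exact_mod_cast congrArg (Rat.cast (K := K)) k₂
    · exact_mod_cast congrArg (Rat.cast (K := K)) k₃
  rw [hL]
  exact ⟨hprod, Units.mk0 d₁ h₁, Units.mk0 d₂ h₂, Units.mk0 d₃ h₃, rfl, main ℝ,
    fun p _ => main ℚ_[p]⟩

/-- The descent homomorphism `E(ℚ) → Sel₂(E)`. -/
noncomputable def Coeffs.descent (e : Coeffs) : Multiplicative e.Points →* e.Sel where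
  toFun P := ⟨descentFun (e.e₁ : ℚ) (e.e₂ : ℚ) P.toAdd, e.descentFun_mem P.toAdd⟩
  map_one' := rfl
  map_mul' P Q := Subtype.ext (descentFun_add (Int.cast_ne_zero.2 e.ne₁) (Int.cast_ne_zero.2 e.ne₂)
    (fun h => e.ne₃ (by
      have h' : e.e₁ + e.e₂ = 0 := by exact_mod_cast h
      have := e.sum_eq
      omega)) P.toAdd Q.toAdd)

/-- The pure `2`-Selmer group `Sel₂'(E)`: the quotient of `Sel₂(E)` by the image of `E(ℚ)_tors`,
which is `E(ℚ)_tors / 2 E(ℚ)_tors`. -/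
abbrev Coeffs.PureSel (e : Coeffs) : Type :=
  e.Sel ⧸ (CommGroup.torsion (Multiplicative e.Points)).map e.descent

/-- The class in `(ℚˣ/ℚˣ²)³` of a triple of nonzero integers. -/
noncomputable def classOf (d₁ d₂ d₃ : ℤ) : SqClass ℚ × SqClass ℚ × SqClass ℚ :=
  (sq (d₁ : ℚ), sq (d₂ : ℚ), sq (d₃ : ℚ))

open Classical in
/-- The additive Hilbert symbol of nonzero elements of a local field `K`: it is `0` if
`z² = α x² + β y²` has a nonzero solution in `K` and `1` otherwise. -/
noncomputable def addHilbert {K : Type} [Field K] (α β : K) : ZMod 2 :=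
  if ∃ x y z : K, ¬ (x = 0 ∧ y = 0 ∧ z = 0) ∧ z ^ 2 = α * x ^ 2 + β * y ^ 2 then 0 else 1

/-- The additive Jacobi symbol of an integer `u` coprime to `m > 0`. -/
def addJacobi (u : ℤ) (m : ℕ) : ZMod 2 := if jacobiSym u m = 1 then 0 else 1

/-- The matrix `A = ([p_j, -n]_{p_i})_{i,j}`, where `n = p_1 ⋯ p_k`. -/
noncomputable def matA {k : ℕ} (p : Fin k → ℕ) [∀ i, Fact (p i).Prime] (n : ℕ) :
    Matrix (Fin k) (Fin k) (ZMod 2) :=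
  Matrix.of fun i j => addHilbert (K := ℚ_[p i]) (p j : ℚ_[p i]) (-(n : ℚ_[p i]))

/-- The diagonal matrix `D_u` of the additive Legendre symbols of `u` at `p_1, …, p_k`. -/
def matD {k : ℕ} (p : Fin k → ℕ) (u : ℤ) : Matrix (Fin k) (Fin k) (ZMod 2) :=
  Matrix.diagonal fun i => addJacobi u (p i)

/-- The block matrix `(A + D_{-e₃}, D_{-e₂e₃}; D_{-e₁e₃}, A + D_{e₃})`. -/
noncomputable def matM (e : Coeffs) {k : ℕ} (p : Fin k → ℕ) [∀ i, Fact (p i).Prime] (n : ℕ) :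
    Matrix (Fin k ⊕ Fin k) (Fin k ⊕ Fin k) (ZMod 2) :=
  Matrix.fromBlocks (matA p n + matD p (-e.e₃)) (matD p (-(e.e₂ * e.e₃)))
    (matD p (-(e.e₁ * e.e₃))) (matA p n + matD p e.e₃)

/-- The column vector `(x, y)` with `x_i = v_{p_i}(d₁)` and `y_i = v_{p_i}(d₂)` modulo `2`. -/
def valVec {k : ℕ} (p : Fin k → ℕ) (d₁ d₂ : ℤ) : Fin k ⊕ Fin k → ZMod 2 :=
  Sum.elim (fun i => (padicValInt (p i) d₁ : ZMod 2)) (fun i => (padicValInt (p i) d₂ : ZMod 2))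

end TwoDescent

/-! Write `T`, `S`, `TS` for the descent classes of the points `(0, 0)`, `(e₁, 0)`, `(-e₂, 0)`.
Local solvability at a place is preserved by multiplying triples, so a triple may be moved by these
everywhere soluble classes. The proof compares the local conditions for the twist with those for
`E`, place by place.

For a triple of positive divisors of `n`, the entries are squares in `ℝ` and in `ℚ_q` for odd `q ∣
e₁e₂e₃`, which gives points with `t = 0`. At the other odd `q ∤ n` the reduction is good. Over a
finite field of odd order `E/2E` has as many elements as `E[2]`, at least four, and embeds in a
group of square classes with at most four, so the descent map is onto and every homogeneous space
has a point (`descentHom_surjective`); Hensel's lemma lifts it. At `p ∣ n` one of `1`, `T`, `S`,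
`TS` turns the triple into units, and a unit triple is soluble exactly when its entries are squares
modulo `p`. Written with Legendre symbols, this is the pair of rows of the matrix that belongs to
`p` (`Coeffs.solvable_twist_iff`).

The prime `2` imposes nothing on odd triples (`Coeffs.OddAtTwo.solvable_two`). The curve maps to
three conics, which are then soluble at every place other than `2`. Legendre's descent gives them
rational points without any condition at `2`, since every residue modulo `2` is a square. These
points, read modulo `8`, give the congruences that a `2`-adic point of the curve requires.

Every Selmer class of the twist is reached modulo torsion. After multiplication by `S` the entries
are odd, and they split as `dᵢ = aᵢbᵢ` with `bᵢ = gcd(dᵢ, n)`. The triple `(aᵢ)` lies in `Sel₂(E) =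
{1, T, S, TS}`, and parity leaves `1` or `T` (`Coeffs.OddAtTwo.classOf_eq_of_odd`). The class `T` of
`E` differs from that of the twist by `(n, n, 1)`, again a triple of divisors. Such triples meet the
torsion image only in `1`: `S` and `TS` have first entries of odd `2`-adic valuation, and `T` would
make `e₂` and `-e₁` squares, hence `4 ∣ e₃` (`Coeffs.OddAtTwo.eq_zero_of_classVec`). -/

namespace TwoDescent

/-! ### Primitive vectors and Hensel's lemma -/

/-- A nonzero vector over `ℚ_p` is proportional to a vector over `ℤ_p` with a coordinate `1`. -/
theorem exists_primitive {p : ℕ} [Fact p.Prime] {m : ℕ} (w : Fin m → ℚ_[p]) (hw : w ≠ 0) :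
    ∃ (v : Fin m → ℤ_[p]) (c : ℚ_[p]), c ≠ 0 ∧ (∀ i, w i = c * v i) ∧ ∃ j, v j = 1 := by
  obtain ⟨i₀, hi₀⟩ := Function.ne_iff.1 hw
  -- Dividing by a coordinate of maximal norm makes all coordinates integral and that one equal to
  -- `1`.
  obtain ⟨j, -, hj⟩ := Finset.exists_max_image Finset.univ (fun i => ‖w i‖) ⟨i₀, Finset.mem_univ _⟩
  have hj0 : w j ≠ 0 := by
    intro h
    have := hj i₀ (Finset.mem_univ _)
    simp only [h, norm_zero, norm_le_zero_iff] at this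
    exact hi₀ this
  refine ⟨fun i => ⟨w i / w j, ?_⟩, w j, hj0, fun i => ?_, j, ?_⟩
  · rw [norm_div]
    exact div_le_one_of_le₀ (hj i (Finset.mem_univ _)) (norm_nonneg _)
  · simp only
    field_simp
  · exact PadicInt.ext (by simp [hj0])

open Polynomial in
/-- Hensel's lemma for square roots. -/
theorem isSquare_of_norm_lt {p : ℕ} [Fact p.Prime] {u a : ℤ_[p]}
    (h : ‖a ^ 2 - u‖ < ‖2 * a‖ ^ 2) : IsSquare u := by
  obtain ⟨z, hz, -⟩ := hensels_lemma (R := ℤ_[p]) (F := X ^ 2 - C u) (a := a) (by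
    simpa [derivative_pow] using h)
  refine ⟨z, ?_⟩
  have : z ^ 2 - u = 0 := by simpa using hz
  linear_combination -this

theorem norm_two_eq_one {p : ℕ} [Fact p.Prime] (hp : p ≠ 2) : ‖(2 : ℤ_[p])‖ = 1 := by
  have := (PadicInt.norm_natCast_eq_one_iff (p := p) (n := 2)).2
    ((Nat.coprime_primes (Fact.out : p.Prime) Nat.prime_two).2 hp)
  simpa using this

/-- For `p` odd, a unit of `ℤ_p` whose residue is a square is a square. -/
theorem isSquare_of_residue {p : ℕ} [Fact p.Prime] (hp : p ≠ 2) {u : ℤ_[p]}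
    (hu : PadicInt.toZMod u ≠ 0) (h : IsSquare (PadicInt.toZMod u)) : IsSquare u := by
  obtain ⟨r, hr⟩ := h
  obtain ⟨a, rfl⟩ := ZMod.ringHom_surjective (PadicInt.toZMod : ℤ_[p] →+* ZMod p) r
  have hmem : ∀ x : ℤ_[p], PadicInt.toZMod x = 0 ↔ ‖x‖ < 1 := fun x => by
    rw [← RingHom.mem_ker, PadicInt.ker_toZMod, IsLocalRing.mem_maximalIdeal, PadicInt.mem_nonunits]
  have ha : ‖a‖ = 1 := by
    refine le_antisymm (PadicInt.norm_le_one a) (not_lt.1 fun hlt => hu ?_)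
    rw [hr, (hmem a).2 hlt, zero_mul]
  refine isSquare_of_norm_lt (a := a) ?_
  rw [norm_mul, norm_two_eq_one hp, ha, one_mul, one_pow, ← hmem, map_sub, map_pow, hr]
  ring

theorem isSquare_int_of_residue {p : ℕ} [Fact p.Prime] (hp : p ≠ 2) {u : ℤ}
    (hu : ¬ (p : ℤ) ∣ u) (h : IsSquare (u : ZMod p)) : IsSquare (u : ℚ_[p]) := by
  have := isSquare_of_residue hp (u := (u : ℤ_[p])) (by
    rwa [map_intCast, Ne, ZMod.intCast_zmod_eq_zero_iff_dvd]) (by rwa [map_intCast])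
  simpa using this.map (algebraMap ℤ_[p] ℚ_[p])

/-- An integer `≡ 1 mod 8` is a square in `ℤ_2`. -/
theorem isSquare_two_adic {u : ℤ} (hu : u % 8 = 1) : IsSquare (u : ℚ_[2]) := by
  have : IsSquare (u : ℤ_[2]) := by
    -- Newton's iteration starts at `1`: `|1 - u| ≤ 1/8 < 1/4 = |2|²`.
    refine isSquare_of_norm_lt (a := 1) ?_
    have h1 : ‖((1 - u : ℤ) : ℤ_[2])‖ ≤ (2 : ℝ) ^ (-(3 : ℕ) : ℤ) := by
      have := (PadicInt.norm_int_le_pow_iff_dvd (p := 2) (k := 1 - u) (n := 3)).2 (by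
        norm_num; omega)
      exact_mod_cast this
    have h2 : ‖(2 : ℤ_[2])‖ = 2⁻¹ := by
      have := PadicInt.norm_p (p := 2)
      simpa using this
    rw [norm_mul, h2]
    push_cast at h1
    simp only [one_pow, norm_one, mul_one]
    refine lt_of_le_of_lt h1 ?_
    norm_num
  simpa using this.map (algebraMap ℤ_[2] ℚ_[2])

theorem padicInt_dvd_int_iff {p : ℕ} [Fact p.Prime] (a : ℤ) :
    (p : ℤ_[p]) ∣ (a : ℤ_[p]) ↔ (p : ℤ) ∣ a := by
  simpa using PadicInt.pow_p_dvd_int_iff 1 a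

/-! ### Conics and Legendre's theorem -/

/-- The conic `z² = a x² + b y²` has a `K`-rational point. -/
def ConicSolvable {K : Type} [Field K] (a b : K) : Prop :=
  ∃ x y z : K, ¬ (x = 0 ∧ y = 0 ∧ z = 0) ∧ z ^ 2 = a * x ^ 2 + b * y ^ 2

section Field
variable {K : Type} [Field K]

theorem ConicSolvable.symm {a b : K} (h : ConicSolvable a b) : ConicSolvable b a := by
  obtain ⟨x, y, z, h0, h⟩ := h
  exact ⟨y, x, z, by tauto, by linear_combination h⟩

theorem conicSolvable_of_sq {b c : K} : ConicSolvable (c ^ 2) b :=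
  ⟨1, 0, c, by simp, by ring⟩

theorem ConicSolvable.of_mul_sq {a b c : K} (hc : c ≠ 0) (h : ConicSolvable a (b * c ^ 2)) :
    ConicSolvable a b := by
  obtain ⟨x, y, z, h0, h⟩ := h
  exact ⟨x, c * y, z, by simpa [hc] using h0, by linear_combination h⟩

theorem ConicSolvable.mul_sq {a b c : K} (hc : c ≠ 0) (h : ConicSolvable a b) :
    ConicSolvable a (b * c ^ 2) := by
  obtain ⟨x, y, z, h0, h⟩ := h
  refine ⟨x, y / c, z, by simpa [hc] using h0, ?_⟩
  field_simp
  exact h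

/-- Solvability says that `b` is a norm from `K(√a)`, and `b b'` is the norm of `t + √a`. The new
point comes from `(z + x√a)(t + √a)`, whose norm is `b'(b y)²`. A point with `y = 0` lies on the
conic for every `b'`. -/
theorem ConicSolvable.of_norm {a b b' t : K} (hb : b ≠ 0) (ht : t ^ 2 - a = b * b')
    (h : ConicSolvable a b) : ConicSolvable a b' := by
  obtain ⟨x, y, z, h0, h⟩ := h
  by_cases hy : y = 0
  · subst hy
    exact ⟨x, 0, z, h0, by linear_combination h⟩
  · refine ⟨z + x * t, b * y, z * t + a * x, by simp [hb, hy], ?_⟩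
    linear_combination (t ^ 2 - a) * h + (b * y ^ 2) * ht

theorem ConicSolvable.map {L : Type} [Field L] (f : K →+* L) {a b : K} (h : ConicSolvable a b) :
    ConicSolvable (f a) (f b) := by
  obtain ⟨x, y, z, h0, h⟩ := h
  refine ⟨f x, f y, f z, by simpa using h0, ?_⟩
  simpa using congrArg f h

end Field

/-- Solvability of `z² = a x² + b y²` over `ℝ` and over `ℚ_p` for all odd primes `p`. -/
def ConicSolvableAwayTwo (a b : ℚ) : Prop :=
  ConicSolvable (a : ℝ) (b : ℝ) ∧
    ∀ (p : ℕ) [Fact p.Prime], p ≠ 2 → ConicSolvable (a : ℚ_[p]) (b : ℚ_[p])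

theorem ConicSolvableAwayTwo.symm {a b : ℚ} (h : ConicSolvableAwayTwo a b) :
    ConicSolvableAwayTwo b a :=
  ⟨h.1.symm, fun p _ hp => (h.2 p hp).symm⟩

theorem ConicSolvableAwayTwo.of_mul_sq {a b c : ℚ} (hc : c ≠ 0)
    (h : ConicSolvableAwayTwo a (b * c ^ 2)) : ConicSolvableAwayTwo a b :=
  ⟨.of_mul_sq (c := (c : ℝ)) (by exact_mod_cast hc) (by exact_mod_cast h.1),
    fun p _ hp => .of_mul_sq (c := (c : ℚ_[p])) (by exact_mod_cast hc)
      (by exact_mod_cast h.2 p hp)⟩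

theorem ConicSolvableAwayTwo.of_norm {a b b' t : ℚ} (hb : b ≠ 0) (ht : t ^ 2 - a = b * b')
    (h : ConicSolvableAwayTwo a b) : ConicSolvableAwayTwo a b' :=
  ⟨.of_norm (t := (t : ℝ)) (by exact_mod_cast hb) (by exact_mod_cast ht) h.1,
    fun p _ hp => .of_norm (t := (t : ℚ_[p])) (by exact_mod_cast hb) (by exact_mod_cast ht)
      (h.2 p hp)⟩

/-- If `p ∥ b`, a `p`-adic point on `z² = a x² + b y²` makes `a` a square modulo `p`. -/
theorem isSquare_zmod_of_conic {p : ℕ} [Fact p.Prime] {a b : ℤ} (hb : (p : ℤ) ∣ b)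
    (hb2 : ¬ (p : ℤ) ^ 2 ∣ b) (h : ConicSolvable (a : ℚ_[p]) (b : ℚ_[p])) :
    IsSquare (a : ZMod p) := by
  obtain ⟨x, y, z, h0, h⟩ := h
  obtain ⟨v, c, hc, hv, j, hj⟩ := exists_primitive ![x, y, z] (by
    intro h'
    apply h0
    have h1 := congrFun h' 0
    have h2 := congrFun h' 1
    have h3 := congrFun h' 2
    simpa using And.intro h1 (And.intro h2 h3))
  have e0 := hv 0
  have e1 := hv 1
  have e2 := hv 2
  simp only [Matrix.cons_val] at e0 e1 e2
  have key : (v 2) ^ 2 = a * (v 0) ^ 2 + b * (v 1) ^ 2 := by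
    refine PadicInt.ext ?_
    push_cast
    rw [e0, e1, e2] at h
    have : c ^ 2 ≠ 0 := pow_ne_zero 2 hc
    apply mul_left_cancel₀ this
    linear_combination h
  have hbp : PadicInt.toZMod (b : ℤ_[p]) = 0 := by
    rw [map_intCast, ZMod.intCast_zmod_eq_zero_iff_dvd]; exact hb
  have key' := congrArg (PadicInt.toZMod (p := p)) key
  simp only [map_add, map_mul, map_pow, hbp, zero_mul, add_zero, map_intCast] at key'
  by_cases hx : PadicInt.toZMod (v 0) = 0
  · exfalso
    have hmem : ∀ x : ℤ_[p], PadicInt.toZMod x = 0 ↔ (p : ℤ_[p]) ∣ x := fun x => by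
      rw [← RingHom.mem_ker, PadicInt.ker_toZMod, PadicInt.maximalIdeal_eq_span_p,
        Ideal.mem_span_singleton]
    have hz : PadicInt.toZMod (v 2) = 0 := by
      rw [hx] at key'
      simpa using key'
    rw [hmem] at hx hz
    obtain ⟨b', rfl⟩ := hb
    obtain ⟨x', hx'⟩ := hx
    obtain ⟨z', hz'⟩ := hz
    have hb' : ¬ (p : ℤ_[p]) ∣ b' := by
      rw [padicInt_dvd_int_iff]
      rintro ⟨b'', rfl⟩
      exact hb2 ⟨b'', by ring⟩
    have hp0 : (p : ℤ_[p]) ≠ 0 := PadicInt.prime_p.ne_zero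
    have hy : (p : ℤ_[p]) ∣ b' * v 1 ^ 2 := by
      refine ⟨z' ^ 2 - a * x' ^ 2, mul_left_cancel₀ hp0 ?_⟩
      rw [hx', hz'] at key
      push_cast at key
      linear_combination -key
    have hy' := PadicInt.prime_p.dvd_of_dvd_pow ((PadicInt.prime_p.dvd_or_dvd hy).resolve_left hb')
    have hu : (p : ℤ_[p]) ∣ v j := by
      fin_cases j
      · exact ⟨x', hx'⟩
      · exact hy'
      · exact ⟨z', hz'⟩
    rw [hj] at hu
    exact PadicInt.prime_p.not_isUnit (isUnit_of_dvd_one hu)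
  · refine ⟨PadicInt.toZMod (v 2) / PadicInt.toZMod (v 0), ?_⟩
    field_simp
    exact key'.symm

/-- Square roots modulo the primes dividing `m` are glued by the Chinese remainder theorem. -/
theorem exists_sq_sub_dvd (a : ℤ) (m : ℕ) (hm : Squarefree m)
    (h : ∀ p : ℕ, p.Prime → p ∣ m → IsSquare (a : ZMod p)) : ∃ t : ℤ, (m : ℤ) ∣ t ^ 2 - a := by
  induction m using Nat.recOnPrimeCoprime with
  | zero => exact absurd hm not_squarefree_zero
  | prime_pow p k hp =>
    have hk : k ≤ 1 := by
      by_contra! hk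
      have := hm p (by rw [← _root_.sq]; exact pow_dvd_pow p hk)
      exact hp.one_lt.ne' (Nat.isUnit_iff.1 this)
    interval_cases k
    · exact ⟨0, by simp⟩
    · obtain ⟨r, hr⟩ := h p hp (by simp)
      obtain ⟨t, rfl⟩ := ZMod.intCast_surjective r
      refine ⟨t, ?_⟩
      rw [pow_one, ← ZMod.intCast_zmod_eq_zero_iff_dvd]
      push_cast
      rw [hr]; ring
  | coprime x y hx hy hxy ihx ihy =>
    obtain ⟨t, ht⟩ := ihx (hm.of_mul_left) fun p hp hd => h p hp (hd.mul_right _)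
    obtain ⟨s, hs⟩ := ihy (hm.of_mul_right) fun p hp hd => h p hp (hd.mul_left _)
    obtain ⟨u, v, huv⟩ := Nat.isCoprime_iff_coprime.2 hxy
    refine ⟨t * (v * y) + s * (u * x), ?_⟩
    push_cast
    refine IsCoprime.mul_dvd ⟨u, v, huv⟩ ?_ ?_
    · obtain ⟨k, hk⟩ := ht
      have hv : (v : ℤ) * y = 1 - u * x := by linear_combination huv
      rw [hv]
      exact ⟨k + (-2 * t ^ 2 * u + t ^ 2 * u ^ 2 * x + 2 * t * (1 - u * x) * s * u
        + s ^ 2 * u ^ 2 * x), by linear_combination hk⟩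
    · obtain ⟨k, hk⟩ := hs
      have hu : (u : ℤ) * x = 1 - v * y := by linear_combination huv
      rw [hu]
      exact ⟨k + (-2 * s ^ 2 * v + s ^ 2 * v ^ 2 * y + 2 * s * (1 - v * y) * t * v
        + t ^ 2 * v ^ 2 * y), by linear_combination hk⟩

theorem exists_sq_sub_dvd_small (a b : ℤ) (hb : Squarefree b)
    (h : ConicSolvableAwayTwo a b) : ∃ t : ℤ, b ∣ t ^ 2 - a ∧ 2 * |t| ≤ |b| := by
  have hb0 : b ≠ 0 := hb.ne_zero
  obtain ⟨t, ht⟩ := exists_sq_sub_dvd a b.natAbs (Int.squarefree_natAbs.2 hb) (by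
    intro p hp hd
    have : Fact p.Prime := ⟨hp⟩
    by_cases h2 : p = 2
    -- Every residue modulo `2` is a square, so the descent never uses a condition at `2`.
    · subst h2
      generalize (a : ZMod 2) = r
      exact ⟨r, by revert r; decide⟩
    · refine isSquare_zmod_of_conic (Int.natCast_dvd.2 hd) (fun h' => ?_) (b := b)
        (by simpa using h.2 p h2)
      have := hb p (by rwa [← _root_.sq])
      exact hp.one_lt.ne' (by simpa [Int.isUnit_iff_natAbs_eq] using this))
  rw [Int.natCast_natAbs, abs_dvd] at ht
  -- The balanced residue gives the bound `|t| ≤ |b|/2` on which the descent rests.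
  refine ⟨Int.bmod t b.natAbs, ?_, ?_⟩
  · have h1 : b ∣ t - Int.bmod t b.natAbs := by
      have := Int.dvd_self_sub_bmod (x := t) (m := b.natAbs)
      exact Int.natAbs_dvd.1 this
    obtain ⟨k, hk⟩ := h1
    obtain ⟨l, hl⟩ := ht
    have e : Int.bmod t b.natAbs = t - b * k := by linear_combination -hk
    rw [e]
    exact ⟨l - 2 * t * k + b * k ^ 2, by linear_combination hl⟩
  · have hpos : 0 < b.natAbs := Int.natAbs_pos.2 hb0
    have h1 := Int.le_bmod (x := t) hpos
    have h2 := Int.bmod_le (x := t) hpos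
    rw [Int.abs_eq_natAbs b]
    rcases abs_cases (t.bmod b.natAbs) with ⟨h3, -⟩ | ⟨h3, -⟩ <;> rw [h3] <;> omega

theorem exists_squarefree_mul_sq {b : ℤ} (hb : b ≠ 0) :
    ∃ s c : ℤ, Squarefree s ∧ c ≠ 0 ∧ b = s * c ^ 2 := by
  obtain ⟨s, c, hsc, hs⟩ := Nat.sq_mul_squarefree b.natAbs
  have hc : c ≠ 0 := by
    rintro rfl
    exact Int.natAbs_ne_zero.2 hb (by rw [← hsc]; simp)
  refine ⟨b.sign * s, c, ?_, by exact_mod_cast hc, ?_⟩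
  · rw [← Int.squarefree_natAbs, Int.natAbs_mul, Int.natAbs_sign_of_ne_zero hb, one_mul]
    simpa using hs
  · have : ((b.natAbs : ℕ) : ℤ) = c ^ 2 * s := by rw [← hsc]; push_cast; ring
    conv_lhs => rw [← Int.sign_mul_natAbs b, this]
    ring

/-- Legendre's theorem: a conic that is solvable over `ℝ` and over `ℚ_p` for all odd `p`
is solvable over `ℚ`. -/
theorem conicSolvable_of_awayTwo_squarefree (N : ℕ) : ∀ a b : ℤ, Squarefree a → Squarefree b →
    a.natAbs + b.natAbs ≤ N → ConicSolvableAwayTwo a b → ConicSolvable (a : ℚ) (b : ℚ) := by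
  induction N with
  | zero =>
    intro a b ha _ hN
    have := Int.natAbs_pos.2 ha.ne_zero
    omega
  | succ N ih =>
    have main : ∀ a b : ℤ, Squarefree a → Squarefree b → a.natAbs ≤ b.natAbs →
        a.natAbs + b.natAbs ≤ N + 1 → ConicSolvableAwayTwo a b →
        ConicSolvable (a : ℚ) (b : ℚ) := by
      intro a b ha hb hab hN h
      have ha0 := ha.ne_zero
      have hb0 := hb.ne_zero
      by_cases hb1 : b.natAbs = 1
      · have ha1 : a.natAbs = 1 := le_antisymm (hb1 ▸ hab) (Int.natAbs_pos.2 ha0)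
        rcases Int.natAbs_eq_iff.1 ha1 with rfl | rfl
        · exact ⟨1, 0, 1, by simp, by simp⟩
        rcases Int.natAbs_eq_iff.1 hb1 with rfl | rfl
        · exact ⟨0, 1, 1, by simp, by simp⟩
        -- The remaining case is `a = b = -1`, which the real place rules out.
        exfalso
        obtain ⟨x, y, z, h0, h⟩ := h.1
        push_cast at h
        apply h0
        refine ⟨?_, ?_, ?_⟩ <;> nlinarith [sq_nonneg x, sq_nonneg y, sq_nonneg z]
      obtain ⟨t, ⟨b', hb'⟩, ht⟩ := exists_sq_sub_dvd_small a b hb h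
      by_cases hb'0 : b' = 0
      · rw [hb'0, mul_zero, sub_eq_zero] at hb'
        rw [← hb', Int.cast_pow]
        exact conicSolvable_of_sq
      -- Here `|b b'| ≤ t² + |a| ≤ b²/4 + |b| < b²`, the last step because `|b| ≥ 2`.
      have hlt : b'.natAbs < b.natAbs := by
        zify
        have hb2 : 2 ≤ |b| := by
          have := Int.natAbs_pos.2 hb0
          rw [Int.abs_eq_natAbs]; omega
        have hab' : |a| ≤ |b| := by zify at hab; exact hab
        have h1 : |b| * |b'| ≤ |t| ^ 2 + |a| := by
          rw [← abs_mul, ← hb', ← abs_pow]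
          exact abs_sub _ _
        by_contra! hle
        have h2 : |b| * |b| ≤ |b| * |b'| := mul_le_mul_of_nonneg_left hle (abs_nonneg b)
        nlinarith [abs_nonneg t]
      obtain ⟨s, c, hs, hc, hsc⟩ := exists_squarefree_mul_sq hb'0
      have hsle : s.natAbs ≤ b'.natAbs := by
        rw [hsc, Int.natAbs_mul]
        exact Nat.le_mul_of_pos_right _ (Int.natAbs_pos.2 (pow_ne_zero 2 hc))
      have hcQ : (c : ℚ) ≠ 0 := Int.cast_ne_zero.2 hc
      have hbQ : (b : ℚ) ≠ 0 := Int.cast_ne_zero.2 hb0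
      have hbQ' : (b' : ℚ) ≠ 0 := Int.cast_ne_zero.2 hb'0
      have hrel : (t : ℚ) ^ 2 - a = b * b' := by exact_mod_cast hb'
      have hscQ : (b' : ℚ) = s * (c : ℚ) ^ 2 := by exact_mod_cast hsc
      have h1 : ConicSolvableAwayTwo a s := by
        have := h.of_norm hbQ hrel
        rw [hscQ] at this
        exact this.of_mul_sq hcQ
      have h2 := (ih a s ha hs (by omega) h1).mul_sq hcQ
      rw [← hscQ] at h2
      exact h2.of_norm hbQ' (by rw [hrel, mul_comm])
    intro a b ha hb hN h
    rcases le_total a.natAbs b.natAbs with hab | hab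
    · exact main a b ha hb hab hN h
    · exact (main b a hb ha hab (by omega) h.symm).symm

theorem conicSolvable_of_awayTwo {a b : ℤ} (ha : a ≠ 0) (hb : b ≠ 0)
    (h : ConicSolvableAwayTwo a b) : ConicSolvable (a : ℚ) (b : ℚ) := by
  obtain ⟨s, c, hs, hc, rfl⟩ := exists_squarefree_mul_sq ha
  obtain ⟨s', c', hs', hc', rfl⟩ := exists_squarefree_mul_sq hb
  have hcQ : (c : ℚ) ≠ 0 := Int.cast_ne_zero.2 hc
  have hcQ' : (c' : ℚ) ≠ 0 := Int.cast_ne_zero.2 hc'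
  push_cast at h ⊢
  have h1 := (h.of_mul_sq hcQ').symm.of_mul_sq hcQ
  exact ((conicSolvable_of_awayTwo_squarefree _ s' s hs' hs le_rfl h1).mul_sq hcQ).symm.mul_sq hcQ'

/-! ### Solvability at 2 -/

theorem HasPoint.rotate {K : Type} [Field K] {e₁ e₂ e₃ d₁ d₂ d₃ : K}
    (h : HasPoint e₁ e₂ e₃ d₁ d₂ d₃) : HasPoint e₂ e₃ e₁ d₂ d₃ d₁ := by
  obtain ⟨t, u₁, u₂, u₃, h0, k₁, k₂, k₃⟩ := h
  exact ⟨t, u₂, u₃, u₁, by tauto, k₂, k₃, k₁⟩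

/-- Multiplying the first equation by `d₂` gives `(d₂u₂)² = d₂d₃u₃² - e₁d₂t²`. The image is never
the zero vector, since `t = u₂ = u₃ = 0` forces `u₁ = 0`. -/
theorem HasPoint.conicSolvable {K : Type} [Field K] {e₁ e₂ e₃ d₁ d₂ d₃ : K} (h₁ : d₁ ≠ 0)
    (h₂ : d₂ ≠ 0) (h : HasPoint e₁ e₂ e₃ d₁ d₂ d₃) : ConicSolvable (d₂ * d₃) (-(e₁ * d₂)) := by
  obtain ⟨t, u₁, u₂, u₃, h0, k₁, k₂, k₃⟩ := h
  refine ⟨u₃, t, d₂ * u₂, ?_, by linear_combination d₂ * k₁⟩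
  rintro ⟨rfl, rfl, hu⟩
  have hu₂ : u₂ = 0 := by simpa [h₂] using hu
  subst hu₂
  refine h0 ⟨rfl, ?_, rfl, rfl⟩
  have : d₁ * u₁ ^ 2 = 0 := by linear_combination k₃
  simpa [h₁] using this

/-- A point on the conic `e t² + d u² = d' w²` modulo `8`, one coordinate of which is `1`. -/
theorem exists_mod_eight_of_conicSolvable {e d d' : ℤ} (hd : d ≠ 0)
    (h : ConicSolvable ((d * d' : ℤ) : ℚ) ((-(e * d) : ℤ) : ℚ)) :
    ∃ t u w : ZMod 8, (t = 1 ∨ u = 1 ∨ w = 1) ∧ (e : ZMod 8) * t ^ 2 + d * u ^ 2 = d' * w ^ 2 := by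
  obtain ⟨x, y, z, h0, h⟩ := h.map (Rat.castHom ℚ_[2])
  have hdQ : (d : ℚ_[2]) ≠ 0 := by exact_mod_cast hd
  obtain ⟨v, c, hc, hv, j, hj⟩ := exists_primitive ![y, z / d, x] (by
    intro h'
    apply h0
    have h1 := congrFun h' 0
    have h2 := congrFun h' 1
    have h3 := congrFun h' 2
    simp only [Matrix.cons_val, Pi.zero_apply, div_eq_zero_iff, hdQ, or_false] at h1 h2 h3
    exact ⟨h3, h1, h2⟩)
  have e0 := hv 0
  have e1 := hv 1
  have e2 := hv 2
  simp only [Matrix.cons_val] at e0 e1 e2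
  rw [div_eq_iff hdQ] at e1
  have key : (e : ℤ_[2]) * v 0 ^ 2 + d * v 1 ^ 2 = d' * v 2 ^ 2 := by
    refine PadicInt.ext ?_
    push_cast
    simp only [eq_ratCast, Rat.cast_intCast] at h
    push_cast at h
    rw [e0, e1, e2] at h
    have : d * c ^ 2 ≠ 0 := mul_ne_zero hdQ (pow_ne_zero 2 hc)
    apply mul_left_cancel₀ this
    linear_combination h
  have key' := congrArg (PadicInt.toZModPow (p := 2) 3) key
  simp only [map_add, map_mul, map_pow, map_intCast] at key'
  refine ⟨_, _, _, ?_, key'⟩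
  have hj' := congrArg (PadicInt.toZModPow (p := 2) 3) hj
  rw [map_one] at hj'
  fin_cases j
  · exact Or.inl hj'
  · exact Or.inr (Or.inl hj')
  · exact Or.inr (Or.inr hj')

theorem sq_zmod_eight (x : ZMod 8) : x ^ 2 = 0 ∨ x ^ 2 = 1 ∨ x ^ 2 = 4 := by
  revert x; decide

/-- The integers stand for the squares of the coordinates modulo `8`; their finite range leaves
linear congruences that `omega` can decide. -/
theorem exists_int_mod_eight {e d d' : ℤ}
    (h : ∃ t u w : ZMod 8, (t = 1 ∨ u = 1 ∨ w = 1) ∧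
      (e : ZMod 8) * t ^ 2 + d * u ^ 2 = d' * w ^ 2) :
    ∃ t u w : ℤ, (t = 0 ∨ t = 1 ∨ t = 4) ∧ (u = 0 ∨ u = 1 ∨ u = 4) ∧ (w = 0 ∨ w = 1 ∨ w = 4) ∧
      (t = 1 ∨ u = 1 ∨ w = 1) ∧ (e * t + d * u - d' * w) % 8 = 0 := by
  obtain ⟨t, u, w, h1, h⟩ := h
  have lift : ∀ x : ZMod 8, ∃ y : ℤ, (y = 0 ∨ y = 1 ∨ y = 4) ∧ (y : ZMod 8) = x ^ 2 ∧
      (x = 1 → y = 1) := by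
    intro x
    rcases sq_zmod_eight x with hx | hx | hx
    · exact ⟨0, by simp, by simp [hx], by rintro rfl; exact absurd hx (by decide)⟩
    · exact ⟨1, by simp, by simp [hx], by simp⟩
    · exact ⟨4, by simp, by rw [hx]; rfl, by rintro rfl; exact absurd hx (by decide)⟩
  obtain ⟨t', ht, et, et1⟩ := lift t
  obtain ⟨u', hu, eu, eu1⟩ := lift u
  obtain ⟨w', hw, ew, ew1⟩ := lift w
  refine ⟨t', u', w', ht, hu, hw, h1.imp et1 (Or.imp eu1 ew1), ?_⟩
  rw [← et, ← eu, ← ew] at h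
  have h' : ((e * t' + d * u' - d' * w' : ℤ) : ZMod 8) = 0 := by
    push_cast
    rw [h, sub_self]
  exact Int.emod_eq_zero_of_dvd ((ZMod.intCast_zmod_eq_zero_iff_dvd _ 8).1 h')

/-- The torsion point `(0, 0)`. -/
theorem Coeffs.solvable_T (e : Coeffs) (K : Type) [Field K] [CharZero K] :
    e.Solvable K e.e₂ (-e.e₁) (-(e.e₁ * e.e₂)) := by
  have hs : (e.e₁ : K) + e.e₂ + e.e₃ = 0 := by
    exact_mod_cast congrArg (Int.cast (R := K)) e.sum_eq
  refine ⟨1, 1, 1, 0, by simp, ?_, ?_, ?_⟩ <;> push_cast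
  · ring
  · ring
  · linear_combination hs

/-- The torsion point `(e₁, 0)`. -/
theorem Coeffs.solvable_S (e : Coeffs) (K : Type) [Field K] [CharZero K] :
    e.Solvable K (-e.e₃) (-(e.e₁ * e.e₃)) e.e₁ := by
  have hs : (e.e₁ : K) + e.e₂ + e.e₃ = 0 := by
    exact_mod_cast congrArg (Int.cast (R := K)) e.sum_eq
  refine ⟨1, 1, 0, 1, by simp, ?_, ?_, ?_⟩ <;> push_cast
  · ring
  · linear_combination hs
  · ring

/-- `D_Λ` has points over `ℝ` and over `ℚ_q` for every odd prime `q`. -/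
def Coeffs.SolvableAwayTwo (e : Coeffs) (d₁ d₂ d₃ : ℚ) : Prop :=
  e.Solvable ℝ d₁ d₂ d₃ ∧ ∀ (q : ℕ) [Fact q.Prime], q ≠ 2 → e.Solvable ℚ_[q] d₁ d₂ d₃

/-- The curve maps to three conics, and Legendre's theorem gives rational points on them. This is
how information at `2` is obtained from the other places. -/
theorem Coeffs.SolvableAwayTwo.conics {e : Coeffs} {d₁ d₂ d₃ : ℤ} (h₁ : d₁ ≠ 0) (h₂ : d₂ ≠ 0)
    (h₃ : d₃ ≠ 0) (h : e.SolvableAwayTwo d₁ d₂ d₃) :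
    ConicSolvable ((d₂ * d₃ : ℤ) : ℚ) ((-(e.e₁ * d₂) : ℤ) : ℚ) ∧
      ConicSolvable ((d₃ * d₁ : ℤ) : ℚ) ((-(e.e₂ * d₃) : ℤ) : ℚ) ∧
      ConicSolvable ((d₁ * d₂ : ℤ) : ℚ) ((-(e.e₃ * d₁) : ℤ) : ℚ) := by
  have c : ∀ (K : Type) [Field K] [CharZero K] (d : ℤ), d ≠ 0 → (((d : ℤ) : ℚ) : K) ≠ 0 :=
    fun K _ _ d hd => by exact_mod_cast hd
  have r1 : ∀ (K : Type) [Field K] [CharZero K], e.Solvable K d₁ d₂ d₃ →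
      ConicSolvable (((d₂ * d₃ : ℤ) : ℚ) : K) (((-(e.e₁ * d₂) : ℤ) : ℚ) : K) ∧
      ConicSolvable (((d₃ * d₁ : ℤ) : ℚ) : K) (((-(e.e₂ * d₃) : ℤ) : ℚ) : K) ∧
      ConicSolvable (((d₁ * d₂ : ℤ) : ℚ) : K) (((-(e.e₃ * d₁) : ℤ) : ℚ) : K) := by
    intro K _ _ hK
    have k1 := HasPoint.conicSolvable (c K d₁ h₁) (c K d₂ h₂) hK
    have k2 := HasPoint.conicSolvable (c K d₂ h₂) (c K d₃ h₃) hK.rotate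
    have k3 := HasPoint.conicSolvable (c K d₃ h₃) (c K d₁ h₁) hK.rotate.rotate
    push_cast at k1 k2 k3 ⊢
    exact ⟨k1, k2, k3⟩
  refine ⟨conicSolvable_of_awayTwo ?_ ?_ ?_, conicSolvable_of_awayTwo ?_ ?_ ?_,
    conicSolvable_of_awayTwo ?_ ?_ ?_⟩
  · exact mul_ne_zero h₂ h₃
  · exact neg_ne_zero.2 (mul_ne_zero e.ne₁ h₂)
  · exact ⟨(r1 ℝ h.1).1, fun q _ hq => (r1 _ (h.2 q hq)).1⟩
  · exact mul_ne_zero h₃ h₁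
  · exact neg_ne_zero.2 (mul_ne_zero e.ne₂ h₃)
  · exact ⟨(r1 ℝ h.1).2.1, fun q _ hq => (r1 _ (h.2 q hq)).2.1⟩
  · exact mul_ne_zero h₁ h₂
  · exact neg_ne_zero.2 (mul_ne_zero e.ne₃ h₁)
  · exact ⟨(r1 ℝ h.1).2.2, fun q _ hq => (r1 _ (h.2 q hq)).2.2⟩

theorem Coeffs.SolvableAwayTwo.mul {e : Coeffs} {d₁ d₂ d₃ d₁' d₂' d₃' : ℚ} (h₁ : d₁ ≠ 0)
    (h₂ : d₂ ≠ 0) (h₃ : d₃ ≠ 0) (h₁' : d₁' ≠ 0) (h₂' : d₂' ≠ 0)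
    (h₃' : d₃' ≠ 0) (hd : IsSquare (d₁ * d₂ * d₃)) (hd' : IsSquare (d₁' * d₂' * d₃'))
    (h : e.SolvableAwayTwo d₁ d₂ d₃) (h' : e.SolvableAwayTwo d₁' d₂' d₃') :
    e.SolvableAwayTwo (d₁ * d₁') (d₂ * d₂') (d₃ * d₃') :=
  ⟨h.1.mul h₁ h₂ h₃ h₁' h₂' h₃' hd hd' h'.1,
    fun q _ hq => (h.2 q hq).mul h₁ h₂ h₃ h₁' h₂' h₃' hd hd' (h'.2 q hq)⟩

/-- The condition on the coefficients at `2`: `e₁`, `e₂` odd and `2 ∥ e₃`. -/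
def Coeffs.OddAtTwo (e : Coeffs) : Prop :=
  Odd e.e₁ ∧ Odd e.e₂ ∧ (2 : ℤ) ∣ e.e₃ ∧ ¬ (4 : ℤ) ∣ e.e₃

/-- Odd squares are `1` modulo `8`, so both `d₁d₂d₃` and `(d₁d₂)²` are. -/
theorem mul_emod_eight_of_isSquare {d₁ d₂ d₃ : ℤ} (o₁ : Odd d₁) (o₂ : Odd d₂) (o₃ : Odd d₃)
    (hd : IsSquare (d₁ * d₂ * d₃)) : d₃ % 8 = (d₁ * d₂) % 8 := by
  have s : ∀ r : ℤ, Odd r → ∃ k, r ^ 2 = 8 * k + 1 := by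
    intro r hr
    have := Int.sq_mod_four_eq_one_of_odd hr
    obtain ⟨k, rfl⟩ := hr
    obtain ⟨m, hm⟩ := Int.even_mul_succ_self k
    exact ⟨m, by linear_combination 4 * hm⟩
  obtain ⟨c, hc⟩ := hd
  have oc : Odd c := by
    have : Odd (c * c) := hc ▸ (o₁.mul o₂).mul o₃
    exact (Int.odd_mul.1 this).1
  obtain ⟨k, hk⟩ := s c oc
  obtain ⟨l, hl⟩ := s (d₁ * d₂) (o₁.mul o₂)
  exact Int.modEq_iff_dvd.2 ⟨l * d₃ - k * (d₁ * d₂),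
    by linear_combination d₃ * hl - d₁ * d₂ * hk - d₁ * d₂ * hc⟩

theorem exists_sq_mul_of_emod {a d : ℤ} (hd : d ≠ 0) (h : (d * a) % 8 = 1) :
    ∃ u : ℚ_[2], (d : ℚ_[2]) * u ^ 2 = a := by
  obtain ⟨r, hr⟩ := isSquare_two_adic h
  have hdQ : (d : ℚ_[2]) ≠ 0 := by exact_mod_cast hd
  refine ⟨r / d, ?_⟩
  push_cast at hr
  field_simp
  linear_combination -hr

theorem Coeffs.OddAtTwo.solvable_two_of_emod_four {e : Coeffs} (he : e.OddAtTwo) {d₁ d₂ d₃ : ℤ}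
    (h₁ : d₁ % 4 = 1) (h₂ : d₂ % 4 = 1) (h₁₂ : d₁ % 8 = d₂ % 8) (h₃ : d₃ % 8 = (d₁ * d₂) % 8) :
    e.Solvable ℚ_[2] d₁ d₂ d₃ := by
  obtain ⟨⟨a, ha⟩, ⟨b, hb⟩, -, h4⟩ := he
  have hs := e.sum_eq
  have n₁ : d₁ ≠ 0 := by rintro rfl; simp at h₁
  have n₂ : d₂ ≠ 0 := by rintro rfl; simp at h₂
  have m : ∀ x y : ℤ, x % 8 = 1 ∨ x % 8 = 5 → y % 8 = x % 8 → (x * y) % 8 = 1 := by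
    rintro x y (hx | hx) hy <;> rw [Int.mul_emod, hy, hx] <;> rfl
  have h₃' : d₃ % 8 = 1 := by rw [h₃]; exact m _ _ (by omega) h₁₂.symm
  have n₃ : d₃ ≠ 0 := by rintro rfl; simp at h₃'
  have hsum : (e.e₁ : ℚ_[2]) + e.e₂ + e.e₃ = 0 := by exact_mod_cast hs
  rcases (by omega : d₂ % 8 = 1 ∨ d₂ % 8 = 5) with h | h
  · obtain ⟨u₁, k₁⟩ := exists_sq_mul_of_emod (a := 1) n₁ (by omega)
    obtain ⟨u₂, k₂⟩ := exists_sq_mul_of_emod (a := 1) n₂ (by omega)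
    obtain ⟨u₃, k₃⟩ := exists_sq_mul_of_emod (a := 1) n₃ (by omega)
    push_cast at k₁ k₂ k₃
    refine ⟨0, u₁, u₂, u₃, ?_, ?_, ?_, ?_⟩
    · rintro ⟨-, rfl, -, -⟩
      simp at k₁
    all_goals push_cast; simp [k₁, k₂, k₃]
  -- When `d₁ ≡ d₂ ≡ 5` modulo `8`, take `t = 2` and `u₂ = 1`. Then `d₃u₃² = d₂ + 4e₁ ≡ 1` because
  -- `e₁` is odd, and `d₁u₁² = d₂ + 4(e₁ + e₂) ≡ 5` because `e₁ + e₂` is even. Both are solvable in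
  -- `ℚ_2`.
  · obtain ⟨u₃, k₃⟩ := exists_sq_mul_of_emod (a := d₂ + 4 * e.e₁) n₃ (m _ _ (by omega) (by omega))
    obtain ⟨u₁, k₁⟩ := exists_sq_mul_of_emod (a := d₂ + 4 * e.e₁ + 4 * e.e₂) n₁
      (m _ _ (by omega) (by omega))
    push_cast at k₁ k₃
    refine ⟨2, u₁, 1, u₃, by simp, ?_, ?_, ?_⟩ <;> push_cast
    · linear_combination -k₃
    · linear_combination k₃ - k₁
    · linear_combination k₁ + 4 * hsum

theorem Coeffs.sq_prod_T (e : Coeffs) :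
    IsSquare ((e.e₂ : ℚ) * (-e.e₁) * (-(e.e₁ * e.e₂))) :=
  ⟨e.e₁ * e.e₂, by ring⟩

/-- The conic `e₃t² + d₁u² = d₂w²` modulo `8` supplies the missing congruence `d₁ ≡ d₂`. As `e₃` is
even, `u` and `w` have the same parity. If both were even, `t` would be odd and `4 ∣ e₃`. So both
are odd and `e₃t² ≡ d₂ - d₁`, a multiple of `4`; thus `t` is even and the difference vanishes modulo
`8`. -/
theorem Coeffs.OddAtTwo.solvable_two_of_emod_one {e : Coeffs} (he : e.OddAtTwo) {d₁ d₂ d₃ : ℤ}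
    (h₁ : d₁ % 4 = 1) (h₂ : d₂ % 4 = 1) (o₃ : Odd d₃) (hd : IsSquare (d₁ * d₂ * d₃))
    (h : e.SolvableAwayTwo d₁ d₂ d₃) : e.Solvable ℚ_[2] d₁ d₂ d₃ := by
  have n₁ : d₁ ≠ 0 := by rintro rfl; simp at h₁
  have n₂ : d₂ ≠ 0 := by rintro rfl; simp at h₂
  have n₃ : d₃ ≠ 0 := by rintro rfl; simp at o₃
  refine he.solvable_two_of_emod_four h₁ h₂ ?_ (mul_emod_eight_of_isSquare
    (Int.odd_iff.2 (by omega)) (Int.odd_iff.2 (by omega)) o₃ hd)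
  obtain ⟨⟨a, ha⟩, ⟨b, hb⟩, -, h4⟩ := he
  have hs := e.sum_eq
  have c3 := (h.conics n₁ n₂ n₃).2.2
  obtain ⟨t, u, w, ht, hu, hw, h1, hk⟩ :=
    exists_int_mod_eight (exists_mod_eight_of_conicSolvable n₁ c3)
  rcases ht with rfl | rfl | rfl <;> rcases hu with rfl | rfl | rfl <;>
    rcases hw with rfl | rfl | rfl <;> simp at h1 <;> omega

theorem isSquare_intCast {z : ℤ} (h : IsSquare z) : IsSquare (z : ℚ) := by
  obtain ⟨c, rfl⟩ := h
  exact ⟨c, Int.cast_mul c c⟩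

/-- Solvability away from `2` implies solvability at `2` for odd triples. -/
theorem Coeffs.OddAtTwo.solvable_two {e : Coeffs} (he : e.OddAtTwo) {d₁ d₂ d₃ : ℤ}
    (o₁ : Odd d₁) (o₂ : Odd d₂) (o₃ : Odd d₃) (hd : IsSquare (d₁ * d₂ * d₃))
    (h : e.SolvableAwayTwo d₁ d₂ d₃) : e.Solvable ℚ_[2] d₁ d₂ d₃ := by
  have n₁ : d₁ ≠ 0 := by rintro rfl; simp at o₁
  have n₂ : d₂ ≠ 0 := by rintro rfl; simp at o₂
  have n₃ : d₃ ≠ 0 := by rintro rfl; simp at o₃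
  have o₁' := Int.odd_iff.1 o₁
  have o₂' := Int.odd_iff.1 o₂
  by_cases h₁₂ : d₁ % 4 = 1 ∧ d₂ % 4 = 1
  · exact he.solvable_two_of_emod_one h₁₂.1 h₁₂.2 o₃ hd h
  have h₃ := mul_emod_eight_of_isSquare o₁ o₂ o₃ hd
  -- From `4 ∤ e₃` follows `e₁ ≡ e₂` modulo `4`. The first two conics modulo `4`, together with `d₃
  -- ≡ d₁d₂`, leave besides `d₁ ≡ d₂ ≡ 1` only `d₁ ≡ e₂`, `d₂ ≡ -e₁`, which multiplication by `T`
  -- brings back to the previous case.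
  have hT : (d₁ * e.e₂) % 4 = 1 ∧ (d₂ * -e.e₁) % 4 = 1 := by
    have he' := he
    obtain ⟨⟨a, ha⟩, ⟨b, hb⟩, -, h4⟩ := he'
    have hs := e.sum_eq
    obtain ⟨c1, c2, -⟩ := h.conics n₁ n₂ n₃
    obtain ⟨t, u, w, ht, hu, hw, h1, hk⟩ :=
      exists_int_mod_eight (exists_mod_eight_of_conicSolvable n₂ c1)
    obtain ⟨t', u', w', ht', hu', hw', h1', hk'⟩ :=
      exists_int_mod_eight (exists_mod_eight_of_conicSolvable n₃ c2)
    have h3 : d₃ % 4 = (d₁ * d₂) % 4 := by omega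
    have k1 : (e.e₁ + d₂) % 4 = 0 ∨ (e.e₁ - d₃) % 4 = 0 ∨ (d₂ - d₃) % 4 = 0 := by
      have := Int.odd_iff.1 o₃
      rcases ht with rfl | rfl | rfl <;> rcases hu with rfl | rfl | rfl <;>
        rcases hw with rfl | rfl | rfl <;> simp at h1 <;> omega
    have k2 : (e.e₂ + d₃) % 4 = 0 ∨ (e.e₂ - d₁) % 4 = 0 ∨ (d₃ - d₁) % 4 = 0 := by
      have := Int.odd_iff.1 o₃
      rcases ht' with rfl | rfl | rfl <;> rcases hu' with rfl | rfl | rfl <;>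
        rcases hw' with rfl | rfl | rfl <;> simp at h1' <;> omega
    clear hk hk' h1 h1' ht hu hw ht' hu' hw'
    rw [Int.mul_emod, Int.mul_emod d₂]
    rw [Int.mul_emod] at h3
    rcases (by omega : d₁ % 4 = 1 ∨ d₁ % 4 = 3) with q₁ | q₁ <;>
    rcases (by omega : d₂ % 4 = 1 ∨ d₂ % 4 = 3) with q₂ | q₂ <;>
    rcases (by omega : e.e₁ % 4 = 1 ∨ e.e₁ % 4 = 3) with q₃ | q₃ <;>
    · rw [q₁, q₂] at h3
      rw [q₁, q₂]
      omega
  have hprod : IsSquare ((d₁ : ℚ) * d₂ * d₃) := by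
    exact_mod_cast isSquare_intCast hd
  have nQ : ∀ d : ℤ, d ≠ 0 → (d : ℚ) ≠ 0 := fun d hd => by exact_mod_cast hd
  have t₁ : (e.e₂ : ℚ) ≠ 0 := nQ _ e.ne₂
  have t₂ : (-e.e₁ : ℚ) ≠ 0 := neg_ne_zero.2 (nQ _ e.ne₁)
  have t₃ : (-(e.e₁ * e.e₂) : ℚ) ≠ 0 := neg_ne_zero.2 (mul_ne_zero (nQ _ e.ne₁) (nQ _ e.ne₂))
  have hmul := h.mul (nQ _ n₁) (nQ _ n₂) (nQ _ n₃) t₁ t₂ t₃ hprod e.sq_prod_T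
    ⟨e.solvable_T ℝ, fun q _ _ => e.solvable_T _⟩
  have hsqT : IsSquare (d₁ * e.e₂ * (d₂ * -e.e₁) * (d₃ * -(e.e₁ * e.e₂))) := by
    obtain ⟨c, hc⟩ := hd
    exact ⟨c * (e.e₁ * e.e₂), by linear_combination (e.e₁ * e.e₂) ^ 2 * hc⟩
  have h2 := he.solvable_two_of_emod_one hT.1 hT.2
    (o₃.mul (he.1.mul he.2.1).neg) hsqT (by push_cast; exact hmul)
  push_cast at h2
  -- A second multiplication by `T` returns to the original triple up to squares.
  have h3 := h2.mul (mul_ne_zero (nQ _ n₁) t₁) (mul_ne_zero (nQ _ n₂) t₂)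
    (mul_ne_zero (nQ _ n₃) t₃) t₁ t₂ t₃ (by exact_mod_cast isSquare_intCast hsqT)
    e.sq_prod_T (e.solvable_T _)
  have c2 : ∀ d : ℚ, d ≠ 0 → (d : ℚ_[2]) ≠ 0 := fun d hd => by exact_mod_cast hd
  have s2 : ∀ d t : ℚ, d ≠ 0 → t ≠ 0 → sq ((d * t * t : ℚ) : ℚ_[2]) = sq (d : ℚ_[2]) := by
    intro d t hd ht
    refine ((sq_eq_iff (c2 _ hd) (c2 _ (mul_ne_zero (mul_ne_zero hd ht) ht))).2
      ⟨t, c2 _ ht, ?_⟩).symm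
    push_cast; ring
  refine HasPoint.of_rep ?_ ?_ ?_ ?_ ?_ ?_ (s2 _ _ ?_ t₁) (s2 _ _ ?_ t₂) (s2 _ _ ?_ t₃) h3
  all_goals first
    | exact nQ _ ‹_›
    | exact c2 _ (nQ _ ‹_›)
    | exact c2 _ (mul_ne_zero (mul_ne_zero (nQ _ ‹_›) ‹_›) ‹_›)

/-! ### Halving points, and descent over finite fields -/

section Field
variable {K : Type} [Field K]

theorem curve_nonsingular_of_two_ne_zero (h2 : (2 : K) ≠ 0) {a b : K} (ha : a ≠ 0) (hb : b ≠ 0)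
    (hab : a + b ≠ 0) {x y : K} (h : y ^ 2 = x * (x - a) * (x + b)) :
    (curve a b).Nonsingular x y := by
  refine (WeierstrassCurve.Affine.equation_iff_nonsingular_of_Δ_ne_zero ?_).1
    ((curve_equation a b x y).2 h)
  have : (curve a b).Δ = 2 ^ 4 * (a * b * (a + b)) ^ 2 := by
    simp only [curve, WeierstrassCurve.Δ, WeierstrassCurve.b₂, WeierstrassCurve.b₄,
      WeierstrassCurve.b₆, WeierstrassCurve.b₈]
    ring
  rw [this]
  exact mul_ne_zero (pow_ne_zero 4 h2) (pow_ne_zero 2 (mul_ne_zero (mul_ne_zero ha hb) hab))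

theorem curve_negY (a b x y : K) : (curve a b).negY x y = -y := by
  simp [WeierstrassCurve.Affine.negY, curve]

/-- A point all of whose coordinates `x - root` are squares is twice a point. -/
theorem exists_double [DecidableEq K] (h2 : (2 : K) ≠ 0) {a b : K} (ha : a ≠ 0) (hb : b ≠ 0)
    (hab : a + b ≠ 0) {x α β γ : K} (h1 : x + b = α ^ 2) (h2' : x - a = β ^ 2) (h3 : x = γ ^ 2)
    (h : (curve a b).Nonsingular x (α * β * γ)) :
    ∃ Q : (curve a b).Point, Q + Q = .some x (α * β * γ) h := by
  have n1 : α + β ≠ 0 := fun h0 => hab (by linear_combination h1 - h2' + (α - β) * h0)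
  have n2 : α + γ ≠ 0 := fun h0 => hb (by linear_combination h1 - h3 + (α - γ) * h0)
  have n3 : β + γ ≠ 0 := fun h0 => ha (by linear_combination h3 - h2' + (γ - β) * h0)
  -- The classical halving formula: `X + b`, `X - a` and `X` are the products of pairs of the sums
  -- `α + β`, `β + γ`, `α + γ`, and the tangent at `(X, Y)` has slope `α + β + γ`.
  obtain ⟨X, hX⟩ : ∃ X, X = x + (α * β + β * γ + γ * α) := ⟨_, rfl⟩
  obtain ⟨Y, hY⟩ : ∃ Y, Y = (α + β) * (β + γ) * (α + γ) := ⟨_, rfl⟩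
  have hY0 : Y ≠ 0 := by
    rw [hY]; exact mul_ne_zero (mul_ne_zero n1 n3) n2
  have f1 : X + b = (α + β) * (α + γ) := by rw [hX]; linear_combination h1
  have f2 : X - a = (α + β) * (β + γ) := by rw [hX]; linear_combination h2'
  have f3 : X = (α + γ) * (β + γ) := by rw [hX]; linear_combination h3
  have hE : Y ^ 2 = X * (X - a) * (X + b) := by
    rw [f1, f2, f3, hY]; ring
  have hne : Y ≠ (curve a b).negY X Y := by
    rw [curve_negY]
    intro h0
    have : 2 * Y = 0 := by linear_combination h0
    exact (mul_ne_zero h2 hY0) this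
  refine ⟨.some X Y (curve_nonsingular_of_two_ne_zero h2 ha hb hab hE), ?_⟩
  rw [WeierstrassCurve.Affine.Point.add_self_of_Y_ne hne]
  have hsl : (curve a b).slope X X Y Y = α + β + γ := by
    rw [WeierstrassCurve.Affine.slope_of_Y_ne rfl hne, div_eq_iff (sub_ne_zero.2 hne), curve_negY]
    simp only [curve]
    have e2 : 3 * X ^ 2 + 2 * (b - a) * X + -(a * b) - 0 * Y =
        (X - a) * (X + b) + X * (X + b) + X * (X - a) := by ring
    rw [e2, f1, f2, f3, hY]; ring
  have hx : (curve a b).addX X X ((curve a b).slope X X Y Y) = x := by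
    rw [hsl]
    simp only [WeierstrassCurve.Affine.addX, curve]
    rw [hX]; linear_combination -h1 - h2' - h3
  have hy : (curve a b).addY X X Y ((curve a b).slope X X Y Y) = α * β * γ := by
    rw [WeierstrassCurve.Affine.addY, WeierstrassCurve.Affine.negAddY, curve_negY, hx, hsl, hX, hY]
    ring
  simp only [WeierstrassCurve.Affine.Point.some.injEq]
  exact ⟨hx, hy⟩

theorem exists_sq_of_comp_eq_one {r s t x : K} (h : comp r s t x = 1) : ∃ c, x - r = c ^ 2 := by
  unfold comp at h
  split_ifs at h with hx
  · exact ⟨0, by rw [hx]; ring⟩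
  · obtain ⟨c, -, hc⟩ := (sq_eq_one_iff (sub_ne_zero.2 hx)).1 h
    exact ⟨c, hc⟩

/-- The kernel of the descent map is `2 E(K)`. -/
theorem exists_double_of_descentFun_eq_one [DecidableEq K] (h2 : (2 : K) ≠ 0) {a b : K}
    (ha : a ≠ 0) (hb : b ≠ 0) (hab : a + b ≠ 0) (P : (curve a b).Point)
    (hP : descentFun a b P = 1) : ∃ Q, Q + Q = P := by
  rcases P with _ | ⟨x, y, h⟩
  · exact ⟨0, add_zero _⟩
  simp only [descentFun, Prod.ext_iff, Prod.fst_one, Prod.snd_one] at hP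
  obtain ⟨α, h1⟩ := exists_sq_of_comp_eq_one hP.1
  obtain ⟨β, h2'⟩ := exists_sq_of_comp_eq_one hP.2.1
  obtain ⟨γ, h3⟩ := exists_sq_of_comp_eq_one hP.2.2
  rw [sub_neg_eq_add] at h1
  rw [sub_zero] at h3
  have hE := (curve_equation a b x y).1 h.1
  -- The equation of the curve gives `y² = (αβγ)²`; a wrong sign is absorbed into `α`.
  have hy : (y - α * β * γ) * (y + α * β * γ) = 0 := by
    rw [h1, h2'] at hE
    rw [h3] at hE
    linear_combination hE
  rcases mul_eq_zero.1 hy with hy | hy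
  · obtain rfl : y = α * β * γ := by linear_combination hy
    exact exists_double h2 ha hb hab h1 h2' h3 h
  · obtain rfl : y = -α * β * γ := by linear_combination hy
    exact exists_double h2 ha hb hab (by rw [h1]; ring) h2' h3 h

/-- The descent map as a homomorphism into the first two components. -/
noncomputable def descentHom [DecidableEq K] {a b : K} (ha : a ≠ 0) (hb : b ≠ 0)
    (hab : a + b ≠ 0) : Multiplicative (curve a b).Point →* SqClass K × SqClass K where
  toFun P := ((descentFun a b P.toAdd).1, (descentFun a b P.toAdd).2.1)
  map_one' := rfl
  map_mul' P Q := by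
    have := descentFun_add ha hb hab P.toAdd Q.toAdd
    rw [toAdd_mul, this]
    rfl

/-- Kernel and image of an endomorphism have orders with product `|G|`, and so do the image and its
index. -/
theorem index_range_powMonoidHom_two {G : Type} [CommGroup G] [Finite G] :
    (powMonoidHom 2 : G →* G).range.index = Nat.card (powMonoidHom 2 : G →* G).ker := by
  have h1 := (powMonoidHom 2 : G →* G).range.card_mul_index
  have h2 := (powMonoidHom 2 : G →* G).ker.card_mul_index
  rw [Subgroup.index_ker, ← h1, mul_comm] at h2
  exact (Nat.eq_of_mul_eq_mul_left Nat.card_pos h2).symm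

/-- The index of the squares is the order of the kernel of squaring, which is contained in `{1,
-1}`. -/
theorem card_sqClass_le [Finite K] : Nat.card (SqClass K) ≤ 2 := by
  have h : Nat.card (SqClass K) = (powMonoidHom 2 : Kˣ →* Kˣ).range.index := rfl
  rw [h, index_range_powMonoidHom_two]
  have : Set.ncard (((powMonoidHom 2 : Kˣ →* Kˣ).ker : Set Kˣ)) ≤ Set.ncard ({1, -1} : Set Kˣ) := by
    refine Set.ncard_le_ncard ?_ (Set.toFinite _)
    intro u hu
    have hu' : u ^ 2 = 1 := hu
    have : (u : K) ^ 2 = 1 := by rw [← Units.val_pow_eq_pow_val, hu', Units.val_one]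
    rcases (sq_eq_sq_iff_eq_or_eq_neg.1 (this.trans (one_pow 2).symm)) with h | h
    · exact Or.inl (Units.ext h)
    · exact Or.inr (Units.ext (by simpa using h))
  exact this.trans (Set.ncard_insert_le _ _ |>.trans (by simp))

/-- A count: the kernel lies in `2E(K)`, so the image has at least `[E(K) : 2E(K)] = |E(K)[2]|`
elements. The three roots and the zero point make this at least `4`, while the target has at most
`4`. No estimate for the number of points is needed. -/
theorem descentHom_surjective [Finite K] [DecidableEq K] (h2 : (2 : K) ≠ 0) {a b : K} (ha : a ≠ 0)
    (hb : b ≠ 0) (hab : a + b ≠ 0) : Function.Surjective (descentHom ha hb hab) := by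
  set δ := descentHom ha hb hab
  have hfin : Finite (curve a b).Point :=
    have : Finite (WithZero {xy : K × K // (curve a b).Nonsingular xy.1 xy.2}) :=
      inferInstanceAs (Finite (Option _))
    Finite.of_equiv _ (WeierstrassCurve.Affine.nonsingularPointEquiv (curve a b)).symm
  have hker : δ.ker ≤ (powMonoidHom 2 : Multiplicative (curve a b).Point →* _).range := by
    intro P hP
    have hP' : δ P = 1 := hP
    have h1 : (descentFun a b P.toAdd).1 = 1 := congrArg Prod.fst hP'
    have h2' : (descentFun a b P.toAdd).2.1 = 1 := congrArg Prod.snd hP'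
    have h3 : (descentFun a b P.toAdd).2.2 = 1 := by
      obtain ⟨d₁, d₂, d₃, -, -, -, hd, -, hprod⟩ := hasPoint_of_descentFun (e₃ := -(a + b)) ha hb
        (by ring) (neg_ne_zero.2 hab) P.toAdd
      rw [hd] at h1 h2' ⊢
      simp only at h1 h2' ⊢
      rwa [h1, h2', one_mul, one_mul] at hprod
    obtain ⟨Q, hQ⟩ := exists_double_of_descentFun_eq_one h2 ha hb hab P.toAdd
      (Prod.ext h1 (Prod.ext h2' h3))
    exact ⟨Multiplicative.ofAdd Q, by
      rw [powMonoidHom_apply, pow_two, ← ofAdd_add, hQ, ofAdd_toAdd]⟩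
  have h4 : 4 ≤ Nat.card (powMonoidHom 2 : Multiplicative (curve a b).Point →* _).ker := by
    have ns : ∀ r, r * (r - a) * (r + b) = 0 → (curve a b).Nonsingular r 0 := fun r hr =>
      curve_nonsingular_of_two_ne_zero h2 ha hb hab (by rw [hr]; ring)
    have tw : ∀ r (h : (curve a b).Nonsingular r 0),
        Multiplicative.ofAdd (WeierstrassCurve.Affine.Point.some r 0 h) ∈
        (powMonoidHom 2 : Multiplicative (curve a b).Point →* _).ker := fun r h => by
      rw [MonoidHom.mem_ker, powMonoidHom_apply, pow_two, ← ofAdd_add,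
        WeierstrassCurve.Affine.Point.add_self_of_Y_eq (by rw [curve_negY, neg_zero])]
      rfl
    have s0 := ns 0 (by ring)
    have s1 := ns a (by ring)
    have s2 := ns (-b) (by ring)
    let f : Fin 4 → (powMonoidHom 2 : Multiplicative (curve a b).Point →* _).ker :=
      ![1, ⟨_, tw 0 s0⟩, ⟨_, tw a s1⟩, ⟨_, tw (-b) s2⟩]
    have hba : -b ≠ a := fun h => hab (by linear_combination -h)
    have hbz : -b ≠ 0 := neg_ne_zero.2 hb
    have z1 : ∀ r (h : (curve a b).Nonsingular r 0),
        (1 : Multiplicative (curve a b).Point) ≠ Multiplicative.ofAdd (.some r 0 h) :=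
      fun r h h0 => by cases h0
    have z2 : ∀ r s (h : (curve a b).Nonsingular r 0) (h' : (curve a b).Nonsingular s 0), r ≠ s →
        Multiplicative.ofAdd (WeierstrassCurve.Affine.Point.some r 0 h) ≠
          Multiplicative.ofAdd (.some s 0 h') :=
      fun r s h h' hrs h0 => by
        rw [Multiplicative.ofAdd.injective.eq_iff, WeierstrassCurve.Affine.Point.some.injEq] at h0
        exact hrs h0.1
    have hf : Function.Injective f := by
      intro i j hij
      have hij' := congrArg Subtype.val hij
      fin_cases i <;> fin_cases j <;> first
        | rfl
        | exact absurd hij' (z1 _ _)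
        | exact absurd hij'.symm (z1 _ _)
        | exact absurd hij' (z2 _ _ _ _ ha.symm)
        | exact absurd hij' (z2 _ _ _ _ ha)
        | exact absurd hij' (z2 _ _ _ _ hbz)
        | exact absurd hij' (z2 _ _ _ _ hbz.symm)
        | exact absurd hij' (z2 _ _ _ _ hba)
        | exact absurd hij' (z2 _ _ _ _ hba.symm)
    simpa using Nat.card_le_card_of_injective f hf
  have hrange : 4 ≤ Nat.card δ.range := by
    rw [← Subgroup.index_ker]
    rw [← index_range_powMonoidHom_two] at h4
    exact h4.trans (Nat.le_of_dvd (Nat.pos_of_ne_zero Subgroup.index_ne_zero_of_finite)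
      (Subgroup.index_dvd_of_le hker))
  have hfinS : Finite (SqClass K) := inferInstanceAs (Finite (Kˣ ⧸ _))
  have hcard : Nat.card (SqClass K × SqClass K) ≤ 4 := by
    rw [Nat.card_prod]
    exact Nat.mul_le_mul card_sqClass_le card_sqClass_le
  rw [← MonoidHom.range_eq_top]
  exact Subgroup.eq_top_of_le_card _ (hcard.trans hrange)

/-- Over a finite field of odd characteristic the homogeneous spaces have points. -/
theorem hasPoint_of_finite [Finite K] (h2 : (2 : K) ≠ 0) {e₁ e₂ e₃ d₁ d₂ d₃ : K} (he₁ : e₁ ≠ 0)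
    (he₂ : e₂ ≠ 0) (he₃ : e₃ ≠ 0) (he : e₁ + e₂ + e₃ = 0) (h₁ : d₁ ≠ 0) (h₂ : d₂ ≠ 0) (h₃ : d₃ ≠ 0)
    (hd : IsSquare (d₁ * d₂ * d₃)) : HasPoint e₁ e₂ e₃ d₁ d₂ d₃ := by
  classical
  have hab : e₁ + e₂ ≠ 0 := fun h0 => he₃ (by linear_combination he - h0)
  obtain ⟨P, hP⟩ := descentHom_surjective h2 he₁ he₂ hab (sq d₁, sq d₂)
  obtain ⟨f₁, f₂, f₃, n₁, n₂, n₃, hf, hpt, hprod⟩ :=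
    hasPoint_of_descentFun he₁ he₂ he he₃ P.toAdd
  have q₁ : sq f₁ = sq d₁ := (congrArg Prod.fst hf).symm.trans (congrArg Prod.fst hP)
  have q₂ : sq f₂ = sq d₂ :=
    (congrArg (fun c => c.2.1) hf).symm.trans (congrArg Prod.snd hP)
  refine hpt.of_rep n₁ n₂ n₃ h₁ h₂ h₃ q₁ q₂ ?_
  obtain ⟨c, hc⟩ := hd
  have hn := mul_ne_zero (mul_ne_zero h₁ h₂) h₃
  have hprod' : sq d₁ * sq d₂ * sq d₃ = 1 := by
    rw [← sq_mul h₁ h₂, ← sq_mul (mul_ne_zero h₁ h₂) h₃, sq_eq_one_iff hn]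
    exact ⟨c, fun h0 => hn (by rw [hc, h0, zero_mul]), by rw [hc]; ring⟩
  rw [← hprod', q₁, q₂] at hprod
  exact mul_left_cancel hprod

end Field

theorem Coeffs.solvable_intCast {e : Coeffs} {K : Type} [Field K] [CharZero K] {d₁ d₂ d₃ : ℤ} :
    e.Solvable K d₁ d₂ d₃ ↔
      HasPoint (e.e₁ : K) (e.e₂ : K) (e.e₃ : K) (d₁ : K) (d₂ : K) (d₃ : K) := by
  simp [Coeffs.Solvable]

/-- The point has `t = 0`, so the coefficients `a`, `b`, `c` play no role. -/
theorem hasPoint_of_isSquare {K : Type} [Field K] {a b c d₁ d₂ d₃ : K} (h₁ : d₁ ≠ 0) (h₂ : d₂ ≠ 0)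
    (h₃ : d₃ ≠ 0) (s₁ : IsSquare d₁) (s₂ : IsSquare d₂) (s₃ : IsSquare d₃) :
    HasPoint a b c d₁ d₂ d₃ := by
  obtain ⟨r₁, rfl⟩ := s₁
  obtain ⟨r₂, rfl⟩ := s₂
  obtain ⟨r₃, rfl⟩ := s₃
  have n₁ := left_ne_zero_of_mul h₁
  have n₂ := left_ne_zero_of_mul h₂
  have n₃ := left_ne_zero_of_mul h₃
  refine ⟨0, 1 / r₁, 1 / r₂, 1 / r₃, by simp [n₁], ?_, ?_, ?_⟩ <;> field_simp <;> ring

/-! ### Local solvability at odd primes -/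

section Padic
variable {p : ℕ} [Fact p.Prime]

theorem toZMod_intCast_ne_zero {d : ℤ} (hd : ¬ (p : ℤ) ∣ d) : (d : ZMod p) ≠ 0 := by
  rwa [Ne, ZMod.intCast_zmod_eq_zero_iff_dvd]

theorem intCast_padic_ne_zero {d : ℤ} (hd : ¬ (p : ℤ) ∣ d) : (d : ℚ_[p]) ≠ 0 := by
  rw [Int.cast_ne_zero]
  rintro rfl
  exact hd (dvd_zero _)

theorem toZMod_eq_zero_iff (x : ℤ_[p]) : PadicInt.toZMod x = 0 ↔ (p : ℤ_[p]) ∣ x := by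
  rw [← RingHom.mem_ker, PadicInt.ker_toZMod, PadicInt.maximalIdeal_eq_span_p,
    Ideal.mem_span_singleton]

theorem exists_sqrt_lift (hp : p ≠ 2) {d : ℤ} (hd : ¬ (p : ℤ) ∣ d) {r : ℤ_[p]} {u : ZMod p}
    (hu : u ≠ 0) (h : PadicInt.toZMod r = d * u ^ 2) :
    ∃ U : ℚ_[p], U ≠ 0 ∧ (d : ℚ_[p]) * U ^ 2 = r := by
  have hdz := toZMod_intCast_ne_zero hd
  have hr : PadicInt.toZMod r ≠ 0 := by
    rw [h]; exact mul_ne_zero hdz (pow_ne_zero 2 hu)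
  obtain ⟨s, hs⟩ := isSquare_of_residue hp (u := d * r)
    (by rw [map_mul, map_intCast]; exact mul_ne_zero hdz hr)
    ⟨d * u, by rw [map_mul, map_intCast, h]; ring⟩
  have hdQ : (d : ℚ_[p]) ≠ 0 := intCast_padic_ne_zero hd
  have hs' := congrArg (fun x : ℤ_[p] => (x : ℚ_[p])) hs
  push_cast at hs'
  have key : (d : ℚ_[p]) * (s / d) ^ 2 = r := by
    field_simp
    linear_combination -hs'
  refine ⟨s / d, ?_, key⟩
  intro h0
  rw [h0] at key
  apply hr
  have : r = 0 := PadicInt.ext (by rw [← key]; simp)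
  rw [this, map_zero]

/-- Lifting a point of a homogeneous space from `𝔽_p` to `ℚ_p`. -/
theorem hasPoint_of_residue_aux (hp : p ≠ 2) {a b c d₁ d₂ d₃ : ℤ} (hs : a + b + c = 0)
    (h₂ : ¬ (p : ℤ) ∣ d₂) (h₃ : ¬ (p : ℤ) ∣ d₃) {t u₁ u₂ u₃ : ZMod p}
    (n₂ : u₂ ≠ 0) (n₃ : u₃ ≠ 0) (k₂ : (b : ZMod p) * t ^ 2 + d₃ * u₃ ^ 2 - d₁ * u₁ ^ 2 = 0)
    (k₃ : (c : ZMod p) * t ^ 2 + d₁ * u₁ ^ 2 - d₂ * u₂ ^ 2 = 0) :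
    HasPoint (a : ℚ_[p]) (b : ℚ_[p]) (c : ℚ_[p]) (d₁ : ℚ_[p]) (d₂ : ℚ_[p]) (d₃ : ℚ_[p]) := by
  -- The coordinates `t` and `u₁` are lifted arbitrarily, and the last two equations are solved for
  -- `u₂` and `u₃` by Hensel's lemma. The first equation then follows from `a + b + c = 0`.
  obtain ⟨T, rfl⟩ := ZMod.ringHom_surjective (PadicInt.toZMod : ℤ_[p] →+* ZMod p) t
  obtain ⟨U₁, rfl⟩ := ZMod.ringHom_surjective (PadicInt.toZMod : ℤ_[p] →+* ZMod p) u₁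
  obtain ⟨U₂, m₂, l₂⟩ := exists_sqrt_lift hp h₂ (r := c * T ^ 2 + d₁ * U₁ ^ 2) n₂ (by
    simp only [map_add, map_mul, map_pow, map_intCast]; linear_combination k₃)
  obtain ⟨U₃, -, l₃⟩ := exists_sqrt_lift hp h₃ (r := d₁ * U₁ ^ 2 - b * T ^ 2) n₃ (by
    simp only [map_sub, map_mul, map_pow, map_intCast]; linear_combination -k₂)
  push_cast at l₂ l₃
  have hsQ : (a : ℚ_[p]) + b + c = 0 := by exact_mod_cast hs
  refine ⟨T, U₁, U₂, U₃, by simp [m₂], ?_, ?_, ?_⟩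
  · linear_combination l₂ - l₃ + (T : ℚ_[p]) ^ 2 * hsQ
  · linear_combination l₃
  · linear_combination -l₂

/-- If one `uᵢ` vanishes, the unit coefficients force the other two to be nonzero. So some two are
nonzero, and the cyclic symmetry moves them to the positions that `hasPoint_of_residue_aux`
requires. -/
theorem hasPoint_of_residue (hp : p ≠ 2) {a b c d₁ d₂ d₃ : ℤ} (hs : a + b + c = 0)
    (ha : ¬ (p : ℤ) ∣ a) (hb : ¬ (p : ℤ) ∣ b) (hc : ¬ (p : ℤ) ∣ c)
    (h₁ : ¬ (p : ℤ) ∣ d₁) (h₂ : ¬ (p : ℤ) ∣ d₂) (h₃ : ¬ (p : ℤ) ∣ d₃)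
    (h : HasPoint (a : ZMod p) (b : ZMod p) (c : ZMod p) (d₁ : ZMod p) (d₂ : ZMod p)
      (d₃ : ZMod p)) :
    HasPoint (a : ℚ_[p]) (b : ℚ_[p]) (c : ℚ_[p]) (d₁ : ℚ_[p]) (d₂ : ℚ_[p]) (d₃ : ℚ_[p]) := by
  obtain ⟨t, u₁, u₂, u₃, h0, k₁, k₂, k₃⟩ := h
  have za := toZMod_intCast_ne_zero ha
  have zb := toZMod_intCast_ne_zero hb
  have zc := toZMod_intCast_ne_zero hc
  have z₁ := toZMod_intCast_ne_zero h₁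
  have z₂ := toZMod_intCast_ne_zero h₂
  have z₃ := toZMod_intCast_ne_zero h₃
  by_cases n₂ : u₂ = 0
  · subst n₂
    have n₃ : u₃ ≠ 0 := by
      rintro rfl
      have ht : t = 0 := by simpa [za] using k₁
      subst ht
      exact h0 ⟨rfl, by simpa [z₁] using k₃, rfl, rfl⟩
    have n₁ : u₁ ≠ 0 := by
      rintro rfl
      have ht : t = 0 := by simpa [zc] using k₃
      subst ht
      exact h0 ⟨rfl, rfl, rfl, by simpa [z₃] using k₁⟩
    exact (hasPoint_of_residue_aux hp (by linear_combination hs) h₃ h₁ n₃ n₁ k₃ k₁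
      : HasPoint (b : ℚ_[p]) c a d₂ d₃ d₁).rotate.rotate
  by_cases n₃ : u₃ = 0
  · subst n₃
    have n₁ : u₁ ≠ 0 := by
      rintro rfl
      have ht : t = 0 := by simpa [zb] using k₂
      subst ht
      exact h0 ⟨rfl, rfl, by simpa [z₂] using k₁, rfl⟩
    exact (hasPoint_of_residue_aux hp (by linear_combination hs) h₁ h₂ n₁ n₂ k₁ k₂
      : HasPoint (c : ℚ_[p]) a b d₃ d₁ d₂).rotate
  exact hasPoint_of_residue_aux hp hs h₂ h₃ n₂ n₃ k₂ k₃

theorem two_ne_zero_zmod (hp : p ≠ 2) : (2 : ZMod p) ≠ 0 := by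
  have := toZMod_intCast_ne_zero (p := p) (d := 2) (fun h => hp
    ((Nat.prime_dvd_prime_iff_eq Fact.out Nat.prime_two).1 (by exact_mod_cast h)))
  exact_mod_cast this

/-- The homogeneous spaces of unit triples have points at the odd primes of good reduction. -/
theorem Coeffs.solvable_of_good (e : Coeffs) (hp : p ≠ 2) (he : ¬ (p : ℤ) ∣ e.e₁ * e.e₂ * e.e₃)
    {d₁ d₂ d₃ : ℤ} (h₁ : ¬ (p : ℤ) ∣ d₁) (h₂ : ¬ (p : ℤ) ∣ d₂) (h₃ : ¬ (p : ℤ) ∣ d₃)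
    (hd : IsSquare (d₁ * d₂ * d₃)) : e.Solvable ℚ_[p] d₁ d₂ d₃ := by
  have ha : ¬ (p : ℤ) ∣ e.e₁ := fun h => he ((h.mul_right _).mul_right _)
  have hb : ¬ (p : ℤ) ∣ e.e₂ := fun h => he ((h.mul_left _).mul_right _)
  have hc : ¬ (p : ℤ) ∣ e.e₃ := fun h => he (h.mul_left _)
  rw [Coeffs.solvable_intCast]
  refine hasPoint_of_residue hp e.sum_eq ha hb hc h₁ h₂ h₃ ?_
  refine hasPoint_of_finite (two_ne_zero_zmod hp) (toZMod_intCast_ne_zero ha)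
    (toZMod_intCast_ne_zero hb) (toZMod_intCast_ne_zero hc) ?_ (toZMod_intCast_ne_zero h₁)
    (toZMod_intCast_ne_zero h₂) (toZMod_intCast_ne_zero h₃) ?_
  · exact_mod_cast congrArg (Int.cast (R := ZMod p)) e.sum_eq
  · obtain ⟨c, hc⟩ := hd
    exact ⟨c, by exact_mod_cast congrArg (Int.cast (R := ZMod p)) hc⟩

/-- A `ℚ_p`-point of a homogeneous space has primitive coordinates. -/
theorem HasPoint.exists_primitive {a b c d₁ d₂ d₃ : ℤ}
    (h : HasPoint (a : ℚ_[p]) (b : ℚ_[p]) (c : ℚ_[p]) (d₁ : ℚ_[p]) (d₂ : ℚ_[p]) (d₃ : ℚ_[p])) :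
    ∃ t u₁ u₂ u₃ : ℤ_[p], (t = 1 ∨ u₁ = 1 ∨ u₂ = 1 ∨ u₃ = 1) ∧
      (a : ℤ_[p]) * t ^ 2 + d₂ * u₂ ^ 2 - d₃ * u₃ ^ 2 = 0 ∧
      (b : ℤ_[p]) * t ^ 2 + d₃ * u₃ ^ 2 - d₁ * u₁ ^ 2 = 0 ∧
      (c : ℤ_[p]) * t ^ 2 + d₁ * u₁ ^ 2 - d₂ * u₂ ^ 2 = 0 := by
  obtain ⟨t, u₁, u₂, u₃, h0, k₁, k₂, k₃⟩ := h
  obtain ⟨v, s, hs, hv, j, hj⟩ := TwoDescent.exists_primitive ![t, u₁, u₂, u₃] (by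
    intro h'
    apply h0
    have h1 := congrFun h' 0
    have h2 := congrFun h' 1
    have h3 := congrFun h' 2
    have h4 := congrFun h' 3
    simp only [Matrix.cons_val, Pi.zero_apply] at h1 h2 h3 h4
    exact ⟨h1, h2, h3, h4⟩)
  have e0 := hv 0
  have e1 := hv 1
  have e2 := hv 2
  have e3 := hv 3
  simp only [Matrix.cons_val] at e0 e1 e2 e3
  subst e0 e1 e2 e3
  have hs2 : s ^ 2 ≠ 0 := pow_ne_zero 2 hs
  refine ⟨v 0, v 1, v 2, v 3, ?_, ?_, ?_, ?_⟩
  · fin_cases j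
    · exact Or.inl hj
    · exact Or.inr (Or.inl hj)
    · exact Or.inr (Or.inr (Or.inl hj))
    · exact Or.inr (Or.inr (Or.inr hj))
  all_goals
    refine PadicInt.ext (mul_left_cancel₀ hs2 ?_)
    push_cast
  · linear_combination k₁
  · linear_combination k₂
  · linear_combination k₃

theorem not_dvd_all_of_eq_one {t u₁ u₂ u₃ : ℤ_[p]} (h : t = 1 ∨ u₁ = 1 ∨ u₂ = 1 ∨ u₃ = 1) :
    ¬ ((p : ℤ_[p]) ∣ t ∧ (p : ℤ_[p]) ∣ u₁ ∧ (p : ℤ_[p]) ∣ u₂ ∧ (p : ℤ_[p]) ∣ u₃) := by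
  rintro ⟨h0, h1, h2, h3⟩
  have : (p : ℤ_[p]) ∣ 1 := by
    rcases h with rfl | rfl | rfl | rfl <;> assumption
  exact PadicInt.prime_p.not_isUnit (isUnit_of_dvd_one this)

theorem dvd_of_dvd_intCast_mul_sq {d : ℤ} {u : ℤ_[p]} (hd : ¬ (p : ℤ) ∣ d)
    (h : (p : ℤ_[p]) ∣ d * u ^ 2) : (p : ℤ_[p]) ∣ u :=
  PadicInt.prime_p.dvd_of_dvd_pow ((PadicInt.prime_p.dvd_or_dvd h).resolve_left
    fun h' => hd ((padicInt_dvd_int_iff d).1 h'))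

/-- The valuation of `d` is at most `1`, so `u²` must contribute a factor `p`. -/
theorem dvd_of_sq_dvd_intCast_mul_sq {d : ℤ} {u : ℤ_[p]} (hd : ¬ (p : ℤ) ^ 2 ∣ d)
    (h : (p : ℤ_[p]) ^ 2 ∣ d * u ^ 2) : (p : ℤ_[p]) ∣ u := by
  by_cases hpd : (p : ℤ) ∣ d
  · obtain ⟨d', rfl⟩ := hpd
    have hd' : ¬ (p : ℤ) ∣ d' := by
      rintro ⟨d'', rfl⟩
      exact hd ⟨d'', by ring⟩
    refine dvd_of_dvd_intCast_mul_sq hd' ?_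
    obtain ⟨k, hk⟩ := h
    refine ⟨k, mul_left_cancel₀ PadicInt.prime_p.ne_zero ?_⟩
    push_cast at hk
    linear_combination hk
  · exact dvd_of_dvd_intCast_mul_sq hpd ((dvd_pow_self _ two_ne_zero).trans h)

/-- Two of the `dᵢ` cannot have odd valuation at a prime that does not divide the third `eᵢ`. -/
theorem not_hasPoint_of_dvd {a b c d₁ d₂ d₃ : ℤ} (hc : ¬ (p : ℤ) ∣ c)
    (h₁ : (p : ℤ) ∣ d₁) (h₂ : (p : ℤ) ∣ d₂) (h₁' : ¬ (p : ℤ) ^ 2 ∣ d₁) (h₂' : ¬ (p : ℤ) ^ 2 ∣ d₂)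
    (h₃ : ¬ (p : ℤ) ∣ d₃) :
    ¬ HasPoint (a : ℚ_[p]) (b : ℚ_[p]) (c : ℚ_[p]) (d₁ : ℚ_[p]) (d₂ : ℚ_[p]) (d₃ : ℚ_[p]) := by
  intro h
  obtain ⟨t, u₁, u₂, u₃, h1, k₁, k₂, k₃⟩ := h.exists_primitive
  have q₁ := (padicInt_dvd_int_iff (p := p) d₁).2 h₁
  have q₂ := (padicInt_dvd_int_iff (p := p) d₂).2 h₂
  have ht : (p : ℤ_[p]) ∣ t := by
    refine dvd_of_dvd_intCast_mul_sq hc ?_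
    have : (c : ℤ_[p]) * t ^ 2 = d₂ * u₂ ^ 2 - d₁ * u₁ ^ 2 := by linear_combination k₃
    rw [this]
    exact dvd_sub (q₂.mul_right _) (q₁.mul_right _)
  have hu₃ : (p : ℤ_[p]) ∣ u₃ := by
    refine dvd_of_dvd_intCast_mul_sq h₃ ?_
    have : (d₃ : ℤ_[p]) * u₃ ^ 2 = a * t ^ 2 + d₂ * u₂ ^ 2 := by linear_combination -k₁
    rw [this]
    exact dvd_add ((dvd_pow ht two_ne_zero).mul_left _) (q₂.mul_right _)
  have ht2 := pow_dvd_pow_of_dvd ht 2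
  have hu2 := pow_dvd_pow_of_dvd hu₃ 2
  refine not_dvd_all_of_eq_one h1 ⟨ht, dvd_of_sq_dvd_intCast_mul_sq h₁' ?_,
    dvd_of_sq_dvd_intCast_mul_sq h₂' ?_, hu₃⟩
  · have : (d₁ : ℤ_[p]) * u₁ ^ 2 = b * t ^ 2 + d₃ * u₃ ^ 2 := by linear_combination -k₂
    rw [this]
    exact dvd_add (ht2.mul_left _) (hu2.mul_left _)
  · have : (d₂ : ℤ_[p]) * u₂ ^ 2 = d₃ * u₃ ^ 2 - a * t ^ 2 := by linear_combination k₁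
    rw [this]
    exact dvd_sub (hu2.mul_left _) (ht2.mul_left _)

/-- At a prime exactly dividing the twist, unit triples with a local point are trivial. -/
theorem isSquare_of_hasPoint_twist {a b c d₁ d₂ d₃ : ℤ} (ha : (p : ℤ) ∣ a) (hb : (p : ℤ) ∣ b)
    (ha' : ¬ (p : ℤ) ^ 2 ∣ a) (h₁ : ¬ (p : ℤ) ∣ d₁) (h₂ : ¬ (p : ℤ) ∣ d₂) (h₃ : ¬ (p : ℤ) ∣ d₃)
    (hd : IsSquare (d₁ * d₂ * d₃))
    (h : HasPoint (a : ℚ_[p]) (b : ℚ_[p]) (c : ℚ_[p]) (d₁ : ℚ_[p]) (d₂ : ℚ_[p]) (d₃ : ℚ_[p])) :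
    IsSquare (d₁ : ZMod p) ∧ IsSquare (d₂ : ZMod p) := by
  obtain ⟨t, u₁, u₂, u₃, h1, k₁, k₂, -⟩ := h.exists_primitive
  have za : (a : ZMod p) = 0 := (ZMod.intCast_zmod_eq_zero_iff_dvd _ _).2 ha
  have zb : (b : ZMod p) = 0 := (ZMod.intCast_zmod_eq_zero_iff_dvd _ _).2 hb
  have z₁ := toZMod_intCast_ne_zero h₁
  have z₂ := toZMod_intCast_ne_zero h₂
  have z₃ := toZMod_intCast_ne_zero h₃
  have m₁ := congrArg (PadicInt.toZMod (p := p)) k₁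
  have m₂ := congrArg (PadicInt.toZMod (p := p)) k₂
  simp only [map_add, map_sub, map_mul, map_pow, map_intCast, map_zero, za, zb, zero_mul, zero_add]
    at m₁ m₂
  -- Modulo `p` the three `dᵢuᵢ²` agree. If they vanish, `p² ∣ a t²`, and `p² ∤ a` makes `t`
  -- divisible by `p` too, against primitivity.
  have n₃ : PadicInt.toZMod u₃ ≠ 0 := by
    intro h0
    rw [h0] at m₁ m₂
    have hu₂ : PadicInt.toZMod u₂ = 0 := by simpa [z₂] using m₁
    have hu₁ : PadicInt.toZMod u₁ = 0 := by simpa [z₁] using m₂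
    rw [toZMod_eq_zero_iff] at h0 hu₁ hu₂
    refine not_dvd_all_of_eq_one h1 ⟨dvd_of_sq_dvd_intCast_mul_sq ha' ?_, hu₁, hu₂, h0⟩
    have : (a : ℤ_[p]) * t ^ 2 = d₃ * u₃ ^ 2 - d₂ * u₂ ^ 2 := by linear_combination k₁
    rw [this]
    exact dvd_sub ((pow_dvd_pow_of_dvd h0 2).mul_left _) ((pow_dvd_pow_of_dvd hu₂ 2).mul_left _)
  have n₁ : PadicInt.toZMod u₁ ≠ 0 := by
    intro h0
    rw [h0] at m₂
    simp [z₃, n₃] at m₂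
  have n₂ : PadicInt.toZMod u₂ ≠ 0 := by
    intro h0
    rw [h0] at m₁
    simp [z₃, n₃] at m₁
  generalize PadicInt.toZMod u₁ = v₁ at *
  generalize PadicInt.toZMod u₂ = v₂ at *
  generalize PadicInt.toZMod u₃ = v₃ at *
  obtain ⟨r, hr⟩ := hd
  have hr' := congrArg (Int.cast (R := ZMod p)) hr
  push_cast at hr'
  have f₂ : (d₂ : ZMod p) * v₂ ^ 2 = d₃ * v₃ ^ 2 := by linear_combination m₁
  have f₁ : (d₁ : ZMod p) * v₁ ^ 2 = d₃ * v₃ ^ 2 := by linear_combination -m₂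
  constructor
  -- Since `d₂d₃ = (d₃v₃/v₂)²` and `d₁d₂d₃ = r²`, the quotient `d₁` is a square.
  · refine ⟨r * v₂ / (d₃ * v₃), ?_⟩
    field_simp
    linear_combination v₂ ^ 2 * hr' - d₁ * d₃ * f₂
  · refine ⟨r * v₁ / (d₃ * v₃), ?_⟩
    field_simp
    linear_combination v₁ ^ 2 * hr' - d₂ * d₃ * f₁

end Padic

/-! ### Selmer classes represented by integers -/

theorem intCast_rat_ne_zero {d : ℤ} (hd : d ≠ 0) : (d : ℚ) ≠ 0 := Int.cast_ne_zero.2 hd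

theorem sq_intCast_eq_one_iff {x : ℤ} (hx : x ≠ 0) : sq (x : ℚ) = 1 ↔ IsSquare x := by
  rw [sq_eq_one_iff (intCast_rat_ne_zero hx), ← Rat.isSquare_intCast_iff]
  constructor
  · rintro ⟨c, -, hc⟩
    exact ⟨c, by rw [hc]; ring⟩
  · rintro ⟨c, hc⟩
    refine ⟨c, ?_, by rw [hc]; ring⟩
    rintro rfl
    exact intCast_rat_ne_zero hx (by rw [hc]; ring)

theorem sq_intCast_eq_iff {x y : ℤ} (hx : x ≠ 0) (hy : y ≠ 0) :
    sq (x : ℚ) = sq (y : ℚ) ↔ IsSquare (x * y) := by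
  rw [← sq_intCast_eq_one_iff (mul_ne_zero hx hy), Int.cast_mul,
    sq_mul (intCast_rat_ne_zero hx) (intCast_rat_ne_zero hy), mul_eq_one_iff_eq_inv, sqClass_inv]

theorem classOf_mul {d₁ d₂ d₃ d₁' d₂' d₃' : ℤ} (h₁ : d₁ ≠ 0) (h₂ : d₂ ≠ 0) (h₃ : d₃ ≠ 0)
    (h₁' : d₁' ≠ 0) (h₂' : d₂' ≠ 0) (h₃' : d₃' ≠ 0) :
    classOf (d₁ * d₁') (d₂ * d₂') (d₃ * d₃') = classOf d₁ d₂ d₃ * classOf d₁' d₂' d₃' := by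
  simp only [classOf, Int.cast_mul, Prod.mk_mul_mk]
  rw [sq_mul (intCast_rat_ne_zero h₁) (intCast_rat_ne_zero h₁'),
    sq_mul (intCast_rat_ne_zero h₂) (intCast_rat_ne_zero h₂'),
    sq_mul (intCast_rat_ne_zero h₃) (intCast_rat_ne_zero h₃')]

theorem classOf_eq_iff {d₁ d₂ d₃ d₁' d₂' d₃' : ℤ} (h₁ : d₁ ≠ 0) (h₂ : d₂ ≠ 0) (h₃ : d₃ ≠ 0)
    (h₁' : d₁' ≠ 0) (h₂' : d₂' ≠ 0) (h₃' : d₃' ≠ 0) :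
    classOf d₁ d₂ d₃ = classOf d₁' d₂' d₃' ↔
      IsSquare (d₁ * d₁') ∧ IsSquare (d₂ * d₂') ∧ IsSquare (d₃ * d₃') := by
  simp only [classOf, Prod.mk.injEq, sq_intCast_eq_iff h₁ h₁', sq_intCast_eq_iff h₂ h₂',
    sq_intCast_eq_iff h₃ h₃']

theorem classOf_one : classOf 1 1 1 = 1 := by
  have : sq ((1 : ℤ) : ℚ) = 1 := (sq_intCast_eq_one_iff one_ne_zero).2 ⟨1, rfl⟩
  simp only [classOf, this]
  rfl

theorem sq_class_triple_mul_self (L : SqClass ℚ × SqClass ℚ × SqClass ℚ) : L * L = 1 := by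
  ext <;> exact sqClass_mul_self _

theorem Coeffs.Solvable.congr {e : Coeffs} {K : Type} [Field K] [CharZero K]
    {d₁ d₂ d₃ d₁' d₂' d₃' : ℚ} (h₁ : d₁ ≠ 0) (h₂ : d₂ ≠ 0) (h₃ : d₃ ≠ 0) (h₁' : d₁' ≠ 0)
    (h₂' : d₂' ≠ 0) (h₃' : d₃' ≠ 0) (s₁ : sq d₁ = sq d₁') (s₂ : sq d₂ = sq d₂')
    (s₃ : sq d₃ = sq d₃') (h : e.Solvable K d₁ d₂ d₃) : e.Solvable K d₁' d₂' d₃' := by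
  have c : ∀ d : ℚ, d ≠ 0 → (d : K) ≠ 0 := fun d hd => by exact_mod_cast hd
  have s : ∀ d d' : ℚ, d ≠ 0 → d' ≠ 0 → sq d = sq d' → sq (d : K) = sq (d' : K) := by
    intro d d' hd hd' h
    obtain ⟨r, hr, rfl⟩ := (sq_eq_iff hd hd').1 h
    exact (sq_eq_iff (c _ hd) (c _ hd')).2 ⟨r, c _ hr, by push_cast; rfl⟩
  exact HasPoint.of_rep (c _ h₁) (c _ h₂) (c _ h₃) (c _ h₁') (c _ h₂') (c _ h₃')
    (s _ _ h₁ h₁' s₁) (s _ _ h₂ h₂' s₂) (s _ _ h₃ h₃' s₃) h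

/-- The definition of `Coeffs.Sel` asks for some soluble representatives; solvability depends only
on square classes, so any nonzero integers will do. -/
theorem classOf_mem_sel_iff {e : Coeffs} {d₁ d₂ d₃ : ℤ} (h₁ : d₁ ≠ 0) (h₂ : d₂ ≠ 0)
    (h₃ : d₃ ≠ 0) :
    classOf d₁ d₂ d₃ ∈ e.Sel ↔ IsSquare (d₁ * d₂ * d₃) ∧ e.EverywhereSolvable d₁ d₂ d₃ := by
  have hprod : sq (d₁ : ℚ) * sq (d₂ : ℚ) * sq (d₃ : ℚ) = 1 ↔ IsSquare (d₁ * d₂ * d₃) := by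
    rw [← sq_mul (intCast_rat_ne_zero h₁) (intCast_rat_ne_zero h₂), ← Int.cast_mul,
      ← sq_mul (intCast_rat_ne_zero (mul_ne_zero h₁ h₂)) (intCast_rat_ne_zero h₃), ← Int.cast_mul,
      sq_intCast_eq_one_iff (mul_ne_zero (mul_ne_zero h₁ h₂) h₃)]
  constructor
  · rintro ⟨hL, f₁, f₂, f₃, hf, hr, hp⟩
    simp only [classOf, Prod.mk.injEq] at hf
    refine ⟨hprod.1 hL, hr.congr ?_ ?_ ?_ ?_ ?_ ?_ hf.1.symm hf.2.1.symm hf.2.2.symm, fun p _ =>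
      (hp p).congr ?_ ?_ ?_ ?_ ?_ ?_ hf.1.symm hf.2.1.symm hf.2.2.symm⟩
    all_goals first | exact Units.ne_zero _ | exact intCast_rat_ne_zero ‹_›
  · rintro ⟨hsq, h⟩
    exact ⟨hprod.2 hsq, Units.mk0 _ (intCast_rat_ne_zero h₁), Units.mk0 _ (intCast_rat_ne_zero h₂),
      Units.mk0 _ (intCast_rat_ne_zero h₃), rfl, h⟩

theorem Coeffs.everywhereSolvable_iff {e : Coeffs} {d₁ d₂ d₃ : ℚ} :
    e.EverywhereSolvable d₁ d₂ d₃ ↔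
      e.SolvableAwayTwo d₁ d₂ d₃ ∧ e.Solvable ℚ_[2] d₁ d₂ d₃ := by
  constructor
  · exact fun h => ⟨⟨h.1, fun q _ _ => h.2 q⟩, h.2 2⟩
  · rintro ⟨h, h2⟩
    refine ⟨h.1, fun q hq => ?_⟩
    by_cases hq2 : q = 2
    · subst hq2
      exact h2
    · exact h.2 q hq2

/-- The class of the torsion point `(0, 0)`. -/
noncomputable def Coeffs.classT (e : Coeffs) : SqClass ℚ × SqClass ℚ × SqClass ℚ :=
  classOf e.e₂ (-e.e₁) (-(e.e₁ * e.e₂))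

/-- The class of the torsion point `(e₁, 0)`. -/
noncomputable def Coeffs.classS (e : Coeffs) : SqClass ℚ × SqClass ℚ × SqClass ℚ :=
  classOf (-e.e₃) (-(e.e₁ * e.e₃)) e.e₁

/-- This product is the class of the torsion point `(-e₂, 0)`. -/
theorem Coeffs.classT_mul_classS (e : Coeffs) :
    e.classT * e.classS = classOf (-(e.e₂ * e.e₃)) e.e₃ (-e.e₂) := by
  have n := e.ne₁
  have n₂ := e.ne₂
  have n₃ := e.ne₃
  rw [classT, classS, ← classOf_mul, classOf_eq_iff]
  · exact ⟨⟨e.e₂ * e.e₃, by ring⟩, ⟨e.e₁ * e.e₃, by ring⟩, ⟨e.e₁ * e.e₂, by ring⟩⟩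
  all_goals simp [n, n₂, n₃]

theorem emod_four_of_odd_of_isSquare {x : ℤ} (h : Odd x) (hs : IsSquare x) : x % 4 = 1 := by
  obtain ⟨c, rfl⟩ := hs
  have := Int.sq_mod_four_eq_one_of_odd (Int.odd_mul.1 h).1
  rwa [pow_two] at this

theorem not_isSquare_of_two_dvd {x : ℤ} (h2 : (2 : ℤ) ∣ x) (h4 : ¬ (4 : ℤ) ∣ x) :
    ¬ IsSquare x := by
  rintro ⟨c, rfl⟩
  obtain ⟨d, rfl⟩ : (2 : ℤ) ∣ c := by
    rcases Int.prime_two.dvd_or_dvd h2 with h | h <;> exact h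
  exact h4 ⟨d * d, by ring⟩

theorem not_four_dvd_mul {x y : ℤ} (hx : Odd x) (hy : ¬ (4 : ℤ) ∣ y) : ¬ (4 : ℤ) ∣ x * y := by
  intro h
  have hc : IsCoprime ((2 : ℤ) ^ 2) x := (Int.isCoprime_two_left.2 hx).pow_left
  exact hy (hc.dvd_of_dvd_mul_left h)

/-- The first entries have `2`-adic valuations of different parity. This separates `S` and `TS` from
all classes with odd first entry. -/
theorem classOf_ne_of_two_dvd {x d₁ d₂ d₃ f₂ f₃ : ℤ} (hx : (2 : ℤ) ∣ x) (hx' : ¬ (4 : ℤ) ∣ x)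
    (hd : Odd d₁) : classOf x f₂ f₃ ≠ classOf d₁ d₂ d₃ := by
  intro h
  have h1 : sq (x : ℚ) = sq (d₁ : ℚ) := congrArg Prod.fst h
  have x0 : x ≠ 0 := by rintro rfl; exact hx' (dvd_zero _)
  have d0 : d₁ ≠ 0 := by rintro rfl; simp at hd
  rw [sq_intCast_eq_iff x0 d0, mul_comm] at h1
  exact not_isSquare_of_two_dvd (hx.mul_left _) (not_four_dvd_mul hd hx') h1

namespace Coeffs.OddAtTwo
variable {e : Coeffs} (he : e.OddAtTwo)
include he

/-- If `e₂` and `-e₁` were squares, both would be `1` modulo `4`, and `4` would divide `e₁ + e₂ =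
-e₃`. -/
theorem classT_ne_one : e.classT ≠ 1 := by
  intro h
  rw [Coeffs.classT, ← classOf_one, classOf_eq_iff e.ne₂ (neg_ne_zero.2 e.ne₁)
    (neg_ne_zero.2 (mul_ne_zero e.ne₁ e.ne₂)) one_ne_zero one_ne_zero one_ne_zero] at h
  simp only [mul_one] at h
  have h1 := emod_four_of_odd_of_isSquare he.2.1 h.1
  have h2 := emod_four_of_odd_of_isSquare he.1.neg h.2.1
  have := e.sum_eq
  have := he.2.2.2
  omega

theorem classS_ne {d₁ d₂ d₃ : ℤ} (hd : Odd d₁) : e.classS ≠ classOf d₁ d₂ d₃ :=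
  classOf_ne_of_two_dvd (by simpa using he.2.2.1) (by simpa using he.2.2.2) hd

theorem classT_mul_classS_ne {d₁ d₂ d₃ : ℤ} (hd : Odd d₁) :
    e.classT * e.classS ≠ classOf d₁ d₂ d₃ := by
  rw [Coeffs.classT_mul_classS]
  exact classOf_ne_of_two_dvd (by simpa using he.2.2.1.mul_left _)
    (by simpa using not_four_dvd_mul he.2.1 he.2.2.2) hd

end Coeffs.OddAtTwo

/-! ### The image of the torsion points -/

section Torsion

theorem Coeffs.add_ne_zero (e : Coeffs) : (e.e₁ : ℚ) + e.e₂ ≠ 0 := by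
  intro h
  have h' : e.e₁ + e.e₂ = 0 := by exact_mod_cast h
  have := e.sum_eq
  exact e.ne₃ (by omega)

theorem Coeffs.descentFun_origin (e : Coeffs) (h : (curve (e.e₁ : ℚ) e.e₂).Nonsingular 0 0) :
    descentFun (e.e₁ : ℚ) e.e₂ (.some 0 0 h) = e.classT := by
  have n₁ := intCast_rat_ne_zero e.ne₁
  have n₂ := intCast_rat_ne_zero e.ne₂
  simp only [descentFun, comp, Coeffs.classT, classOf, if_neg (neg_ne_zero.2 n₂).symm,
    if_neg n₁.symm, if_true]
  push_cast
  refine Prod.ext (congrArg sq ?_) (Prod.ext (congrArg sq ?_) (congrArg sq ?_)) <;>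
    ring

theorem Coeffs.descentFun_root (e : Coeffs)
    (h : (curve (e.e₁ : ℚ) e.e₂).Nonsingular (e.e₁ : ℚ) 0) :
    descentFun (e.e₁ : ℚ) e.e₂ (.some (e.e₁ : ℚ) 0 h) = e.classS := by
  have n₁ := intCast_rat_ne_zero e.ne₁
  have hs : (e.e₃ : ℚ) = -e.e₁ - e.e₂ := by
    have : (e.e₁ : ℚ) + e.e₂ + e.e₃ = 0 := by exact_mod_cast e.sum_eq
    linear_combination this
  have n : (e.e₁ : ℚ) ≠ -e.e₂ := fun h => e.add_ne_zero (by linear_combination h)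
  simp only [descentFun, comp, Coeffs.classS, classOf, if_neg n, if_neg n₁, if_true]
  push_cast
  rw [hs]
  refine Prod.ext (congrArg sq ?_) (Prod.ext (congrArg sq ?_) (congrArg sq ?_)) <;>
    ring

theorem Coeffs.descentFun_root' (e : Coeffs)
    (h : (curve (e.e₁ : ℚ) e.e₂).Nonsingular (-e.e₂ : ℚ) 0) :
    descentFun (e.e₁ : ℚ) e.e₂ (.some (-e.e₂ : ℚ) 0 h) = e.classT * e.classS := by
  have n₁ := intCast_rat_ne_zero e.ne₂
  have hs : (e.e₃ : ℚ) = -e.e₁ - e.e₂ := by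
    have : (e.e₁ : ℚ) + e.e₂ + e.e₃ = 0 := by exact_mod_cast e.sum_eq
    linear_combination this
  have n : -(e.e₂ : ℚ) ≠ e.e₁ := fun h => e.add_ne_zero (by linear_combination -h)
  rw [Coeffs.classT_mul_classS]
  simp only [descentFun, comp, classOf, if_neg n, if_neg (neg_ne_zero.2 n₁), if_true]
  push_cast
  rw [hs]
  refine Prod.ext (congrArg sq ?_) (Prod.ext (congrArg sq ?_) (congrArg sq ?_)) <;>
    ring

theorem Coeffs.nonsingular_root (e : Coeffs) {r : ℚ} (hr : r * (r - e.e₁) * (r + e.e₂) = 0) :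
    (curve (e.e₁ : ℚ) e.e₂).Nonsingular r 0 :=
  curve_nonsingular (intCast_rat_ne_zero e.ne₁) (intCast_rat_ne_zero e.ne₂) e.add_ne_zero
    (by rw [hr]; ring)

theorem Coeffs.some_add_self (e : Coeffs) {r : ℚ}
    (h : (curve (e.e₁ : ℚ) e.e₂).Nonsingular r 0) :
    WeierstrassCurve.Affine.Point.some r 0 h + .some r 0 h = 0 :=
  WeierstrassCurve.Affine.Point.add_self_of_Y_eq (by rw [curve_negY, neg_zero])

theorem Coeffs.descentFun_of_add_self_eq_zero (e : Coeffs) {P : e.Points} (hP : P + P = 0) :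
    P = 0 ∨ descentFun (e.e₁ : ℚ) e.e₂ P = e.classT ∨ descentFun (e.e₁ : ℚ) e.e₂ P = e.classS ∨
      descentFun (e.e₁ : ℚ) e.e₂ P = e.classT * e.classS := by
  rcases P with _ | ⟨x, y, h⟩
  · exact Or.inl rfl
  right
  have hy : y = 0 := by
    by_contra hy
    have hne : y ≠ (curve (e.e₁ : ℚ) e.e₂).negY x y := by
      rw [curve_negY]
      intro h0
      exact hy (by linear_combination h0 / 2)
    rw [WeierstrassCurve.Affine.Point.add_self_of_Y_ne hne] at hP
    exact WeierstrassCurve.Affine.Point.some_ne_zero _ hP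
  subst hy
  have hE := (curve_equation _ _ _ _).1 h.1
  have hE' : x * (x - e.e₁) * (x + e.e₂) = 0 := by rw [← hE]; ring
  rcases mul_eq_zero.1 hE' with hE' | hx
  · rcases mul_eq_zero.1 hE' with hx | hx
    · subst hx
      exact Or.inl (e.descentFun_origin h)
    · obtain rfl := sub_eq_zero.1 hx
      exact Or.inr (Or.inl (e.descentFun_root h))
  · obtain rfl : x = -e.e₂ := by linear_combination hx
    exact Or.inr (Or.inr (e.descentFun_root' h))

theorem Coeffs.descentFun_add (e : Coeffs) (P Q : e.Points) :
    descentFun (e.e₁ : ℚ) e.e₂ (P + Q)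
      = descentFun (e.e₁ : ℚ) e.e₂ P * descentFun (e.e₁ : ℚ) e.e₂ Q :=
  TwoDescent.descentFun_add (intCast_rat_ne_zero e.ne₁) (intCast_rat_ne_zero e.ne₂)
    e.add_ne_zero P Q

theorem Coeffs.classT_mem (e : Coeffs) : e.classT ∈ e.Sel := by
  rw [← e.descentFun_origin (e.nonsingular_root (r := 0) (by ring))]
  exact e.descentFun_mem _

theorem Coeffs.classS_mem (e : Coeffs) : e.classS ∈ e.Sel := by
  rw [← e.descentFun_root (e.nonsingular_root (r := e.e₁) (by ring))]
  exact e.descentFun_mem _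

namespace Coeffs.OddAtTwo
variable {e : Coeffs} (he : e.OddAtTwo)
include he

/-- There is no rational point of order `4`: a double has trivial descent class, whereas the three
points of order `2` have nontrivial classes. -/
theorem add_self_eq_zero {P : e.Points} (hP : (P + P) + (P + P) = 0) : P + P = 0 := by
  have h1 : descentFun (e.e₁ : ℚ) e.e₂ (P + P) = 1 := by
    rw [e.descentFun_add, sq_class_triple_mul_self]
  rcases e.descentFun_of_add_self_eq_zero hP with h | h | h | h
  · exact h
  · exact absurd (h.symm.trans h1) he.classT_ne_one
  · exact absurd (h.symm.trans (h1.trans classOf_one.symm)) (he.classS_ne odd_one)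
  · exact absurd (h.symm.trans (h1.trans classOf_one.symm)) (he.classT_mul_classS_ne odd_one)

theorem two_nsmul_eq_zero (k : ℕ) {P : e.Points} (hP : 2 ^ k • P = 0) : P + P = 0 := by
  induction k generalizing P with
  | zero =>
    rw [pow_zero, one_nsmul] at hP
    rw [hP, add_zero]
  | succ k ih =>
    refine he.add_self_eq_zero (ih ?_)
    rw [pow_succ, mul_nsmul', two_nsmul] at hP
    exact hP

/-- The image of the torsion points under descent. -/
theorem descentFun_of_isOfFinAddOrder {P : e.Points} (hP : IsOfFinAddOrder P) :
    descentFun (e.e₁ : ℚ) e.e₂ P = 1 ∨ descentFun (e.e₁ : ℚ) e.e₂ P = e.classT ∨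
      descentFun (e.e₁ : ℚ) e.e₂ P = e.classS ∨
      descentFun (e.e₁ : ℚ) e.e₂ P = e.classT * e.classS := by
  obtain ⟨N, hN, h0⟩ := isOfFinAddOrder_iff_nsmul_eq_zero.1 hP
  obtain ⟨k, m, hm, rfl⟩ := Nat.exists_eq_two_pow_mul_odd hN.ne'
  rw [mul_nsmul'] at h0
  have h2 := he.two_nsmul_eq_zero k h0
  -- An odd multiple differs from the point by a double, which descent does not see.
  have hPm : descentFun (e.e₁ : ℚ) e.e₂ (m • P) = descentFun (e.e₁ : ℚ) e.e₂ P := by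
    obtain ⟨l, rfl⟩ := hm
    rw [add_nsmul, one_nsmul, mul_comm, mul_nsmul, two_nsmul, e.descentFun_add, e.descentFun_add,
      sq_class_triple_mul_self, one_mul]
  rw [← hPm]
  rcases e.descentFun_of_add_self_eq_zero h2 with h | h
  · left; rw [h]; rfl
  · exact Or.inr h

/-- The four classes are realised by the zero point and the three points of order `2`. This makes
the quotient defining the pure Selmer group explicit, for `E` and equally for its odd twists. -/
theorem mem_torsion_iff {L : e.Sel} :
    L ∈ (CommGroup.torsion (Multiplicative e.Points)).map e.descent ↔
      (L : SqClass ℚ × SqClass ℚ × SqClass ℚ) = 1 ∨ L.1 = e.classT ∨ L.1 = e.classS ∨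
        L.1 = e.classT * e.classS := by
  have tw : ∀ {r : ℚ} (h : (curve (e.e₁ : ℚ) e.e₂).Nonsingular r 0),
      Multiplicative.ofAdd (WeierstrassCurve.Affine.Point.some r 0 h) ∈
      CommGroup.torsion (Multiplicative e.Points) := fun h => by
    refine isOfFinOrder_iff_pow_eq_one.2 ⟨2, two_pos, ?_⟩
    rw [← ofAdd_nsmul, two_nsmul, e.some_add_self]
    rfl
  constructor
  · rintro ⟨P, hP, rfl⟩
    have hP' : IsOfFinAddOrder P.toAdd := by
      obtain ⟨N, hN, h0⟩ := isOfFinOrder_iff_pow_eq_one.1 hP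
      exact isOfFinAddOrder_iff_nsmul_eq_zero.2 ⟨N, hN, h0⟩
    exact he.descentFun_of_isOfFinAddOrder hP'
  · rintro (h | h | h | h)
    · have : L = 1 := Subtype.ext h
      rw [this]
      exact one_mem _
    · exact ⟨_, tw (e.nonsingular_root (r := 0) (by ring)),
        Subtype.ext ((e.descentFun_origin (e.nonsingular_root (by ring))).trans h.symm)⟩
    · exact ⟨_, tw (e.nonsingular_root (r := e.e₁) (by ring)),
        Subtype.ext ((e.descentFun_root (e.nonsingular_root (by ring))).trans h.symm)⟩
    · exact ⟨_, tw (e.nonsingular_root (r := -e.e₂) (by ring)),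
        Subtype.ext ((e.descentFun_root' (e.nonsingular_root (by ring))).trans h.symm)⟩

/-- If `Sel₂(E) ≅ (ℤ/2)²`, it is the image of the torsion points. -/
theorem sel_eq (hSel : Nonempty (e.Sel ≃* Multiplicative (ZMod 2 × ZMod 2)))
    {L : SqClass ℚ × SqClass ℚ × SqClass ℚ} (hL : L ∈ e.Sel) :
    L = 1 ∨ L = e.classT ∨ L = e.classS ∨ L = e.classT * e.classS := by
  obtain ⟨ψ⟩ := hSel
  have hcard : Set.ncard (e.Sel : Set (SqClass ℚ × SqClass ℚ × SqClass ℚ)) = 4 := by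
    have h1 : Nat.card e.Sel = 4 := by
      rw [Nat.card_congr ψ.toEquiv, Nat.card_congr Multiplicative.toAdd, Nat.card_prod, Nat.card_zmod]
    exact h1
  have hfin : (e.Sel : Set (SqClass ℚ × SqClass ℚ × SqClass ℚ)).Finite :=
    Set.finite_of_ncard_ne_zero (by rw [hcard]; norm_num)
  have n₁ := he.classT_ne_one
  have n₂ : e.classS ≠ 1 := classOf_one ▸ he.classS_ne odd_one
  have n₃ : e.classT * e.classS ≠ 1 := classOf_one ▸ he.classT_mul_classS_ne odd_one
  have n₄ : e.classT ≠ e.classS := (he.classS_ne he.2.1).symm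
  have hsub : ({1, e.classT, e.classS, e.classT * e.classS} : Set _) ⊆ (e.Sel : Set _) := by
    rintro x (rfl | rfl | rfl | rfl)
    · exact one_mem _
    · exact e.classT_mem
    · exact e.classS_mem
    · exact mul_mem e.classT_mem e.classS_mem
  have h4 : Set.ncard ({1, e.classT, e.classS, e.classT * e.classS} : Set _) = 4 := by
    rw [Set.ncard_insert_of_notMem, Set.ncard_insert_of_notMem, Set.ncard_pair]
    · simpa using n₁
    · simp [n₄, n₂]
    · simp [n₁.symm, n₂.symm, n₃.symm]
  have := Set.eq_of_subset_of_ncard_le hsub (by rw [hcard, h4]) hfin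
  have hL' : L ∈ ({1, e.classT, e.classS, e.classT * e.classS} : Set _) := by
    rw [this]; exact hL
  simpa using hL'

end Coeffs.OddAtTwo
end Torsion

/-! ### Legendre and Hilbert symbols -/

theorem addJacobi_one (m : ℕ) : addJacobi 1 m = 0 := by
  simp [addJacobi]

section Jacobi
variable {p : ℕ} [Fact p.Prime]

theorem addJacobi_eq_zero_iff {u : ℤ} (hu : ¬ (p : ℤ) ∣ u) :
    addJacobi u p = 0 ↔ IsSquare (u : ZMod p) := by
  have h : jacobiSym u p = 1 ↔ IsSquare (u : ZMod p) := by
    rw [← jacobiSym.legendreSym.to_jacobiSym]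
    exact legendreSym.eq_one_iff p (toZMod_intCast_ne_zero hu)
  rw [addJacobi, ← h]
  split_ifs with h1 <;> simp [h1]

theorem addJacobi_mul {u v : ℤ} (hu : ¬ (p : ℤ) ∣ u) (hv : ¬ (p : ℤ) ∣ v) :
    addJacobi (u * v) p = addJacobi u p + addJacobi v p := by
  have h : ∀ u : ℤ, ¬ (p : ℤ) ∣ u → jacobiSym u p = 1 ∨ jacobiSym u p = -1 := fun u hu => by
    rw [← jacobiSym.legendreSym.to_jacobiSym]
    exact legendreSym.eq_one_or_neg_one p (toZMod_intCast_ne_zero hu)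
  unfold addJacobi
  rw [jacobiSym.mul_left]
  rcases h u hu with h1 | h1 <;> rcases h v hv with h2 | h2 <;> rw [h1, h2] <;> norm_num
  decide

theorem not_dvd_prod {ι : Type*} (s : Finset ι) (f : ι → ℤ) (hf : ∀ j ∈ s, ¬ (p : ℤ) ∣ f j) :
    ¬ (p : ℤ) ∣ ∏ j ∈ s, f j := by
  rw [Prime.dvd_finsetProd_iff (Nat.prime_iff_prime_int.1 Fact.out)]
  rintro ⟨j, hj, h⟩
  exact hf j hj h

theorem addJacobi_prod {ι : Type*} (s : Finset ι) (f : ι → ℤ) (hf : ∀ j ∈ s, ¬ (p : ℤ) ∣ f j) :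
    addJacobi (∏ j ∈ s, f j) p = ∑ j ∈ s, addJacobi (f j) p := by
  classical
  induction s using Finset.induction_on with
  | empty => simp [addJacobi_one]
  | insert a s ha ih =>
    have hs : ∀ j ∈ s, ¬ (p : ℤ) ∣ f j := fun j hj => hf j (Finset.mem_insert_of_mem hj)
    rw [Finset.prod_insert ha, Finset.sum_insert ha,
      addJacobi_mul (hf a (Finset.mem_insert_self _ _)) (not_dvd_prod s f hs), ih hs]

theorem addHilbert_eq_zero_iff {K : Type} [Field K] {α β : K} :
    addHilbert α β = 0 ↔ ConicSolvable α β := by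
  rw [addHilbert]
  split_ifs with h
  · exact ⟨fun _ => h, fun _ => rfl⟩
  · exact ⟨fun h' => absurd h' one_ne_zero, fun h' => absurd h' h⟩

theorem zmod_two_ext {x y : ZMod 2} (h : x = 0 ↔ y = 0) : x = y := by
  revert x y; decide

theorem not_sq_dvd_prime_mul {m : ℤ} (hm : ¬ (p : ℤ) ∣ m) : ¬ (p : ℤ) ^ 2 ∣ p * m := by
  rw [pow_two]
  intro h
  exact hm (Int.dvd_of_mul_dvd_mul_left (Int.natCast_ne_zero.2 (Fact.out : p.Prime).ne_zero) h)

/-- A unit that is a square modulo `p` is a `p`-adic square, and the conic is then soluble;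
conversely a primitive point, reduced modulo `p`, exhibits `u` as a square. -/
theorem addHilbert_unit (hp : p ≠ 2) {u m : ℤ} (hu : ¬ (p : ℤ) ∣ u) (hm : ¬ (p : ℤ) ∣ m) :
    addHilbert (u : ℚ_[p]) ((p * m : ℤ) : ℚ_[p]) = addJacobi u p := by
  refine zmod_two_ext ?_
  rw [addJacobi_eq_zero_iff hu, addHilbert_eq_zero_iff]
  constructor
  · exact isSquare_zmod_of_conic (dvd_mul_right _ _) (not_sq_dvd_prime_mul hm)
  · intro h
    obtain ⟨r, hr⟩ := isSquare_int_of_residue hp hu h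
    rw [hr, ← pow_two]
    exact conicSolvable_of_sq

/-- As `-p` pairs trivially with `p`, the symbol equals that of `p` and `m`. -/
theorem addHilbert_prime (hp : p ≠ 2) {m : ℤ} (hm : ¬ (p : ℤ) ∣ m) :
    addHilbert (p : ℚ_[p]) ((-(p * m) : ℤ) : ℚ_[p]) = addJacobi m p := by
  refine zmod_two_ext ?_
  have hp0 : (p : ℚ_[p]) ≠ 0 := Nat.cast_ne_zero.2 (Fact.out : p.Prime).ne_zero
  rw [addJacobi_eq_zero_iff hm, addHilbert_eq_zero_iff]
  constructor
  · rintro ⟨x, y, z, h0, h⟩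
    -- Multiplying `z² = p x² - p m y²` by `p` gives `(p x)² = m (p y)² + p z²`.
    refine isSquare_zmod_of_conic (b := (p : ℤ)) dvd_rfl ?_ ⟨p * y, z, p * x, ?_, ?_⟩
    · simpa using not_sq_dvd_prime_mul (p := p) (m := 1) (by
        intro h1
        exact (Nat.prime_iff_prime_int.1 Fact.out).not_isUnit (isUnit_of_dvd_one h1))
    · simp only [mul_eq_zero, hp0, false_or]
      tauto
    · push_cast at h ⊢
      linear_combination -p * h
  · intro h
    obtain ⟨r, hr⟩ := isSquare_int_of_residue hp hm h
    refine ⟨r, 1, 0, by simp, ?_⟩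
    push_cast
    rw [hr]
    ring

end Jacobi

/-! ### Translation by soluble classes -/

theorem isSquare_of_mul_sq {w r : ℤ} (hr : r ≠ 0) (h : IsSquare (w * r ^ 2)) : IsSquare w := by
  rw [← Rat.isSquare_intCast_iff] at h ⊢
  obtain ⟨c, hc⟩ := h
  have hr' := intCast_rat_ne_zero hr
  refine ⟨c / r, ?_⟩
  push_cast at hc
  field_simp
  linear_combination hc

theorem sq_intCast_eq_of_mul_sq {x y r s : ℤ} (hx : x ≠ 0) (hy : y ≠ 0) (hr : r ≠ 0)
    (h : x * r ^ 2 = y * s ^ 2) : sq (x : ℚ) = sq (y : ℚ) := by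
  rw [sq_intCast_eq_iff hx hy]
  refine isSquare_of_mul_sq hr ⟨y * s, ?_⟩
  linear_combination y * h

/-- Soluble triples are closed under multiplication, and multiplying by `t` twice changes entries
only by squares. -/
theorem Coeffs.solvable_mul_iff {e : Coeffs} {K : Type} [Field K] [CharZero K]
    {d₁ d₂ d₃ t₁ t₂ t₃ : ℤ} (h₁ : d₁ ≠ 0) (h₂ : d₂ ≠ 0) (h₃ : d₃ ≠ 0) (h₁' : t₁ ≠ 0) (h₂' : t₂ ≠ 0)
    (h₃' : t₃ ≠ 0) (hd : IsSquare (d₁ * d₂ * d₃)) (ht : IsSquare (t₁ * t₂ * t₃))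
    (hs : e.Solvable K t₁ t₂ t₃) :
    e.Solvable K d₁ d₂ d₃ ↔ e.Solvable K (d₁ * t₁ : ℤ) (d₂ * t₂ : ℤ) (d₃ * t₃ : ℤ) := by
  have key : ∀ {f₁ f₂ f₃ : ℤ}, f₁ ≠ 0 → f₂ ≠ 0 → f₃ ≠ 0 → IsSquare (f₁ * f₂ * f₃) →
      e.Solvable K f₁ f₂ f₃ → e.Solvable K (f₁ * t₁ : ℤ) (f₂ * t₂ : ℤ) (f₃ * t₃ : ℤ) := by
    intro f₁ f₂ f₃ n₁ n₂ n₃ hf h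
    push_cast
    exact h.mul (intCast_rat_ne_zero n₁) (intCast_rat_ne_zero n₂) (intCast_rat_ne_zero n₃)
      (intCast_rat_ne_zero h₁') (intCast_rat_ne_zero h₂') (intCast_rat_ne_zero h₃')
      (by exact_mod_cast isSquare_intCast hf) (by exact_mod_cast isSquare_intCast ht) hs
  refine ⟨key h₁ h₂ h₃ hd, fun h => ?_⟩
  have n₁ := mul_ne_zero h₁ h₁'
  have n₂ := mul_ne_zero h₂ h₂'
  have n₃ := mul_ne_zero h₃ h₃'
  have h' := key n₁ n₂ n₃ (by
    obtain ⟨c, hc⟩ := hd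
    obtain ⟨c', hc'⟩ := ht
    exact ⟨c * c', by linear_combination t₁ * t₂ * t₃ * hc + c ^ 2 * hc'⟩) h
  refine h'.congr ?_ ?_ ?_ ?_ ?_ ?_ (sq_intCast_eq_of_mul_sq (r := 1) (s := t₁) ?_ ?_ ?_ (by ring))
    (sq_intCast_eq_of_mul_sq (r := 1) (s := t₂) ?_ ?_ ?_ (by ring))
    (sq_intCast_eq_of_mul_sq (r := 1) (s := t₃) ?_ ?_ ?_ (by ring))
  all_goals simp [h₁, h₂, h₃, h₁', h₂', h₃']

section Local
variable {p : ℕ} [Fact p.Prime]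

theorem isSquare_padic_of_mul {x y z : ℚ_[p]} (hx : x ≠ 0) (hy : y ≠ 0) (sx : IsSquare x)
    (sy : IsSquare y) (h : IsSquare (x * y * z)) : IsSquare z := by
  obtain ⟨a, rfl⟩ := sx
  obtain ⟨b, rfl⟩ := sy
  obtain ⟨c, hc⟩ := h
  have ha := left_ne_zero_of_mul hx
  have hb := left_ne_zero_of_mul hy
  refine ⟨c / (a * b), ?_⟩
  field_simp
  linear_combination hc

/-- Solvability at a prime `p ∥ n`, for a triple that becomes a unit triple `w` after
multiplication by a torsion class `t`. -/
theorem Coeffs.solvable_iff_of_twist {e : Coeffs} (hp : p ≠ 2) (ha : (p : ℤ) ∣ e.e₁)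
    (hb : (p : ℤ) ∣ e.e₂) (ha' : ¬ (p : ℤ) ^ 2 ∣ e.e₁)
    {d₁ d₂ d₃ t₁ t₂ t₃ w₁ w₂ w₃ r₁ r₂ r₃ : ℤ} (h₁ : d₁ ≠ 0) (h₂ : d₂ ≠ 0)
    (h₃ : d₃ ≠ 0) (h₁' : t₁ ≠ 0) (h₂' : t₂ ≠ 0) (h₃' : t₃ ≠ 0) (hd : IsSquare (d₁ * d₂ * d₃))
    (ht : IsSquare (t₁ * t₂ * t₃)) (hs : e.Solvable ℚ_[p] t₁ t₂ t₃)
    (hw₁ : ¬ (p : ℤ) ∣ w₁) (hw₂ : ¬ (p : ℤ) ∣ w₂) (hw₃ : ¬ (p : ℤ) ∣ w₃)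
    (k₁ : d₁ * t₁ = w₁ * r₁ ^ 2) (k₂ : d₂ * t₂ = w₂ * r₂ ^ 2) (k₃ : d₃ * t₃ = w₃ * r₃ ^ 2) :
    e.Solvable ℚ_[p] d₁ d₂ d₃ ↔ IsSquare (w₁ : ZMod p) ∧ IsSquare (w₂ : ZMod p) := by
  have n : ∀ {w : ℤ}, ¬ (p : ℤ) ∣ w → w ≠ 0 := by
    rintro w hw rfl
    exact hw (dvd_zero _)
  have m₁ := mul_ne_zero h₁ h₁'
  have m₂ := mul_ne_zero h₂ h₂'
  have m₃ := mul_ne_zero h₃ h₃'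
  have hr : r₁ * r₂ * r₃ ≠ 0 := by
    rw [k₁] at m₁
    rw [k₂] at m₂
    rw [k₃] at m₃
    refine mul_ne_zero (mul_ne_zero ?_ ?_) ?_ <;> rintro rfl <;> simp_all
  have hwsq : IsSquare (w₁ * w₂ * w₃) := by
    refine isSquare_of_mul_sq hr ?_
    obtain ⟨c, hc⟩ := hd
    obtain ⟨c', hc'⟩ := ht
    refine ⟨c * c', ?_⟩
    have : w₁ * w₂ * w₃ * (r₁ * r₂ * r₃) ^ 2 = (d₁ * t₁) * (d₂ * t₂) * (d₃ * t₃) := by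
      rw [k₁, k₂, k₃]; ring
    rw [this]
    linear_combination t₁ * t₂ * t₃ * hc + c ^ 2 * hc'
  rw [Coeffs.solvable_mul_iff h₁ h₂ h₃ h₁' h₂' h₃' hd ht hs]
  have s₁ := sq_intCast_eq_of_mul_sq (r := 1) (s := r₁) m₁ (n hw₁) one_ne_zero (by rw [k₁]; ring)
  have s₂ := sq_intCast_eq_of_mul_sq (r := 1) (s := r₂) m₂ (n hw₂) one_ne_zero (by rw [k₂]; ring)
  have s₃ := sq_intCast_eq_of_mul_sq (r := 1) (s := r₃) m₃ (n hw₃) one_ne_zero (by rw [k₃]; ring)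
  constructor
  · intro h
    have h' := h.congr (intCast_rat_ne_zero m₁) (intCast_rat_ne_zero m₂) (intCast_rat_ne_zero m₃)
      (intCast_rat_ne_zero (n hw₁)) (intCast_rat_ne_zero (n hw₂)) (intCast_rat_ne_zero (n hw₃))
      s₁ s₂ s₃
    exact isSquare_of_hasPoint_twist ha hb ha' hw₁ hw₂ hw₃ hwsq (Coeffs.solvable_intCast.1 h')
  · rintro ⟨q₁, q₂⟩
    have l₁ := isSquare_int_of_residue hp hw₁ q₁
    have l₂ := isSquare_int_of_residue hp hw₂ q₂
    have l₃ : IsSquare (w₃ : ℚ_[p]) :=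
      isSquare_padic_of_mul (intCast_padic_ne_zero hw₁) (intCast_padic_ne_zero hw₂) l₁ l₂
        (by exact_mod_cast hwsq.map (Int.castRingHom ℚ_[p]))
    have h' : e.Solvable ℚ_[p] w₁ w₂ w₃ :=
      Coeffs.solvable_intCast.2 (hasPoint_of_isSquare (intCast_padic_ne_zero hw₁)
        (intCast_padic_ne_zero hw₂) (intCast_padic_ne_zero hw₃) l₁ l₂ l₃)
    exact h'.congr (intCast_rat_ne_zero (n hw₁)) (intCast_rat_ne_zero (n hw₂))
      (intCast_rat_ne_zero (n hw₃)) (intCast_rat_ne_zero m₁) (intCast_rat_ne_zero m₂)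
      (intCast_rat_ne_zero m₃) s₁.symm s₂.symm s₃.symm

end Local

/-! ### Divisors of n as vectors over the field with two elements -/

section Divisors
variable {k : ℕ} (p : Fin k → ℕ)

/-- The positive divisor `∏ p_i ^ x_i` of `p_1 ⋯ p_k`. -/
def divisorOf (x : Fin k → ZMod 2) : ℤ := ∏ i, (p i : ℤ) ^ (x i).val

/-- The part of `divisorOf p x` away from `p_i`. -/
def divisorAway (i : Fin k) (x : Fin k → ZMod 2) : ℤ :=
  ∏ j ∈ Finset.univ.erase i, (p j : ℤ) ^ (x j).val

theorem divisorOf_eq (i : Fin k) (x : Fin k → ZMod 2) :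
    divisorOf p x = (p i : ℤ) ^ (x i).val * divisorAway p i x :=
  (Finset.mul_prod_erase _ _ (Finset.mem_univ i)).symm

theorem divisorOf_one : divisorOf p 1 = ((∏ i, p i : ℕ) : ℤ) := by
  simp [divisorOf, ZMod.val_one]

theorem divisorOf_dvd (x : Fin k → ZMod 2) : divisorOf p x ∣ ((∏ i, p i : ℕ) : ℤ) := by
  rw [← divisorOf_one]
  refine Finset.prod_dvd_prod_of_dvd _ _ fun i _ => pow_dvd_pow _ ?_
  have := ZMod.val_lt (x i)
  simp only [Pi.one_apply, ZMod.val_one]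
  omega

variable [∀ i, Fact (p i).Prime]

theorem divisorOf_pos (x : Fin k → ZMod 2) : 0 < divisorOf p x :=
  Finset.prod_pos fun i _ => pow_pos (Int.natCast_pos.2 (Fact.out : (p i).Prime).pos) _

variable {p}

theorem injective_of_squarefree (hsq : Squarefree (∏ i, p i)) : Function.Injective p := by
  intro i j hij
  by_contra hne
  have h1 : p i * p i ∣ ∏ i, p i := by
    rw [← Finset.mul_prod_erase _ _ (Finset.mem_univ i)]
    refine mul_dvd_mul_left _ ?_
    conv_lhs => rw [hij]
    exact Finset.dvd_prod_of_mem p (Finset.mem_erase.2 ⟨Ne.symm hne, Finset.mem_univ j⟩)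
  exact (Fact.out : (p i).Prime).one_lt.ne' (Nat.isUnit_iff.1 (hsq _ h1))

theorem not_dvd_of_ne (hp : Function.Injective p) {i j : Fin k} (h : j ≠ i) :
    ¬ ((p i : ℕ) : ℤ) ∣ (p j : ℤ) := by
  rw [Int.natCast_dvd_natCast, Nat.prime_dvd_prime_iff_eq Fact.out Fact.out]
  exact fun h' => h (hp h').symm

theorem not_dvd_divisorAway (hp : Function.Injective p) (i : Fin k) (x : Fin k → ZMod 2) :
    ¬ ((p i : ℕ) : ℤ) ∣ divisorAway p i x :=
  not_dvd_prod _ _ fun _ hj h => not_dvd_of_ne hp (Finset.ne_of_mem_erase hj)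
    ((Nat.prime_iff_prime_int.1 Fact.out).dvd_of_dvd_pow h)

theorem padicValInt_divisorOf (hp : Function.Injective p) (i : Fin k) (x : Fin k → ZMod 2) :
    padicValInt (p i) (divisorOf p x) = (x i).val := by
  have hpi : (p i : ℤ) ≠ 0 := Int.natCast_ne_zero.2 (Fact.out : (p i).Prime).ne_zero
  have h0 : divisorAway p i x ≠ 0 := by
    intro h
    exact not_dvd_divisorAway hp i x (h ▸ dvd_zero _)
  rw [divisorOf_eq p i, padicValInt.mul (pow_ne_zero _ hpi) h0,
    padicValInt.eq_zero_of_not_dvd (not_dvd_divisorAway hp i x), add_zero, padicValInt,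
    Int.natAbs_pow, Int.natAbs_natCast, padicValNat.prime_pow]

/-- All valuations of a divisor of a squarefree number are `0` or `1`, so reducing them modulo `2`
loses nothing. -/
theorem divisorOf_padicValInt (hsq : Squarefree (∏ i, p i)) {d : ℤ} (hd : 0 < d)
    (h : d ∣ ((∏ i, p i : ℕ) : ℤ)) :
    divisorOf p (fun i => (padicValInt (p i) d : ZMod 2)) = d := by
  have hp := injective_of_squarefree hsq
  lift d to ℕ using hd.le
  rw [Int.natCast_dvd_natCast] at h
  rw [Int.natCast_pos] at hd
  have hsqd := hsq.squarefree_of_dvd h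
  have h1 := divisorOf_pos p (fun i => (padicValInt (p i) (d : ℤ) : ZMod 2))
  obtain ⟨D, hD⟩ := Int.eq_ofNat_of_zero_le h1.le
  have hv : ∀ i, (padicValNat (p i) d) ≤ 1 := fun i =>  by
    rw [← Nat.factorization_def _ Fact.out]
    exact hsqd.natFactorization_le_one _
  rw [hD, Int.natCast_inj]
  refine Nat.eq_of_factorization_eq (by rintro rfl; exact h1.ne' hD) hd.ne' fun q => ?_
  by_cases hq : q.Prime
  swap
  · simp [Nat.factorization_eq_zero_of_not_prime _ hq]
  by_cases hi : ∃ i, p i = q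
  · obtain ⟨i, rfl⟩ := hi
    rw [Nat.factorization_def _ hq, Nat.factorization_def _ hq]
    have h2 := padicValInt_divisorOf hp i (fun i => (padicValInt (p i) (d : ℤ) : ZMod 2))
    rw [hD] at h2
    simp only [padicValInt.of_nat] at h2
    rw [h2, ZMod.val_natCast, Nat.mod_eq_of_lt (by have := hv i; omega)]
  · have hqn : ¬ q ∣ ∏ i, p i := by
      rw [Prime.dvd_finsetProd_iff hq.prime]
      rintro ⟨i, -, h⟩
      exact hi ⟨i, ((Nat.prime_dvd_prime_iff_eq hq Fact.out).1 h).symm⟩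
    have h3 : D ∣ ∏ i, p i := by
      rw [← Int.natCast_dvd_natCast]
      exact hD ▸ divisorOf_dvd p _
    rw [Nat.factorization_eq_zero_of_not_dvd fun h' => hqn (h'.trans h),
      Nat.factorization_eq_zero_of_not_dvd fun h' => hqn (h'.trans h3)]

/-- Adding in `ZMod 2` changes the exponents by even numbers only. -/
theorem sq_divisorOf_add (x y : Fin k → ZMod 2) :
    sq (divisorOf p (x + y) : ℚ) = sq (divisorOf p x : ℚ) * sq (divisorOf p y : ℚ) := by
  have n : ∀ z, divisorOf p z ≠ 0 := fun z => (divisorOf_pos p z).ne'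
  rw [← sq_mul (intCast_rat_ne_zero (n x)) (intCast_rat_ne_zero (n y)), ← Int.cast_mul,
    sq_intCast_eq_iff (n _) (mul_ne_zero (n _) (n _))]
  simp only [divisorOf, ← Finset.prod_mul_distrib]
  refine Finset.isSquare_prod _ fun i _ => ?_
  rw [← pow_add, ← pow_add]
  refine Even.isSquare_pow ?_ _
  simp only [Pi.add_apply]
  generalize x i = a
  generalize y i = b
  revert a b
  decide

theorem isSquare_mul_divisorOf_add (x y : Fin k → ZMod 2) :
    IsSquare (divisorOf p x * divisorOf p y * divisorOf p (x + y)) := by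
  have n : ∀ z, divisorOf p z ≠ 0 := fun z => (divisorOf_pos p z).ne'
  rw [← sq_intCast_eq_iff (mul_ne_zero (n _) (n _)) (n _), sq_divisorOf_add, Int.cast_mul,
    sq_mul (intCast_rat_ne_zero (n x)) (intCast_rat_ne_zero (n y))]

theorem eq_zero_of_isSquare_divisorOf (hp : Function.Injective p) {x : Fin k → ZMod 2}
    (h : IsSquare (divisorOf p x)) : x = 0 := by
  obtain ⟨c, hc⟩ := h
  have hc0 : c ≠ 0 := by
    rintro rfl
    exact (divisorOf_pos p x).ne' hc
  funext i
  have h1 := padicValInt_divisorOf hp i x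
  rw [hc, padicValInt.mul hc0 hc0] at h1
  have h2 := ZMod.val_lt (x i)
  exact (ZMod.val_eq_zero _).1 (by omega)

end Divisors

/-! ### Rows of the matrix and the condition at primes dividing n -/

theorem Coeffs.OddAtTwo.twist {e : Coeffs} (he : e.OddAtTwo) {n : ℕ} (hn : n ≠ 0) (hodd : Odd n) :
    (e.twist n hn).OddAtTwo := by
  have hn' : Odd (n : ℤ) := by exact_mod_cast hodd
  have h := not_four_dvd_mul hn' he.2.2.2
  rw [mul_comm] at h
  exact ⟨he.1.mul hn', he.2.1.mul hn', he.2.2.1.mul_right _, h⟩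

theorem zmod_two_eq_zero_or_one (x : ZMod 2) : x = 0 ∨ x = 1 := by
  revert x; decide

section Rows
variable {k : ℕ} {p : Fin k → ℕ} [∀ i, Fact (p i).Prime]

theorem addJacobi_divisorAway (hp : Function.Injective p) (i : Fin k) (x : Fin k → ZMod 2) :
    addJacobi (divisorAway p i x) (p i)
      = ∑ j ∈ Finset.univ.erase i, addJacobi (p j) (p i) * x j := by
  rw [divisorAway, addJacobi_prod]
  · refine Finset.sum_congr rfl fun j _ => ?_
    rcases zmod_two_eq_zero_or_one (x j) with h | h <;> rw [h]
    · simp [addJacobi_one]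
    · simp [ZMod.val_one]
  · exact fun j hj h => not_dvd_of_ne hp (Finset.ne_of_mem_erase hj)
      ((Nat.prime_iff_prime_int.1 Fact.out).dvd_of_dvd_pow h)

/-- Off the diagonal the entry is the symbol of `p_j` at `p_i`, by `addHilbert_unit`. On the
diagonal it is the symbol of `n / p_i` at `p_i`, by `addHilbert_prime`. -/
theorem matA_mulVec (hp : Function.Injective p) (hp2 : ∀ i, p i ≠ 2) (i : Fin k)
    (x : Fin k → ZMod 2) :
    (matA p (∏ i, p i)).mulVec x i
      = addJacobi (divisorAway p i x) (p i) + addJacobi (divisorAway p i 1) (p i) * x i := by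
  have hn : -((∏ j, p j : ℕ) : ℤ) = p i * -divisorAway p i 1 := by
    rw [← divisorOf_one, divisorOf_eq p i]
    simp [ZMod.val_one]
  have hm := not_dvd_divisorAway hp i (1 : Fin k → ZMod 2)
  have hcast : -((∏ j, p j : ℕ) : ℚ_[p i]) = ((p i * -divisorAway p i 1 : ℤ) : ℚ_[p i]) := by
    rw [← hn]; push_cast; rfl
  have hcast' : -((∏ j, p j : ℕ) : ℚ_[p i]) = ((-(p i * divisorAway p i 1) : ℤ) : ℚ_[p i]) := by
    rw [hcast, mul_neg]
  rw [Matrix.mulVec, dotProduct, ← Finset.sum_erase_add _ _ (Finset.mem_univ i),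
    addJacobi_divisorAway hp]
  congr 1
  · refine Finset.sum_congr rfl fun j hj => ?_
    rw [matA, Matrix.of_apply, hcast]
    have := addHilbert_unit (p := p i) (hp2 i) (not_dvd_of_ne hp (Finset.ne_of_mem_erase hj))
      (m := -divisorAway p i 1) (by rwa [dvd_neg])
    rw [← this]
    push_cast
    rfl
  · rw [matA, Matrix.of_apply, hcast', addHilbert_prime (hp2 i) hm]

theorem matM_mulVec_inl (e : Coeffs) (hp : Function.Injective p) (hp2 : ∀ i, p i ≠ 2) (i : Fin k)
    (x y : Fin k → ZMod 2) :
    (matM e p (∏ i, p i)).mulVec (Sum.elim x y) (Sum.inl i)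
      = addJacobi (divisorAway p i x) (p i) + addJacobi (divisorAway p i 1) (p i) * x i
        + addJacobi (-e.e₃) (p i) * x i + addJacobi (-(e.e₂ * e.e₃)) (p i) * y i := by
  rw [matM, Matrix.fromBlocks_mulVec, Sum.elim_inl, Pi.add_apply, Matrix.add_mulVec, Pi.add_apply,
    Sum.elim_comp_inl, Sum.elim_comp_inr, matA_mulVec hp hp2, matD, matD, Matrix.mulVec_diagonal,
    Matrix.mulVec_diagonal]

theorem matM_mulVec_inr (e : Coeffs) (hp : Function.Injective p) (hp2 : ∀ i, p i ≠ 2) (i : Fin k)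
    (x y : Fin k → ZMod 2) :
    (matM e p (∏ i, p i)).mulVec (Sum.elim x y) (Sum.inr i)
      = addJacobi (-(e.e₁ * e.e₃)) (p i) * x i + (addJacobi (divisorAway p i y) (p i)
        + addJacobi (divisorAway p i 1) (p i) * y i + addJacobi e.e₃ (p i) * y i) := by
  rw [matM, Matrix.fromBlocks_mulVec, Sum.elim_inr, Pi.add_apply, Matrix.add_mulVec, Pi.add_apply,
    Sum.elim_comp_inl, Sum.elim_comp_inr, matA_mulVec hp hp2, matD, matD, Matrix.mulVec_diagonal,
    Matrix.mulVec_diagonal]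

end Rows

theorem Coeffs.solvable_TS (e : Coeffs) (K : Type) [Field K] [CharZero K] :
    e.Solvable K (-(e.e₂ * e.e₃) : ℤ) e.e₃ (-e.e₂ : ℤ) := by
  have hs : (e.e₁ : K) + e.e₂ + e.e₃ = 0 := by
    exact_mod_cast congrArg (Int.cast (R := K)) e.sum_eq
  refine ⟨1, 0, 1, 1, by simp, ?_, ?_, ?_⟩ <;> push_cast
  · linear_combination hs
  · ring
  · ring

section Local
variable {p : ℕ} [Fact p.Prime]

theorem prime_not_dvd_mul {a b : ℤ} (ha : ¬ (p : ℤ) ∣ a) (hb : ¬ (p : ℤ) ∣ b) :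
    ¬ (p : ℤ) ∣ a * b := fun h =>
  ((Nat.prime_iff_prime_int.1 Fact.out).dvd_or_dvd h).elim ha hb

/-- The local condition at a prime `p ∥ n`, as a pair of linear equations. -/
theorem Coeffs.solvable_twist_iff (e : Coeffs) (hp : p ≠ 2) {n : ℕ} (hn : n ≠ 0) {m : ℤ}
    (hm : ¬ (p : ℤ) ∣ m) (hnm : (n : ℤ) = p * m) (ha : ¬ (p : ℤ) ∣ e.e₁) (hb : ¬ (p : ℤ) ∣ e.e₂)
    (hc : ¬ (p : ℤ) ∣ e.e₃) {a b c : ℤ} (h₁ : ¬ (p : ℤ) ∣ a) (h₂ : ¬ (p : ℤ) ∣ b)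
    (h₃ : ¬ (p : ℤ) ∣ c) (x y : ZMod 2)
    (hsq : IsSquare ((p : ℤ) ^ x.val * a * ((p : ℤ) ^ y.val * b) * ((p : ℤ) ^ (x + y).val * c))) :
    (e.twist n hn).Solvable ℚ_[p] ((p : ℤ) ^ x.val * a : ℤ) ((p : ℤ) ^ y.val * b : ℤ)
        ((p : ℤ) ^ (x + y).val * c : ℤ) ↔
      addJacobi a p + addJacobi m p * x + addJacobi (-e.e₃) p * x
          + addJacobi (-(e.e₂ * e.e₃)) p * y = 0 ∧
        addJacobi (-(e.e₁ * e.e₃)) p * x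
          + (addJacobi b p + addJacobi m p * y + addJacobi e.e₃ p * y) = 0 := by
  have hp0 : (p : ℤ) ≠ 0 := Int.natCast_ne_zero.2 (Fact.out : p.Prime).ne_zero
  have nz : ∀ {w : ℤ}, ¬ (p : ℤ) ∣ w → w ≠ 0 := by
    rintro w hw rfl
    exact hw (dvd_zero _)
  have hpow : ∀ j : ℕ, ∀ {w : ℤ}, ¬ (p : ℤ) ∣ w → (p : ℤ) ^ j * w ≠ 0 := fun j w hw =>
    mul_ne_zero (pow_ne_zero _ hp0) (nz hw)
  have E₁ : (e.twist n hn).e₁ = p * (m * e.e₁) := by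
    show e.e₁ * n = _
    rw [hnm]; ring
  have E₂ : (e.twist n hn).e₂ = p * (m * e.e₂) := by
    show e.e₂ * n = _
    rw [hnm]; ring
  have E₃ : (e.twist n hn).e₃ = p * (m * e.e₃) := by
    show e.e₃ * n = _
    rw [hnm]; ring
  have ha' := (not_sq_dvd_prime_mul (prime_not_dvd_mul hm ha))
  have na := nz ha
  have nb := nz hb
  have nc := nz hc
  have nm := nz hm
  have ng : ∀ {w : ℤ}, ¬ (p : ℤ) ∣ w → ¬ (p : ℤ) ∣ -w := fun hw => by rwa [dvd_neg]
  have main : ∀ {t₁ t₂ t₃ w₁ w₂ w₃ r₁ r₂ r₃ : ℤ}, t₁ ≠ 0 → t₂ ≠ 0 → t₃ ≠ 0 →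
      IsSquare (t₁ * t₂ * t₃) → (e.twist n hn).Solvable ℚ_[p] t₁ t₂ t₃ →
      ¬ (p : ℤ) ∣ w₁ → ¬ (p : ℤ) ∣ w₂ → ¬ (p : ℤ) ∣ w₃ →
      (p : ℤ) ^ x.val * a * t₁ = w₁ * r₁ ^ 2 → (p : ℤ) ^ y.val * b * t₂ = w₂ * r₂ ^ 2 →
      (p : ℤ) ^ (x + y).val * c * t₃ = w₃ * r₃ ^ 2 →
      ((e.twist n hn).Solvable ℚ_[p] ((p : ℤ) ^ x.val * a : ℤ) ((p : ℤ) ^ y.val * b : ℤ)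
        ((p : ℤ) ^ (x + y).val * c : ℤ) ↔ addJacobi w₁ p = 0 ∧ addJacobi w₂ p = 0) := by
    intro t₁ t₂ t₃ w₁ w₂ w₃ r₁ r₂ r₃ n₁ n₂ n₃ ht hs hw₁ hw₂ hw₃ k₁ k₂ k₃
    rw [addJacobi_eq_zero_iff hw₁, addJacobi_eq_zero_iff hw₂]
    exact Coeffs.solvable_iff_of_twist hp (E₁ ▸ dvd_mul_right _ _) (E₂ ▸ dvd_mul_right _ _)
      (E₁ ▸ ha') (hpow _ h₁) (hpow _ h₂) (hpow _ h₃) n₁ n₂ n₃ hsq ht hs hw₁ hw₂ hw₃ k₁ k₂ k₃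
  have J₁ : addJacobi (-(e.e₂ * e.e₃)) p = addJacobi e.e₂ p + addJacobi (-e.e₃) p := by
    rw [← mul_neg, addJacobi_mul hb (ng hc)]
  have J₂ : addJacobi (-(e.e₁ * e.e₃)) p = addJacobi (-e.e₁) p + addJacobi e.e₃ p := by
    rw [← neg_mul, addJacobi_mul (ng ha) hc]
  have two : ∀ z : ZMod 2, z + z = 0 := by decide
  have one : ((1 : ZMod 2)).val = 1 := rfl
  have zero : ((0 : ZMod 2)).val = 0 := rfl
  have oo : (1 + 1 : ZMod 2) = 0 := rfl
  -- The valuations of the triple are `(x, y, x + y)`. For the twist, the classes `1`, `TS`, `S`,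
  -- `T` have valuations of parities `(0,0,0)`, `(0,1,1)`, `(1,0,1)`, `(1,1,0)` at `p`. In each case
  -- the class with the same parities leaves a unit triple `w` times squares, and the condition is
  -- that `w₁` and `w₂` have trivial symbols.
  rcases zmod_two_eq_zero_or_one x with rfl | rfl <;>
    rcases zmod_two_eq_zero_or_one y with rfl | rfl
  · refine (main (t₁ := 1) (t₂ := 1) (t₃ := 1) (r₁ := 1) (r₂ := 1) (r₃ := 1) one_ne_zero one_ne_zero
      one_ne_zero ⟨1, by ring⟩ (by simpa using (e.twist n hn).solvable_one ℚ_[p]) h₁ h₂ h₃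
      (by simp) (by simp) (by simp)).trans ?_
    simp
  · refine (main (t₁ := -((e.twist n hn).e₂ * (e.twist n hn).e₃)) (t₂ := (e.twist n hn).e₃)
      (t₃ := -(e.twist n hn).e₂) (w₁ := a * -(e.e₂ * e.e₃)) (w₂ := b * m * e.e₃)
      (w₃ := c * m * -e.e₂) (r₁ := p * m) (r₂ := p) (r₃ := p)
      (by simp [Coeffs.ne₂, Coeffs.ne₃]) (Coeffs.ne₃ _) (by simp [Coeffs.ne₂])
      ⟨(e.twist n hn).e₂ * (e.twist n hn).e₃, by ring⟩ ((e.twist n hn).solvable_TS ℚ_[p])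
      (prime_not_dvd_mul h₁ (ng (prime_not_dvd_mul hb hc)))
      (prime_not_dvd_mul (prime_not_dvd_mul h₂ hm) hc)
      (prime_not_dvd_mul (prime_not_dvd_mul h₃ hm) (ng hb)) ?_ ?_ ?_).trans ?_
    · rw [E₂, E₃, zero]; ring
    · rw [E₃, one]; ring
    · rw [E₂, zero_add, one]; ring
    · rw [addJacobi_mul h₁ (ng (prime_not_dvd_mul hb hc)),
        addJacobi_mul (prime_not_dvd_mul h₂ hm) hc, addJacobi_mul h₂ hm]
      simp
  · refine (main (t₁ := -(e.twist n hn).e₃) (t₂ := -((e.twist n hn).e₁ * (e.twist n hn).e₃))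
      (t₃ := (e.twist n hn).e₁) (w₁ := a * m * -e.e₃) (w₂ := b * -(e.e₁ * e.e₃))
      (w₃ := c * m * e.e₁) (r₁ := p) (r₂ := p * m) (r₃ := p)
      (by simp [Coeffs.ne₃]) (by simp [Coeffs.ne₁, Coeffs.ne₃]) (Coeffs.ne₁ _)
      ⟨(e.twist n hn).e₁ * (e.twist n hn).e₃, by ring⟩
      (by simpa using (e.twist n hn).solvable_S ℚ_[p])
      (prime_not_dvd_mul (prime_not_dvd_mul h₁ hm) (ng hc))
      (prime_not_dvd_mul h₂ (ng (prime_not_dvd_mul ha hc)))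
      (prime_not_dvd_mul (prime_not_dvd_mul h₃ hm) ha) ?_ ?_ ?_).trans ?_
    · rw [E₃, one]; ring
    · rw [E₁, E₃, zero]; ring
    · rw [E₁, add_zero, one]; ring
    · rw [addJacobi_mul h₂ (ng (prime_not_dvd_mul ha hc)),
        addJacobi_mul (prime_not_dvd_mul h₁ hm) (ng hc), addJacobi_mul h₁ hm]
      simp [add_comm]
  · refine (main (t₁ := (e.twist n hn).e₂) (t₂ := -(e.twist n hn).e₁)
      (t₃ := -((e.twist n hn).e₁ * (e.twist n hn).e₂)) (w₁ := a * m * e.e₂) (w₂ := b * m * -e.e₁)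
      (w₃ := c * -(e.e₁ * e.e₂)) (r₁ := p) (r₂ := p) (r₃ := p * m)
      (Coeffs.ne₂ _) (by simp [Coeffs.ne₁]) (by simp [Coeffs.ne₁, Coeffs.ne₂])
      ⟨(e.twist n hn).e₁ * (e.twist n hn).e₂, by ring⟩
      (by simpa using (e.twist n hn).solvable_T ℚ_[p])
      (prime_not_dvd_mul (prime_not_dvd_mul h₁ hm) hb)
      (prime_not_dvd_mul (prime_not_dvd_mul h₂ hm) (ng ha))
      (prime_not_dvd_mul h₃ (ng (prime_not_dvd_mul ha hb))) ?_ ?_ ?_).trans ?_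
    · rw [E₂, one]; ring
    · rw [E₁, one]; ring
    · rw [E₁, E₂, oo, zero]; ring
    · rw [addJacobi_mul (prime_not_dvd_mul h₁ hm) hb, addJacobi_mul h₁ hm,
        addJacobi_mul (prime_not_dvd_mul h₂ hm) (ng ha), addJacobi_mul h₂ hm, J₁, J₂]
      generalize addJacobi a p = A
      generalize addJacobi b p = B
      generalize addJacobi m p = M
      generalize addJacobi e.e₂ p = E2
      generalize addJacobi (-e.e₁) p = E1
      generalize addJacobi (-e.e₃) p = E3
      generalize addJacobi e.e₃ p = E3'
      -- Each symbol of `-e₃` or `e₃` occurs twice in its row and cancels in characteristic two.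
      have r1 : A + M * 1 + E3 * 1 + (E2 + E3) * 1 = A + M + E2 := by
        linear_combination two E3
      have r2 : (E1 + E3') * 1 + (B + M * 1 + E3' * 1) = B + M + E1 := by
        linear_combination two E3'
      rw [r1, r2]

end Local

/-! ### Odd representatives and comparison with the Selmer group of E -/

theorem isSquare_of_isCoprime {b t : ℤ} (hb : 0 < b) (hbt : IsCoprime b t)
    (h : IsSquare (b * t)) : IsSquare b ∧ IsSquare t := by
  obtain ⟨c, hc⟩ := h
  obtain ⟨r, hr⟩ := Int.sq_of_isCoprime hbt (by rw [hc]; ring : b * t = c ^ 2)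
  have hb2 : b = r ^ 2 := by
    rcases hr with h | h
    · exact h
    · nlinarith [sq_nonneg r]
  have hr0 : r ≠ 0 := by rintro rfl; simp [hb2] at hb
  refine ⟨⟨r, by rw [hb2]; ring⟩, isSquare_of_mul_sq hr0 ⟨c, ?_⟩⟩
  rw [← hc, hb2]; ring

theorem exists_squarefree_rep (c : SqClass ℚ) : ∃ s : ℤ, Squarefree s ∧ sq (s : ℚ) = c := by
  obtain ⟨u, rfl⟩ := exists_unit c
  have hnum : (u : ℚ).num ≠ 0 := Rat.num_ne_zero.2 u.ne_zero
  have hden : ((u : ℚ).den : ℤ) ≠ 0 := Int.natCast_ne_zero.2 (u : ℚ).den_nz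
  obtain ⟨s, r, hs, hr, hsr⟩ := exists_squarefree_mul_sq (mul_ne_zero hnum hden)
  refine ⟨s, hs, ?_⟩
  have hr' := intCast_rat_ne_zero hr
  have hden' : ((u : ℚ).den : ℚ) ≠ 0 := Nat.cast_ne_zero.2 (u : ℚ).den_nz
  rw [sq_eq_iff (intCast_rat_ne_zero hs.ne_zero) u.ne_zero]
  refine ⟨r / (u : ℚ).den, div_ne_zero hr' hden', ?_⟩
  have h := congrArg (Int.cast (R := ℚ)) hsr
  push_cast at h
  have h2 : (u : ℚ) * (u : ℚ).den = (u : ℚ).num := Rat.mul_den_eq_num _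
  field_simp
  linear_combination h + ((u : ℚ).den : ℚ) * h2

section Prime
variable {p : ℕ} [Fact p.Prime]

theorem not_isSquare_prime_mul {w : ℤ} (hw : ¬ (p : ℤ) ∣ w) : ¬ IsSquare (p * w) := by
  rintro ⟨c, hc⟩
  have hpp : Prime (p : ℤ) := Nat.prime_iff_prime_int.1 Fact.out
  have h1 : (p : ℤ) ∣ c := (hpp.dvd_or_dvd (Dvd.intro _ hc)).elim id id
  exact not_sq_dvd_prime_mul hw (by rw [hc, pow_two]; exact mul_dvd_mul h1 h1)

theorem not_sq_dvd_of_squarefree {d : ℤ} (hd : Squarefree d) : ¬ (p : ℤ) ^ 2 ∣ d := fun h =>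
  (Nat.prime_iff_prime_int.1 Fact.out : Prime (p : ℤ)).not_isUnit (hd _ (by rwa [← pow_two]))

theorem exists_eq_prime_mul_of_squarefree {d : ℤ} (hd : Squarefree d) (h : (p : ℤ) ∣ d) :
    ∃ w, ¬ (p : ℤ) ∣ w ∧ d = p * w := by
  obtain ⟨w, rfl⟩ := h
  refine ⟨w, ?_, rfl⟩
  rintro ⟨w', rfl⟩
  exact not_sq_dvd_of_squarefree (p := p) hd ⟨w', by ring⟩

/-- The product is a square of squarefree factors, so `p` divides none or exactly two of the `dᵢ`.
By `not_hasPoint_of_dvd`, dividing `d₃` and `d₁` would need `p ∣ b`, and dividing `d₂` and `d₃`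
would need `p ∣ a`. -/
theorem not_dvd_of_hasPoint {a b c d₁ d₂ d₃ : ℤ} (ha : ¬ (p : ℤ) ∣ a) (hb : ¬ (p : ℤ) ∣ b)
    (h₁ : Squarefree d₁) (h₂ : Squarefree d₂) (h₃ : Squarefree d₃) (hd : IsSquare (d₁ * d₂ * d₃))
    (h : HasPoint (a : ℚ_[p]) (b : ℚ_[p]) (c : ℚ_[p]) (d₁ : ℚ_[p]) (d₂ : ℚ_[p]) (d₃ : ℚ_[p])) :
    ¬ (p : ℤ) ∣ d₃ := by
  intro h3
  have hp0 : (p : ℤ) ≠ 0 := Int.natCast_ne_zero.2 (Fact.out : p.Prime).ne_zero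
  have s₁ := not_sq_dvd_of_squarefree (p := p) h₁
  have s₂ := not_sq_dvd_of_squarefree (p := p) h₂
  have s₃ := not_sq_dvd_of_squarefree (p := p) h₃
  by_cases h1 : (p : ℤ) ∣ d₁ <;> by_cases h2 : (p : ℤ) ∣ d₂
  · obtain ⟨w₁, n₁, rfl⟩ := exists_eq_prime_mul_of_squarefree h₁ h1
    obtain ⟨w₂, n₂, rfl⟩ := exists_eq_prime_mul_of_squarefree h₂ h2
    obtain ⟨w₃, n₃, rfl⟩ := exists_eq_prime_mul_of_squarefree h₃ h3
    refine not_isSquare_prime_mul (prime_not_dvd_mul (prime_not_dvd_mul n₁ n₂) n₃)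
      (isSquare_of_mul_sq hp0 ?_)
    convert hd using 1
    ring
  · exact not_hasPoint_of_dvd hb h3 h1 s₃ s₁ h2 h.rotate.rotate
  · exact not_hasPoint_of_dvd ha h2 h3 s₂ s₃ h1 h.rotate
  · obtain ⟨w₃, n₃, rfl⟩ := exists_eq_prime_mul_of_squarefree h₃ h3
    refine not_isSquare_prime_mul (prime_not_dvd_mul (prime_not_dvd_mul h1 h2) n₃) ?_
    convert hd using 1
    ring

end Prime

theorem odd_of_isSquare_mul {x y z : ℤ} (hx : Odd x) (hz : Odd z) (hy : Squarefree y)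
    (h : IsSquare (x * y * z)) : Odd y := by
  by_contra hy'
  rw [Int.not_odd_iff_even, even_iff_two_dvd] at hy'
  have h4 := not_sq_dvd_of_squarefree (p := 2) hy
  refine not_isSquare_of_two_dvd (hy'.mul_left (x * z)) (not_four_dvd_mul (hx.mul hz) ?_)
    (by convert h using 1; ring)
  simpa using h4

namespace Coeffs.OddAtTwo
variable {e : Coeffs} (he : e.OddAtTwo)
include he

/-- Since `e₁` and `e₂` are odd, `not_dvd_of_hasPoint` at `2` makes `d₃` odd; the square product
then ties the parity of `d₂` to that of `d₁`. -/
theorem exists_rep {L : SqClass ℚ × SqClass ℚ × SqClass ℚ} (hL : L ∈ e.Sel) :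
    ∃ d₁ d₂ d₃ : ℤ, Squarefree d₁ ∧ Squarefree d₂ ∧ Squarefree d₃ ∧ L = classOf d₁ d₂ d₃ ∧
      Odd d₃ ∧ (Odd d₁ → Odd d₂) := by
  obtain ⟨d₁, s₁, h₁⟩ := exists_squarefree_rep L.1
  obtain ⟨d₂, s₂, h₂⟩ := exists_squarefree_rep L.2.1
  obtain ⟨d₃, s₃, h₃⟩ := exists_squarefree_rep L.2.2
  have hLd : L = classOf d₁ d₂ d₃ := by
    rw [classOf, h₁, h₂, h₃]
  rw [hLd] at hL
  obtain ⟨hsq, hs⟩ := (classOf_mem_sel_iff s₁.ne_zero s₂.ne_zero s₃.ne_zero).1 hL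
  have o₃ : Odd d₃ := by
    have := not_dvd_of_hasPoint (p := 2) (fun h => Int.not_even_iff_odd.2 he.1
      (even_iff_two_dvd.2 h)) (fun h => Int.not_even_iff_odd.2 he.2.1 (even_iff_two_dvd.2 h))
      s₁ s₂ s₃ hsq (Coeffs.solvable_intCast.1 (hs.2 2))
    rw [← Int.not_even_iff_odd, even_iff_two_dvd]
    exact this
  exact ⟨d₁, d₂, d₃, s₁, s₂, s₃, hLd, o₃, fun o₁ => odd_of_isSquare_mul o₁ o₃ s₂ hsq⟩

/-- Up to the torsion class `S`, a Selmer class is represented by odd integers. -/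
theorem exists_odd_rep {L : SqClass ℚ × SqClass ℚ × SqClass ℚ} (hL : L ∈ e.Sel) :
    ∃ d₁ d₂ d₃ : ℤ, Squarefree d₁ ∧ Squarefree d₂ ∧ Squarefree d₃ ∧ Odd d₁ ∧ Odd d₂ ∧ Odd d₃ ∧
      classOf d₁ d₂ d₃ ∈ e.Sel ∧ (L = classOf d₁ d₂ d₃ ∨ L = classOf d₁ d₂ d₃ * e.classS) := by
  obtain ⟨d₁, d₂, d₃, s₁, s₂, s₃, rfl, o₃, o₁₂⟩ := he.exists_rep hL
  by_cases o₁ : Odd d₁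
  · exact ⟨d₁, d₂, d₃, s₁, s₂, s₃, o₁, o₁₂ o₁, o₃, hL, Or.inl rfl⟩
  -- The first entry `-e₃` of `S` has `2`-adic valuation `1`. Multiplying an even squarefree `d₁` by
  -- it gives an even valuation, so a squarefree representative `f₁` of the new class is odd.
  have hLS := mul_mem hL e.classS_mem
  obtain ⟨f₁, f₂, f₃, t₁, t₂, t₃, hf, o₃', o₁₂'⟩ := he.exists_rep hLS
  have o₁' : Odd f₁ := by
    by_contra hf₁
    rw [Int.not_odd_iff_even, even_iff_two_dvd] at o₁ hf₁
    have h4 := not_sq_dvd_of_squarefree (p := 2) t₁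
    obtain ⟨a, ha, rfl⟩ := exists_eq_prime_mul_of_squarefree (p := 2) s₁ o₁
    obtain ⟨b, hb⟩ := he.2.2.1
    have hb' : ¬ (2 : ℤ) ∣ b := by
      rintro ⟨b', rfl⟩
      exact he.2.2.2 ⟨b', by rw [hb]; ring⟩
    have ha' : Odd a := by
      rw [← Int.not_even_iff_odd, even_iff_two_dvd]; exact ha
    have hb'' : Odd b := by
      rw [← Int.not_even_iff_odd, even_iff_two_dvd]; exact hb'
    have n₁ := s₁.ne_zero
    have n₃ : -e.e₃ ≠ 0 := neg_ne_zero.2 e.ne₃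
    have h1 : sq (((2 : ℕ) * a : ℤ) * (-e.e₃ : ℤ) : ℚ) = sq (f₁ : ℚ) := by
      rw [sq_mul (intCast_rat_ne_zero n₁) (intCast_rat_ne_zero n₃)]
      exact congrArg Prod.fst hf
    rw [← Int.cast_mul, sq_intCast_eq_iff (mul_ne_zero n₁ n₃) t₁.ne_zero] at h1
    have h2 : IsSquare (a * -b * f₁) := by
      refine isSquare_of_mul_sq two_ne_zero ?_
      convert h1 using 1
      rw [hb]; push_cast; ring
    exact not_isSquare_of_two_dvd (hf₁.mul_left _)
      (not_four_dvd_mul (ha'.mul hb''.neg) (by simpa using h4)) h2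
  refine ⟨f₁, f₂, f₃, t₁, t₂, t₃, o₁', o₁₂' o₁', o₃', hf ▸ hLS, Or.inr ?_⟩
  rw [← hf, mul_assoc, sq_class_triple_mul_self, mul_one]

end Coeffs.OddAtTwo

/-- Take `b = gcd(d, n)`: as `d` is squarefree, a common factor of `d / b` and `n` would divide `b`
as well, hence be a unit. -/
theorem exists_coprime_factorization {d : ℤ} (hd : Squarefree d) (n : ℤ) :
    ∃ a b : ℤ, d = a * b ∧ 0 < b ∧ b ∣ n ∧ IsCoprime a n := by
  obtain ⟨a, ha⟩ := Int.gcd_dvd_left d n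
  have hb : (0 : ℤ) < Int.gcd d n := Int.natCast_pos.2 (Int.gcd_pos_of_ne_zero_left n hd.ne_zero)
  refine ⟨a, Int.gcd d n, by rw [mul_comm]; exact ha, hb, Int.gcd_dvd_right d n, ?_⟩
  rw [ha] at hd
  refine IsRelPrime.isCoprime fun g hga hgn => ?_
  have hrel := (squarefree_mul_iff.1 hd).1
  refine hrel (Int.dvd_coe_gcd ?_ hgn) hga
  rw [ha]
  exact hga.mul_left _

theorem HasPoint.untwist {K : Type} [Field K] {a b c n d₁ d₂ d₃ : K} (hn0 : n ≠ 0)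
    (hn : IsSquare n) (h : HasPoint (a * n) (b * n) (c * n) d₁ d₂ d₃) :
    HasPoint a b c d₁ d₂ d₃ := by
  obtain ⟨r, rfl⟩ := hn
  have hr := left_ne_zero_of_mul hn0
  obtain ⟨t, u₁, u₂, u₃, h0, k₁, k₂, k₃⟩ := h
  refine ⟨r * t, u₁, u₂, u₃, by simpa [hr] using h0, ?_, ?_, ?_⟩
  · linear_combination k₁
  · linear_combination k₂
  · linear_combination k₃

/-- Over a field in which `n` and the `bᵢ` are squares, `n` and the `bᵢ` can be removed. -/
theorem Coeffs.solvable_of_twist_of_isSquare {e : Coeffs} {K : Type} [Field K] [CharZero K] {n : ℕ}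
    (hn : n ≠ 0) (hnK : IsSquare (n : K)) {a₁ a₂ a₃ b₁ b₂ b₃ : ℤ} (ha₁ : a₁ ≠ 0) (ha₂ : a₂ ≠ 0)
    (ha₃ : a₃ ≠ 0) (hb₁ : b₁ ≠ 0) (hb₂ : b₂ ≠ 0) (hb₃ : b₃ ≠ 0) (q₁ : IsSquare (b₁ : K))
    (q₂ : IsSquare (b₂ : K)) (q₃ : IsSquare (b₃ : K))
    (h : (e.twist n hn).Solvable K (a₁ * b₁ : ℤ) (a₂ * b₂ : ℤ) (a₃ * b₃ : ℤ)) :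
    e.Solvable K a₁ a₂ a₃ := by
  have c : ∀ {d : ℤ}, d ≠ 0 → (d : K) ≠ 0 := fun hd => Int.cast_ne_zero.2 hd
  have s : ∀ {a b : ℤ}, a ≠ 0 → b ≠ 0 → IsSquare (b : K) → sq ((a * b : ℤ) : K) = sq (a : K) := by
    intro a b ha hb ⟨r, hr⟩
    refine ((sq_eq_iff (c ha) (c (mul_ne_zero ha hb))).2 ⟨r, ?_, ?_⟩).symm
    · rintro rfl
      exact c hb (by rw [hr, zero_mul])
    · push_cast
      rw [hr]; ring
  rw [Coeffs.solvable_intCast] at h ⊢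
  have h' := h.of_rep (c (mul_ne_zero ha₁ hb₁)) (c (mul_ne_zero ha₂ hb₂)) (c (mul_ne_zero ha₃ hb₃))
    (c ha₁) (c ha₂) (c ha₃) (s ha₁ hb₁ q₁) (s ha₂ hb₂ q₂) (s ha₃ hb₃ q₃)
  refine HasPoint.untwist (n := (n : K)) (Nat.cast_ne_zero.2 hn) hnK ?_
  simpa [Coeffs.twist] using h'

/-- With `dᵢ = aᵢbᵢ` and `bᵢ = gcd(dᵢ, n)`, the triple `(aᵢ)` is a Selmer class of `E` itself. Over
`ℝ` and at odd `q ∣ e₁e₂e₃`, both `n` and the `bᵢ` are squares and can be removed. At the other odd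
`q` the `aᵢ` are units and `E` has good reduction. The prime `2` is free by `solvable_two`. -/
theorem Coeffs.OddAtTwo.classOf_eq_of_odd {e : Coeffs} (he : e.OddAtTwo)
    (hSel : Nonempty (e.Sel ≃* Multiplicative (ZMod 2 × ZMod 2))) {n : ℕ} (hn : n ≠ 0)
    (hres : ∀ q : ℕ, q.Prime → q ≠ 2 → (q : ℤ) ∣ e.e₁ * e.e₂ * e.e₃ → ∀ b : ℤ, 0 < b →
      b ∣ (n : ℤ) → ¬ (q : ℤ) ∣ b ∧ IsSquare (b : ZMod q)) {d₁ d₂ d₃ : ℤ}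
    (s₁ : Squarefree d₁) (s₂ : Squarefree d₂) (s₃ : Squarefree d₃) (o₁ : Odd d₁) (o₂ : Odd d₂)
    (o₃ : Odd d₃) (h : classOf d₁ d₂ d₃ ∈ (e.twist n hn).Sel) :
    ∃ b₁ b₂ b₃ : ℤ, (0 < b₁ ∧ b₁ ∣ n) ∧ (0 < b₂ ∧ b₂ ∣ n) ∧ (0 < b₃ ∧ b₃ ∣ n) ∧
      IsSquare (b₁ * b₂ * b₃) ∧ (classOf d₁ d₂ d₃ = classOf b₁ b₂ b₃ ∨
        classOf d₁ d₂ d₃ = classOf b₁ b₂ b₃ * e.classT) := by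
  obtain ⟨hsq, hs⟩ := (classOf_mem_sel_iff s₁.ne_zero s₂.ne_zero s₃.ne_zero).1 h
  obtain ⟨a₁, b₁, rfl, pb₁, db₁, c₁⟩ := exists_coprime_factorization s₁ n
  obtain ⟨a₂, b₂, rfl, pb₂, db₂, c₂⟩ := exists_coprime_factorization s₂ n
  obtain ⟨a₃, b₃, rfl, pb₃, db₃, c₃⟩ := exists_coprime_factorization s₃ n
  have na₁ := left_ne_zero_of_mul s₁.ne_zero
  have na₂ := left_ne_zero_of_mul s₂.ne_zero
  have na₃ := left_ne_zero_of_mul s₃.ne_zero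
  have cA : IsCoprime (n : ℤ) (a₁ * a₂ * a₃) := ((c₁.mul_left c₂).mul_left c₃).symm
  have cB : IsCoprime (b₁ * b₂ * b₃) (a₁ * a₂ * a₃) :=
    ((cA.of_isCoprime_of_dvd_left db₁).mul_left (cA.of_isCoprime_of_dvd_left db₂)).mul_left
      (cA.of_isCoprime_of_dvd_left db₃)
  -- Coprimality makes each of the products of the `bᵢ` and of the `aᵢ` a square up to sign, and
  -- positivity of the `bᵢ` fixes the sign.
  obtain ⟨sqB, sqA⟩ := isSquare_of_isCoprime (mul_pos (mul_pos pb₁ pb₂) pb₃) cB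
    (by convert hsq using 1; ring)
  have hA : e.SolvableAwayTwo a₁ a₂ a₃ := by
    constructor
    · have hpos : ∀ b : ℤ, 0 < b → IsSquare (b : ℝ) := fun b hb =>
        ⟨√b, (Real.mul_self_sqrt (Int.cast_nonneg hb.le)).symm⟩
      exact Coeffs.solvable_of_twist_of_isSquare hn
        ⟨√n, (Real.mul_self_sqrt (Nat.cast_nonneg n)).symm⟩ na₁ na₂ na₃ pb₁.ne' pb₂.ne' pb₃.ne'
        (hpos _ pb₁) (hpos _ pb₂) (hpos _ pb₃) hs.1
    · intro q hq hq2
      have hqp : Prime (q : ℤ) := Nat.prime_iff_prime_int.1 Fact.out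
      by_cases hqe : (q : ℤ) ∣ e.e₁ * e.e₂ * e.e₃
      · have hQ : ∀ b : ℤ, 0 < b → b ∣ (n : ℤ) → IsSquare (b : ℚ_[q]) := fun b hb hbn =>
          isSquare_int_of_residue hq2 (hres q Fact.out hq2 hqe b hb hbn).1
            (hres q Fact.out hq2 hqe b hb hbn).2
        exact Coeffs.solvable_of_twist_of_isSquare hn
          (by simpa using hQ n (Int.natCast_pos.2 (Nat.pos_of_ne_zero hn)) dvd_rfl)
          na₁ na₂ na₃ pb₁.ne' pb₂.ne' pb₃.ne' (hQ _ pb₁ db₁) (hQ _ pb₂ db₂) (hQ _ pb₃ db₃) (hs.2 q)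
      · have hq1 : ¬ (q : ℤ) ∣ a₁ ∧ ¬ (q : ℤ) ∣ a₂ ∧ ¬ (q : ℤ) ∣ a₃ := by
          -- For `q ∣ n` the `aᵢ` are units because they are coprime to `n`. For `q ∤ n` the twist
          -- has unit coefficients, and `not_dvd_of_hasPoint` applies to each `dᵢ` by rotation.
          by_cases hqn : (q : ℤ) ∣ n
          · exact ⟨fun h => hqp.not_isUnit (c₁.isUnit_of_dvd' h hqn),
              fun h => hqp.not_isUnit (c₂.isUnit_of_dvd' h hqn),
              fun h => hqp.not_isUnit (c₃.isUnit_of_dvd' h hqn)⟩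
          · have g₁ : ¬ (q : ℤ) ∣ e.e₁ * n := prime_not_dvd_mul
              (fun h => hqe ((h.mul_right _).mul_right _)) hqn
            have g₂ : ¬ (q : ℤ) ∣ e.e₂ * n := prime_not_dvd_mul
              (fun h => hqe ((h.mul_left _).mul_right _)) hqn
            have g₃ : ¬ (q : ℤ) ∣ e.e₃ * n := prime_not_dvd_mul (fun h => hqe (h.mul_left _)) hqn
            have hpt := Coeffs.solvable_intCast.1 (hs.2 q)
            refine ⟨fun h => ?_, fun h => ?_, fun h => ?_⟩
            · exact not_dvd_of_hasPoint g₂ g₃ s₂ s₃ s₁ (by convert hsq using 1; ring) hpt.rotate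
                (h.mul_right _)
            · exact not_dvd_of_hasPoint g₃ g₁ s₃ s₁ s₂ (by convert hsq using 1; ring)
                hpt.rotate.rotate (h.mul_right _)
            · exact not_dvd_of_hasPoint g₁ g₂ s₁ s₂ s₃ hsq hpt (h.mul_right _)
        exact e.solvable_of_good hq2 hqe hq1.1 hq1.2.1 hq1.2.2 sqA
  have oa₁ := (Int.odd_mul.1 o₁).1
  have oa₂ := (Int.odd_mul.1 o₂).1
  have oa₃ := (Int.odd_mul.1 o₃).1
  have hmem : classOf a₁ a₂ a₃ ∈ e.Sel := (classOf_mem_sel_iff na₁ na₂ na₃).2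
    ⟨sqA, Coeffs.everywhereSolvable_iff.2 ⟨hA, he.solvable_two oa₁ oa₂ oa₃ sqA hA⟩⟩
  refine ⟨b₁, b₂, b₃, ⟨pb₁, db₁⟩, ⟨pb₂, db₂⟩, ⟨pb₃, db₃⟩, sqB, ?_⟩
  rw [classOf_mul na₁ na₂ na₃ pb₁.ne' pb₂.ne' pb₃.ne', mul_comm]
  -- The `aᵢ` are odd, which excludes `S` and `TS`.
  rcases he.sel_eq hSel hmem with h | h | h | h
  · left; rw [h, mul_one]
  · right; rw [h]
  · exact absurd h.symm (he.classS_ne oa₁)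
  · exact absurd h.symm (he.classT_mul_classS_ne oa₁)

/-! ### Selmer classes attached to vectors -/

section Vectors
variable {k : ℕ} (p : Fin k → ℕ)

/-- The class of the triple of positive divisors of `p_1 ⋯ p_k` with exponent vectors
`x`, `y`, `x + y`. -/
noncomputable def classVec (v : Fin k ⊕ Fin k → ZMod 2) : SqClass ℚ × SqClass ℚ × SqClass ℚ :=
  classOf (divisorOf p (v ∘ Sum.inl)) (divisorOf p (v ∘ Sum.inr))
    (divisorOf p (v ∘ Sum.inl + v ∘ Sum.inr))

variable {p}

theorem classVec_one :
    classVec p 1 = classOf ((∏ i, p i : ℕ) : ℤ) ((∏ i, p i : ℕ) : ℤ) 1 := by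
  have h : (1 : Fin k → ZMod 2) + 1 = 0 := by
    funext i
    exact (by decide : (1 + 1 : ZMod 2) = 0)
  rw [← divisorOf_one]
  change classOf (divisorOf p 1) (divisorOf p 1) (divisorOf p (1 + 1)) = _
  rw [h]
  simp [divisorOf]

theorem ne_two_of_odd_prod (hodd : Odd (∏ i, p i)) (i : Fin k) : p i ≠ 2 := by
  intro h
  have h2 : 2 ∣ ∏ i, p i := h ▸ Finset.dvd_prod_of_mem p (Finset.mem_univ i)
  exact Nat.not_even_iff_odd.2 hodd (even_iff_two_dvd.2 h2)

theorem prime_not_dvd_of_coprime {m : ℤ} {q : ℕ} (hq : q.Prime)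
    (hcop : IsCoprime ((∏ i, p i : ℕ) : ℤ) m) (hqm : (q : ℤ) ∣ m) :
    ¬ (q : ℤ) ∣ ((∏ i, p i : ℕ) : ℤ) := fun h =>
  (Nat.prime_iff_prime_int.1 hq).not_isUnit (hcop.isUnit_of_dvd' h hqm)

/-- Twisting multiplies `T` by `(n, n, n²)`, whose class is that of the all-ones vector. A factor
`T` of `E` can thus be traded for torsion of the twist and a triple of divisors. -/
theorem classT_twist (e : Coeffs) (hn : (∏ i, p i) ≠ 0) :
    (e.twist (∏ i, p i) hn).classT = e.classT * classVec p 1 := by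
  have n : ((∏ i, p i : ℕ) : ℤ) ≠ 0 := Int.natCast_ne_zero.2 hn
  have n₁ := e.ne₁
  have n₂ := e.ne₂
  rw [classVec_one, Coeffs.classT, Coeffs.classT, ← classOf_mul, classOf_eq_iff]
  · simp only [Coeffs.twist]
    generalize ((∏ i, p i : ℕ) : ℤ) = n
    exact ⟨⟨e.e₂ * n, by ring⟩, ⟨e.e₁ * n, by ring⟩, ⟨e.e₁ * e.e₂ * n, by ring⟩⟩
  all_goals first
    | exact n
    | exact one_ne_zero
    | simp only [Coeffs.twist, ne_eq, neg_eq_zero, mul_eq_zero, n, n₁, n₂, one_ne_zero, or_self,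
        not_false_eq_true]

variable [∀ i, Fact (p i).Prime]

theorem classVec_add (v w : Fin k ⊕ Fin k → ZMod 2) :
    classVec p (v + w) = classVec p v * classVec p w := by
  have h : ∀ x y z t : Fin k → ZMod 2, x + y + (z + t) = x + z + (y + t) := fun _ _ _ _ => by abel
  refine Prod.ext (sq_divisorOf_add _ _) (Prod.ext (sq_divisorOf_add _ _) ?_)
  change sq (divisorOf p (v ∘ Sum.inl + w ∘ Sum.inl + (v ∘ Sum.inr + w ∘ Sum.inr)) : ℚ) = _
  rw [h]
  exact sq_divisorOf_add _ _

/-- The first two entries determine the class of the third, as the product is a square. -/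
theorem classOf_eq_classVec (hsq : Squarefree (∏ i, p i)) {d₁ d₂ d₃ : ℤ} (h₁ : 0 < d₁)
    (h₁' : d₁ ∣ ((∏ i, p i : ℕ) : ℤ)) (h₂ : 0 < d₂) (h₂' : d₂ ∣ ((∏ i, p i : ℕ) : ℤ)) (h₃ : 0 < d₃)
    (hd : IsSquare (d₁ * d₂ * d₃)) :
    classOf d₁ d₂ d₃ = classVec p (valVec p d₁ d₂) := by
  change _ = classOf (divisorOf p fun i => (padicValInt (p i) d₁ : ZMod 2))
    (divisorOf p fun i => (padicValInt (p i) d₂ : ZMod 2))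
    (divisorOf p ((fun i => (padicValInt (p i) d₁ : ZMod 2)) +
      fun i => (padicValInt (p i) d₂ : ZMod 2)))
  refine Prod.ext ?_ (Prod.ext ?_ ?_)
  · simp only [classOf, divisorOf_padicValInt hsq h₁ h₁']
  · simp only [classOf, divisorOf_padicValInt hsq h₂ h₂']
  · simp only [classOf]
    rw [sq_divisorOf_add, divisorOf_padicValInt hsq h₁ h₁', divisorOf_padicValInt hsq h₂ h₂',
      ← sq_mul (intCast_rat_ne_zero h₁.ne') (intCast_rat_ne_zero h₂.ne'), ← Int.cast_mul,
      sq_intCast_eq_iff h₃.ne' (mul_ne_zero h₁.ne' h₂.ne'), mul_comm]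
    exact hd

theorem eq_divisorOf_of_sq_eq (hsq : Squarefree (∏ i, p i)) {d : ℤ} (hd : 0 < d)
    (hdn : d ∣ ((∏ i, p i : ℕ) : ℤ)) {x : Fin k → ZMod 2}
    (h : sq (d : ℚ) = sq (divisorOf p x : ℚ)) : d = divisorOf p x := by
  rw [← divisorOf_padicValInt hsq hd hdn] at h ⊢
  generalize (fun i => (padicValInt (p i) d : ZMod 2)) = z at h ⊢
  have h1 : sq (divisorOf p (z + x) : ℚ) = 1 := by
    rw [sq_divisorOf_add, h, sqClass_mul_self]
  have h2 := eq_zero_of_isSquare_divisorOf (injective_of_squarefree hsq)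
    ((sq_intCast_eq_one_iff (divisorOf_pos p _).ne').1 h1)
  have h3 : z = x := by
    funext i
    exact (CharTwo.add_eq_zero).1 (congrFun h2 i)
  rw [h3]

theorem isSquare_zmod_of_dvd (hsq : Squarefree (∏ i, p i)) {q : ℕ}
    (hq : ∀ i, IsSquare ((p i : ℕ) : ZMod q)) {b : ℤ} (hb : 0 < b)
    (hbn : b ∣ ((∏ i, p i : ℕ) : ℤ)) : IsSquare (b : ZMod q) := by
  rw [← divisorOf_padicValInt hsq hb hbn, divisorOf]
  push_cast
  exact Finset.isSquare_prod _ fun i _ => (hq i).pow _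

end Vectors

theorem mem_ker_toLin'_iff {ι : Type} [Fintype ι] [DecidableEq ι] {M : Matrix ι ι (ZMod 2)}
    {v : ι → ZMod 2} : v ∈ LinearMap.ker (Matrix.toLin' M) ↔ M.mulVec v = 0 := by
  rw [LinearMap.mem_ker, Matrix.toLin'_apply]

/-! ### The kernel of the matrix and the pure Selmer group -/

section Main
variable {e : Coeffs} {k : ℕ} {p : Fin k → ℕ} [∀ i, Fact (p i).Prime]

theorem solvable_divisorOf_iff (hsq : Squarefree (∏ i, p i)) (hodd : Odd (∏ i, p i))
    (hcop : IsCoprime ((∏ i, p i : ℕ) : ℤ) (e.e₁ * e.e₂ * e.e₃)) (i : Fin k)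
    (v : Fin k ⊕ Fin k → ZMod 2) :
    (e.twist (∏ i, p i) hsq.ne_zero).Solvable ℚ_[p i] (divisorOf p (v ∘ Sum.inl))
        (divisorOf p (v ∘ Sum.inr)) (divisorOf p (v ∘ Sum.inl + v ∘ Sum.inr)) ↔
      (matM e p (∏ i, p i)).mulVec v (Sum.inl i) = 0 ∧
        (matM e p (∏ i, p i)).mulVec v (Sum.inr i) = 0 := by
  have hp := injective_of_squarefree hsq
  have hp2 := ne_two_of_odd_prod hodd
  have hpn : ((p i : ℕ) : ℤ) ∣ ((∏ i, p i : ℕ) : ℤ) :=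
    Int.natCast_dvd_natCast.2 (Finset.dvd_prod_of_mem p (Finset.mem_univ i))
  have hdvd : ∀ m : ℤ, m ∣ e.e₁ * e.e₂ * e.e₃ → ¬ ((p i : ℕ) : ℤ) ∣ m := fun m hm h =>
    prime_not_dvd_of_coprime Fact.out hcop (h.trans hm) hpn
  have hv : v = Sum.elim (v ∘ Sum.inl) (v ∘ Sum.inr) := (Sum.elim_comp_inl_inr v).symm
  have hsq' := isSquare_mul_divisorOf_add (p := p) (v ∘ Sum.inl) (v ∘ Sum.inr)
  rw [divisorOf_eq p i, divisorOf_eq p i, divisorOf_eq p i] at hsq' ⊢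
  conv_rhs => rw [hv]
  rw [matM_mulVec_inl e hp hp2, matM_mulVec_inr e hp hp2]
  refine Coeffs.solvable_twist_iff e (hp2 i) _ (not_dvd_divisorAway hp i 1) ?_
    (hdvd _ ((dvd_mul_right _ _).mul_right _)) (hdvd _ ((dvd_mul_left _ _).mul_right _))
    (hdvd _ (dvd_mul_left _ _)) (not_dvd_divisorAway hp i _) (not_dvd_divisorAway hp i _)
    (not_dvd_divisorAway hp i _) _ _ hsq'
  rw [← divisorOf_one, divisorOf_eq p i]
  simp [ZMod.val_one]

/-- Only the primes dividing `n` impose conditions. Positivity settles `ℝ`, the residue hypothesis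
the odd primes dividing `e₁e₂e₃`, good reduction the remaining odd primes, and `solvable_two` the
prime `2`. -/
theorem Coeffs.OddAtTwo.classVec_mem_iff (he : e.OddAtTwo) (hsq : Squarefree (∏ i, p i))
    (hodd : Odd (∏ i, p i)) (hcop : IsCoprime ((∏ i, p i : ℕ) : ℤ) (e.e₁ * e.e₂ * e.e₃))
    (hres : ∀ (i : Fin k) (q : ℕ), q.Prime → q ≠ 2 → (q : ℤ) ∣ e.e₁ * e.e₂ * e.e₃ →
      IsSquare ((p i : ℕ) : ZMod q)) (v : Fin k ⊕ Fin k → ZMod 2) :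
    classVec p v ∈ (e.twist (∏ i, p i) hsq.ne_zero).Sel ↔
      (matM e p (∏ i, p i)).mulVec v = 0 := by
  have hsqd := isSquare_mul_divisorOf_add (p := p) (v ∘ Sum.inl) (v ∘ Sum.inr)
  have pos := divisorOf_pos p
  have dvd := divisorOf_dvd p
  have od : ∀ x, Odd (divisorOf p x) := fun x => by
    obtain ⟨c, hc⟩ := dvd x
    have : Odd ((∏ i, p i : ℕ) : ℤ) := by exact_mod_cast hodd
    rw [hc] at this
    exact (Int.odd_mul.1 this).1
  rw [classVec, classOf_mem_sel_iff (pos _).ne' (pos _).ne' (pos _).ne']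
  constructor
  · rintro ⟨-, h⟩
    funext i
    rcases i with i | i
    · exact ((solvable_divisorOf_iff hsq hodd hcop i v).1 (h.2 (p i))).1
    · exact ((solvable_divisorOf_iff hsq hodd hcop i v).1 (h.2 (p i))).2
  · intro h
    refine ⟨hsqd, ?_⟩
    have haway : (e.twist (∏ i, p i) hsq.ne_zero).SolvableAwayTwo (divisorOf p (v ∘ Sum.inl))
        (divisorOf p (v ∘ Sum.inr)) (divisorOf p (v ∘ Sum.inl + v ∘ Sum.inr)) := by
      constructor
      · have hR : ∀ x, IsSquare (divisorOf p x : ℝ) := fun x =>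
          ⟨√(divisorOf p x), (Real.mul_self_sqrt (Int.cast_nonneg (pos x).le)).symm⟩
        exact Coeffs.solvable_intCast.2 (hasPoint_of_isSquare (Int.cast_ne_zero.2 (pos _).ne')
          (Int.cast_ne_zero.2 (pos _).ne') (Int.cast_ne_zero.2 (pos _).ne') (hR _) (hR _) (hR _))
      · intro q hq hq2
        by_cases hqn : (q : ℤ) ∣ ((∏ i, p i : ℕ) : ℤ)
        · rw [Int.natCast_dvd_natCast,
            Prime.dvd_finsetProd_iff (Fact.out : q.Prime).prime] at hqn
          obtain ⟨i, -, hi⟩ := hqn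
          obtain rfl := (Nat.prime_dvd_prime_iff_eq Fact.out Fact.out).1 hi
          exact (solvable_divisorOf_iff hsq hodd hcop i v).2 ⟨congrFun h _, congrFun h _⟩
        have hq1 : ∀ x, ¬ (q : ℤ) ∣ divisorOf p x := fun x h' => hqn (h'.trans (dvd x))
        by_cases hqe : (q : ℤ) ∣ e.e₁ * e.e₂ * e.e₃
        · have hQ : ∀ x, IsSquare (divisorOf p x : ℚ_[q]) := fun x =>
            isSquare_int_of_residue hq2 (hq1 x)
              (isSquare_zmod_of_dvd hsq (fun i => hres i q Fact.out hq2 hqe) (pos x) (dvd x))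
          exact Coeffs.solvable_intCast.2 (hasPoint_of_isSquare (intCast_padic_ne_zero (hq1 _))
            (intCast_padic_ne_zero (hq1 _)) (intCast_padic_ne_zero (hq1 _)) (hQ _) (hQ _) (hQ _))
        · refine Coeffs.solvable_of_good _ hq2 ?_ (hq1 _) (hq1 _) (hq1 _) hsqd
          -- The product of the twisted coefficients is `e₁e₂e₃n³`.
          have := prime_not_dvd_mul hqe
            (prime_not_dvd_mul hqn (prime_not_dvd_mul hqn hqn))
          convert this using 2
          simp only [Coeffs.twist]
          ring
    exact Coeffs.everywhereSolvable_iff.2 ⟨haway,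
      (he.twist hsq.ne_zero hodd).solvable_two (od _) (od _) (od _) hsqd haway⟩

/-- Modulo torsion, every Selmer class of the twist comes from positive divisors of `n`. -/
theorem Coeffs.OddAtTwo.exists_classVec (he : e.OddAtTwo) (hsq : Squarefree (∏ i, p i))
    (hodd : Odd (∏ i, p i)) (hcop : IsCoprime ((∏ i, p i : ℕ) : ℤ) (e.e₁ * e.e₂ * e.e₃))
    (hres : ∀ (i : Fin k) (q : ℕ), q.Prime → q ≠ 2 → (q : ℤ) ∣ e.e₁ * e.e₂ * e.e₃ →
      IsSquare ((p i : ℕ) : ZMod q))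
    (hSel : Nonempty (e.Sel ≃* Multiplicative (ZMod 2 × ZMod 2)))
    {L : SqClass ℚ × SqClass ℚ × SqClass ℚ} (hL : L ∈ (e.twist (∏ i, p i) hsq.ne_zero).Sel) :
    ∃ v, L * classVec p v = 1 ∨ L * classVec p v = (e.twist (∏ i, p i) hsq.ne_zero).classT ∨
      L * classVec p v = (e.twist (∏ i, p i) hsq.ne_zero).classS ∨
      L * classVec p v = (e.twist (∏ i, p i) hsq.ne_zero).classT
        * (e.twist (∏ i, p i) hsq.ne_zero).classS := by
  obtain ⟨d₁, d₂, d₃, s₁, s₂, s₃, o₁, o₂, o₃, hd, hLd⟩ :=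
    (he.twist hsq.ne_zero hodd).exists_odd_rep hL
  obtain ⟨b₁, b₂, b₃, ⟨p₁, q₁⟩, ⟨p₂, q₂⟩, ⟨p₃, -⟩, hb, hdb⟩ := he.classOf_eq_of_odd hSel hsq.ne_zero
    (fun q hq hq2 hqe b hb hbn => ⟨fun h => prime_not_dvd_of_coprime hq hcop hqe (h.trans hbn),
      isSquare_zmod_of_dvd hsq (fun i => hres i q hq hq2 hqe) hb hbn⟩) s₁ s₂ s₃ o₁ o₂ o₃ hd
  rw [classOf_eq_classVec hsq p₁ q₁ p₂ q₂ p₃ hb] at hdb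
  generalize valVec p b₁ b₂ = v at hdb
  have ee := sq_class_triple_mul_self
  have hT := classT_twist e (p := p) hsq.ne_zero
  generalize (e.twist (∏ i, p i) hsq.ne_zero).classT = T at hT ⊢
  generalize (e.twist (∏ i, p i) hsq.ne_zero).classS = S at hLd ⊢
  generalize classOf d₁ d₂ d₃ = D at hdb hLd
  have hT' : e.classT = T * classVec p 1 := by rw [hT, mul_assoc, ee, mul_one]
  rcases hdb with rfl | rfl
  · refine ⟨v, ?_⟩
    rcases hLd with rfl | rfl
    · exact Or.inl (ee _)
    · right; right; left
      rw [mul_right_comm, ee, one_mul]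
  -- The shift by the all-ones vector replaces the class `T` of `E` by that of the twist.
  · refine ⟨v + 1, ?_⟩
    rw [classVec_add]
    have key : classVec p v * e.classT * (classVec p v * classVec p 1) = T := by
      rw [hT', mul_mul_mul_comm, ee, one_mul, mul_assoc, ee, mul_one]
    rcases hLd with rfl | rfl
    · exact Or.inr (Or.inl key)
    · right; right; right
      rw [mul_right_comm, key]

/-- Distinct triples of positive divisors of `n` are distinct modulo torsion. -/
theorem Coeffs.OddAtTwo.eq_zero_of_classVec (he : e.OddAtTwo) (hsq : Squarefree (∏ i, p i))
    (hodd : Odd (∏ i, p i)) (hcop : IsCoprime ((∏ i, p i : ℕ) : ℤ) (e.e₁ * e.e₂ * e.e₃))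
    {v : Fin k ⊕ Fin k → ZMod 2}
    (h : classVec p v = 1 ∨ classVec p v = (e.twist (∏ i, p i) hsq.ne_zero).classT ∨
      classVec p v = (e.twist (∏ i, p i) hsq.ne_zero).classS ∨
      classVec p v = (e.twist (∏ i, p i) hsq.ne_zero).classT
        * (e.twist (∏ i, p i) hsq.ne_zero).classS) : v = 0 := by
  have he' := he.twist hsq.ne_zero hodd
  have pos := divisorOf_pos p
  have dvd := divisorOf_dvd p
  have od : ∀ x, Odd (divisorOf p x) := fun x => by
    obtain ⟨c, hc⟩ := dvd x
    have : Odd ((∏ i, p i : ℕ) : ℤ) := by exact_mod_cast hodd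
    rw [hc] at this
    exact (Int.odd_mul.1 this).1
  have hp := injective_of_squarefree hsq
  rcases h with h | h | h | h
  · rw [classVec, ← classOf_one, classOf_eq_iff (pos _).ne' (pos _).ne' (pos _).ne' one_ne_zero
      one_ne_zero one_ne_zero] at h
    simp only [mul_one] at h
    have h1 := eq_zero_of_isSquare_divisorOf hp h.1
    have h2 := eq_zero_of_isSquare_divisorOf hp h.2.1
    funext i
    rcases i with i | i
    · exact congrFun h1 i
    · exact congrFun h2 i
  · exfalso
    -- Multiplying by the class of the all-ones vector turns the equality into one between `T` of
    -- `E` and a triple of positive divisors of `n`. These are coprime to `e₁` and `e₂`, so `e₂` and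
    -- `-e₁` would be squares, which is impossible modulo `4`.
    rw [classT_twist, ← mul_one (classVec p v), ← sq_class_triple_mul_self (classVec p 1),
      ← mul_assoc, mul_left_inj, ← classVec_add, classVec, Coeffs.classT,
      classOf_eq_iff (pos _).ne' (pos _).ne' (pos _).ne' e.ne₂ (neg_ne_zero.2 e.ne₁)
      (neg_ne_zero.2 (mul_ne_zero e.ne₁ e.ne₂))] at h
    have c₁ : IsCoprime ((∏ i, p i : ℕ) : ℤ) (-e.e₁) :=
      (IsCoprime.of_mul_right_left (IsCoprime.of_mul_right_left hcop)).neg_right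
    have c₂ : IsCoprime ((∏ i, p i : ℕ) : ℤ) e.e₂ :=
      IsCoprime.of_mul_right_right (IsCoprime.of_mul_right_left hcop)
    have q₂ := (isSquare_of_isCoprime (pos _) (c₂.of_isCoprime_of_dvd_left (dvd _)) h.1).2
    have q₁ := (isSquare_of_isCoprime (pos _) (c₁.of_isCoprime_of_dvd_left (dvd _)) h.2.1).2
    have m₂ := emod_four_of_odd_of_isSquare he.2.1 q₂
    have m₁ := emod_four_of_odd_of_isSquare he.1.neg q₁
    have := e.sum_eq
    have := he.2.2.2
    omega
  · exact absurd h.symm (he'.classS_ne (od _))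
  · exact absurd h.symm (he'.classT_mul_classS_ne (od _))

/-- The homomorphism from the kernel of the matrix to the pure Selmer group. -/
noncomputable def kernelToPureSel (hsq : Squarefree (∏ i, p i))
    (hmem : ∀ v, classVec p v ∈ (e.twist (∏ i, p i) hsq.ne_zero).Sel ↔
      (matM e p (∏ i, p i)).mulVec v = 0) :
    Multiplicative (LinearMap.ker (Matrix.toLin' (matM e p (∏ i, p i)))) →*
      (e.twist (∏ i, p i) hsq.ne_zero).PureSel :=
  MonoidHom.mk' (fun v => QuotientGroup.mk ⟨classVec p v.toAdd.1, (hmem _).2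
    (mem_ker_toLin'_iff.1 v.toAdd.2)⟩) fun v w => by
      rw [← QuotientGroup.mk_mul]
      congr 1
      exact Subtype.ext (classVec_add _ _)

theorem Coeffs.OddAtTwo.kernelToPureSel_bijective (he : e.OddAtTwo) (hsq : Squarefree (∏ i, p i))
    (hodd : Odd (∏ i, p i)) (hcop : IsCoprime ((∏ i, p i : ℕ) : ℤ) (e.e₁ * e.e₂ * e.e₃))
    (hres : ∀ (i : Fin k) (q : ℕ), q.Prime → q ≠ 2 → (q : ℤ) ∣ e.e₁ * e.e₂ * e.e₃ →
      IsSquare ((p i : ℕ) : ZMod q))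
    (hSel : Nonempty (e.Sel ≃* Multiplicative (ZMod 2 × ZMod 2))) :
    Function.Bijective (kernelToPureSel hsq (he.classVec_mem_iff hsq hodd hcop hres)) := by
  have he' := he.twist hsq.ne_zero hodd
  have hmem := he.classVec_mem_iff hsq hodd hcop hres
  constructor
  · rw [injective_iff_map_eq_one]
    intro v hv
    have h1 := (he'.mem_torsion_iff).1 ((QuotientGroup.eq_one_iff _).1 hv)
    have h2 := he.eq_zero_of_classVec hsq hodd hcop h1
    exact Multiplicative.toAdd.injective (Subtype.ext h2)
  · intro c
    obtain ⟨L, rfl⟩ := QuotientGroup.mk_surjective c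
    obtain ⟨v, hv⟩ := he.exists_classVec hsq hodd hcop hres hSel L.2
    have hvm : classVec p v ∈ (e.twist (∏ i, p i) hsq.ne_zero).Sel := by
      have h1 : L.1 * classVec p v ∈ (e.twist (∏ i, p i) hsq.ne_zero).Sel := by
        rcases hv with h | h | h | h <;> rw [h]
        · exact one_mem _
        · exact Coeffs.classT_mem _
        · exact Coeffs.classS_mem _
        · exact mul_mem (Coeffs.classT_mem _) (Coeffs.classS_mem _)
      exact (Subgroup.mul_mem_cancel_left _ L.2).1 h1
    refine ⟨Multiplicative.ofAdd ⟨v, mem_ker_toLin'_iff.2 ((hmem v).1 hvm)⟩, ?_⟩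
    refine QuotientGroup.eq.2 ((he'.mem_torsion_iff).2 ?_)
    have hinv : (classVec p v)⁻¹ = classVec p v :=
      inv_eq_of_mul_eq_one_left (sq_class_triple_mul_self _)
    change (classVec p v)⁻¹ * L.1 = 1 ∨ (classVec p v)⁻¹ * L.1 = _ ∨ (classVec p v)⁻¹ * L.1 = _ ∨
      (classVec p v)⁻¹ * L.1 = _
    rw [hinv, mul_comm]
    exact hv

end Main

end TwoDescent

theorem mainTheorem5 (e : TwoDescent.Coeffs) (he₁ : Odd e.e₁) (he₂ : Odd e.e₂)
    (he₃ : (2 : ℤ) ∣ e.e₃ ∧ ¬ (4 : ℤ) ∣ e.e₃)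
    (n k : ℕ) (p : Fin k → ℕ) [∀ i, Fact (p i).Prime] (hn : n = ∏ i, p i)
    (hodd : Odd n) (hsq : Squarefree n)
    (hcop : IsCoprime (n : ℤ) (e.e₁ * e.e₂ * e.e₃))
    (hres : ∀ (i : Fin k) (q : ℕ), q.Prime → q ≠ 2 → (q : ℤ) ∣ e.e₁ * e.e₂ * e.e₃ →
      IsSquare ((p i : ℕ) : ZMod q))
    (hSel : Nonempty (e.Sel ≃* Multiplicative (ZMod 2 × ZMod 2))) :
    -- every class of the pure Selmer group of the twist has a unique representative
    -- by positive divisors of `n`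
    (∀ c : (e.twist n hsq.ne_zero).PureSel, ∃! d : ℤ × ℤ × ℤ,
      (0 < d.1 ∧ d.1 ∣ n) ∧ (0 < d.2.1 ∧ d.2.1 ∣ n) ∧ (0 < d.2.2 ∧ d.2.2 ∣ n) ∧
      ∃ h : TwoDescent.classOf d.1 d.2.1 d.2.2 ∈ (e.twist n hsq.ne_zero).Sel,
        (QuotientGroup.mk ⟨_, h⟩ : (e.twist n hsq.ne_zero).PureSel) = c) ∧
    -- `(d₁, d₂, d₃) ↦ (x, y)` on these representatives is an isomorphism onto the kernel
    (∃ φ : (e.twist n hsq.ne_zero).PureSel ≃*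
        Multiplicative (LinearMap.ker (Matrix.toLin' (TwoDescent.matM e p n))),
      ∀ d₁ d₂ d₃ : ℤ, 0 < d₁ → d₁ ∣ n → 0 < d₂ → d₂ ∣ n → 0 < d₃ → d₃ ∣ n →
        ∀ h : TwoDescent.classOf d₁ d₂ d₃ ∈ (e.twist n hsq.ne_zero).Sel,
          ((φ (QuotientGroup.mk ⟨_, h⟩)).toAdd : Fin k ⊕ Fin k → ZMod 2) =
            TwoDescent.valVec p d₁ d₂) ∧
    -- for odd `dᵢ`, solvability at all other places implies solvability at `2`
    (∀ d₁ d₂ d₃ : ℤ, Odd d₁ → Odd d₂ → Odd d₃ →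
      Squarefree d₁ → Squarefree d₂ → Squarefree d₃ → IsSquare (d₁ * d₂ * d₃) →
      (e.twist n hsq.ne_zero).Solvable ℝ d₁ d₂ d₃ →
      (∀ (q : ℕ) [Fact q.Prime], q ≠ 2 → (e.twist n hsq.ne_zero).Solvable ℚ_[q] d₁ d₂ d₃) →
      (e.twist n hsq.ne_zero).Solvable ℚ_[2] d₁ d₂ d₃) := by
  subst hn
  have he : e.OddAtTwo := ⟨he₁, he₂, he₃⟩
  have hmem := he.classVec_mem_iff hsq hodd hcop hres
  have hbij := he.kernelToPureSel_bijective hsq hodd hcop hres hSel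
  set Ψ := TwoDescent.kernelToPureSel hsq hmem with hΨ
  have hΨv : ∀ (v) (hv : v ∈ LinearMap.ker (Matrix.toLin' (TwoDescent.matM e p (∏ i, p i))))
      (h : TwoDescent.classVec p v ∈ (e.twist (∏ i, p i) hsq.ne_zero).Sel),
      Ψ (Multiplicative.ofAdd ⟨v, hv⟩) = QuotientGroup.mk ⟨_, h⟩ := fun v hv h => rfl
  have hrep : ∀ d₁ d₂ d₃ : ℤ, 0 < d₁ → d₁ ∣ (∏ i, p i : ℕ) → 0 < d₂ → d₂ ∣ (∏ i, p i : ℕ) → 0 < d₃ →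
      ∀ h : TwoDescent.classOf d₁ d₂ d₃ ∈ (e.twist (∏ i, p i) hsq.ne_zero).Sel,
      ∃ w, (w.toAdd : Fin k ⊕ Fin k → ZMod 2) = TwoDescent.valVec p d₁ d₂ ∧
        Ψ w = QuotientGroup.mk ⟨_, h⟩ := by
    intro d₁ d₂ d₃ h₁ h₁' h₂ h₂' h₃ h
    have hd := ((TwoDescent.classOf_mem_sel_iff h₁.ne' h₂.ne' h₃.ne').1 h).1
    have hc := TwoDescent.classOf_eq_classVec hsq h₁ h₁' h₂ h₂' h₃ hd
    have h' := h
    rw [hc] at h'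
    refine ⟨Multiplicative.ofAdd ⟨_, TwoDescent.mem_ker_toLin'_iff.2 ((hmem _).1 h')⟩, rfl, ?_⟩
    rw [hΨv _ _ h']
    congr 1
    exact Subtype.ext hc.symm
  -- The isomorphism is built from the kernel to the pure Selmer group, where it is given by a
  -- formula; `φ` is its inverse.
  refine ⟨fun c => ?_, ⟨(MulEquiv.ofBijective Ψ hbij).symm, ?_⟩, ?_⟩
  · obtain ⟨v, rfl⟩ := hbij.2 c
    refine ⟨(TwoDescent.divisorOf p (v.toAdd.1 ∘ Sum.inl),
      TwoDescent.divisorOf p (v.toAdd.1 ∘ Sum.inr),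
      TwoDescent.divisorOf p (v.toAdd.1 ∘ Sum.inl + v.toAdd.1 ∘ Sum.inr)),
      ⟨⟨TwoDescent.divisorOf_pos p _, TwoDescent.divisorOf_dvd p _⟩,
        ⟨TwoDescent.divisorOf_pos p _, TwoDescent.divisorOf_dvd p _⟩,
        ⟨TwoDescent.divisorOf_pos p _, TwoDescent.divisorOf_dvd p _⟩,
        (hmem v.toAdd.1).2 (TwoDescent.mem_ker_toLin'_iff.1 v.toAdd.2), rfl⟩, ?_⟩
    rintro ⟨d₁, d₂, d₃⟩ ⟨⟨h₁, h₁'⟩, ⟨h₂, h₂'⟩, ⟨h₃, h₃'⟩, h, hc⟩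
    obtain ⟨w, hw, hwΨ⟩ := hrep d₁ d₂ d₃ h₁ h₁' h₂ h₂' h₃ h
    obtain rfl : w = v := hbij.1 (hwΨ.trans hc)
    have hd := ((TwoDescent.classOf_mem_sel_iff h₁.ne' h₂.ne' h₃.ne').1 h).1
    have e₁ : d₁ = TwoDescent.divisorOf p (w.toAdd.1 ∘ Sum.inl) := by
      rw [hw]
      exact (TwoDescent.divisorOf_padicValInt hsq h₁ h₁').symm
    have e₂ : d₂ = TwoDescent.divisorOf p (w.toAdd.1 ∘ Sum.inr) := by
      rw [hw]
      exact (TwoDescent.divisorOf_padicValInt hsq h₂ h₂').symm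
    -- The exponent vector records only `d₁` and `d₂`; `d₃` is recovered from its square class,
    -- being a positive divisor of the squarefree `n`.
    have e₃ : d₃ = TwoDescent.divisorOf p (w.toAdd.1 ∘ Sum.inl + w.toAdd.1 ∘ Sum.inr) := by
      have hcc := TwoDescent.classOf_eq_classVec hsq h₁ h₁' h₂ h₂' h₃ hd
      rw [← hw] at hcc
      exact TwoDescent.eq_divisorOf_of_sq_eq hsq h₃ h₃' (congrArg (fun c => c.2.2) hcc)
    simp only [Prod.mk.injEq]
    exact ⟨e₁, e₂, e₃⟩
  · intro d₁ d₂ d₃ h₁ h₁' h₂ h₂' h₃ _ h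
    obtain ⟨w, hw, hwΨ⟩ := hrep d₁ d₂ d₃ h₁ h₁' h₂ h₂' h₃ h
    rw [← hw, ← hwΨ]
    congr 2
    exact (MulEquiv.ofBijective Ψ hbij).symm_apply_apply w
  · intro d₁ d₂ d₃ o₁ o₂ o₃ _ _ _ hd hR hq
    exact (he.twist hsq.ne_zero hodd).solvable_two o₁ o₂ o₃ hd ⟨hR, hq⟩
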